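/- **Setting.** Let $d\in\{2,3\}$ and let $\Omega\subset\mathbb R^d$ be a bounded domain with Lipschitz boundary $\Gamma=\overline{\Gamma}_D\cup\overline{\Gamma}_N$, where $\Gamma_D,\Gamma_N\subset\Gamma$ are (Borel) sets with $\Gamma_D\cap\Gamma_N=\emptyset$. Let $\varepsilon>0$ be constant, $\beta\in[W^{1,\infty}(\Omega)]^d$ (taken continuous on $\overline\Omega$), $0\le\sigma\in L^\infty(\Omega)$, $f\in L^2(\Omega)$, $g\in L^2(\Gamma_N)$, and consider $$-\varepsilon\Delta u+\beta\cdot\nabla u+\sigma u=f\ \text{in }\Omega,\qquad u=0\ \text{on }\Gamma_D,\qquad \varepsilon\nabla u\cdot\mathbf n=g\ \text{on }\Gamma_N .$$ Assume: (A1) $\Gamma_D$ has positive surface measure and contains the inflow boundary $\{x\in\Gamma:\beta(x)\cdot\mathbf n<0\}$; (A2) there are constants $\gamma,c_\sigma\ge0$ with $\sigma-\frac12\nabla\cdot\beta\ge\gamma$ a.e. in $\Omega$ and $\|\sigma\|_{0,\infty}\le c_\sigma\gamma$. Here $\|\cdot\|_{0,S}$ and $\|\cdot\|_{0,\infty,S}$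 are the norms of $L^2(S)$ and $L^\infty(S)$ (with the Euclidean norm of vectors), $|v|_{1,S}=\|\nabla v\|_{0,S}$, $\|v\|_1^2=\|v\|_0^2+|v|_1^2$, the index $S$ is omitted if $S=\Omega$, and $H^1_D(\Omega)=\{v\in H^1(\Omega):v|_{\Gamma_D}=0\}$. **Scheme.** Let $\mathcal T_h$ be a conforming triangulation of $\Omega$ into closed simplices, $h_T=\operatorname{diam}T$, $h=\max_Th_T$. Let $V_h^D$ be the space of continuous functions on $\overline\Omega$ that are affine on each $T\in\mathcal T_h$ and vanish (a.e.) on $\Gamma_D$; let $\psi_T$ be the product of the barycentric coordinates of $T$, extended by $0$; $V_b=\operatorname{span}\{\psi_T:T\in\mathcal T_h\}$ and $V_{hb}^D=V_h^D\oplus V_b$. For $w_h\in V_h^D$ put $R(w_h)=\beta\cdot\nabla w_h+\sigma w_h-f$ and $$\xi_T(w_h)=\begin{cases}\dfrac{h_T\|R(w_h)\|_{0,T}}{\|\beta\|_{0,\infty,T}|w_h|_{1,T}+\|\sigma\|_{0,\infty,T}\|w_h\|_{0,T}+\tau_T}&\text{if }\dfrac{\|\beta\|_{0,T}h_T}{2\varepsilon}>1,\\[2mm]0&\text{otherwise,}\end{cases}\qquad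 \tau_T=\begin{cases}\|f\|_{0,T}&\text{if }f|_T\ne0,\\1&\text{if }f|_T=0.\end{cases}$$ The modified dynamic diffusion (DD) scheme is: find $u_{hb}=u_h+u_b\in V_{hb}^D$, with $u_h\in V_h^D$ and $u_b\in V_b$, such that for all $v\in V_{hb}^D$ $$\varepsilon(\nabla u_{hb},\nabla v)+(\beta\cdot\nabla u_{hb},v)+(\sigma u_{hb},v)+\sum_{T\in\mathcal T_h}\int_T\xi_T(u_h)\nabla u_{hb}\cdot\nabla v\,dx=(f,v)+\int_{\Gamma_N}g\,v\,ds .$$ **Constants.** Let $c_0,c_1,c_3$ be the smallest constants such that $\|v\|_0\le c_0|v|_1$ and $\|v\|_1\le c_3|v|_1$ for all $v\in H^1_D(\Omega)$, and $\|v_h\|_{0,T}\le c_1\|v_h+v_b\|_{0,T}$ for all simplices $T\subset\mathbb R^d$, all affine $v_h$ and all $v_b\in\operatorname{span}\{\psi_T\}$; thus $c_0,c_3$ depend only on $\Omega,\Gamma_D$, and $c_1$ only on $d$. Let $\|\cdot\|_{H^{-1/2}(\Gamma_N)}$ be the dual norm of $H^{1/2}(\Gamma_N)$, the space of traces on $\Gamma_N$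 of functions in $H^1(\Omega)$ with the quotient norm $\|s\|_{H^{1/2}(\Gamma_N)}=\inf\{\|v\|_1:v\in H^1(\Omega),\ v|_{\Gamma_N}=s\}$. Put $$D(f,g)=\frac{\|f\|_0}{\max\{\sqrt\gamma,\sqrt\varepsilon/c_0\}}+\frac{c_3}{\sqrt\varepsilon}\|g\|_{H^{-1/2}(\Gamma_N)},\qquad M_4=\max_{T\in\mathcal T_h}\frac{2\sqrt2\max\{1,c_1\}M_{3,T}}{\tau_T},$$ where $M_{3,T}=\max\{\|\beta\|_{0,\infty,T}/\sqrt\varepsilon,\ \|\sigma\|_{0,\infty,T}/\sqrt\gamma\}$ if $\gamma>0$ and $M_{3,T}=\|\beta\|_{0,\infty,T}/\sqrt\varepsilon$ if $\gamma=0$. **Theorem.** If $h<\varepsilon\,D(f,g)^{-1}M_4^{-1}$ (where $0^{-1}=+\infty$), then the modified DD scheme has exactly one solution $u_{hb}\in V_{hb}^D$. -/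

import Mathlib

open MeasureTheory Filter Topology Set
open scoped ENNReal NNReal ContDiff InnerProductSpace

noncomputable section

namespace DD

/-- The Euclidean space `ℝ^d`. -/
abbrev E (d : ℕ) : Type := EuclideanSpace ℝ (Fin d)

variable {d : ℕ}

/-! ### Domains, surface measure, outward normals -/

/-- A bounded domain (connected open set) with Lipschitz boundary: near each boundary point, `Ω` is
the set of points strictly above the graph, in some unit direction `e`, of a Lipschitz function `φ`
of the coordinates orthogonal to `e`. -/
structure IsLipschitzDomain (Ω : Set (E d)) : Prop where
  isOpen : IsOpen Ω
  isConnected : IsConnected Ω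
  isBounded : Bornology.IsBounded Ω
  lipschitz_boundary : ∀ x ∈ frontier Ω, ∃ (e : E d) (φ : E d → ℝ) (K : ℝ≥0),
    ‖e‖ = 1 ∧ LipschitzWith K φ ∧ (∀ (y : E d) (t : ℝ), φ (y + t • e) = φ y) ∧
      ∀ᶠ y in 𝓝 x, (y ∈ Ω ↔ φ y < ⟪e, y⟫_ℝ)

/-- The `(d-1)`-dimensional surface measure: the Hausdorff measure, normalized so that it agrees
with Lebesgue measure on hyperplanes. -/
def surf (d : ℕ) : Measure (E d) := Measure.euclideanHausdorffMeasure (d - 1)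

/-- `n` is the outward unit normal of `Ω` at the boundary point `x`: to first order at `x`, the set
`Ω` is the half space `{y | ⟪n, y - x⟫ < 0}`. -/
def IsOutwardNormal (Ω : Set (E d)) (x n : E d) : Prop :=
  ‖n‖ = 1 ∧ ∀ η : ℝ, 0 < η → ∀ᶠ y in 𝓝 x,
    (⟪n, y - x⟫_ℝ < -(η * ‖y - x‖) → y ∈ Ω) ∧ (η * ‖y - x‖ < ⟪n, y - x⟫_ℝ → y ∉ Ω)

/-! ### Norms and Sobolev spaces -/

/-- The norm `‖u‖_{0,S}` of `L²(S)`, with values in `[0, ∞]`. -/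
def L2 {F : Type*} [NormedAddCommGroup F] (S : Set (E d)) (u : E d → F) : ℝ≥0∞ :=
  eLpNorm u 2 (volume.restrict S)

/-- The norm `‖u‖_{0,∞,S}` of `L^∞(S)`, with values in `[0, ∞]`. -/
def Linf {F : Type*} [NormedAddCommGroup F] (S : Set (E d)) (u : E d → F) : ℝ≥0∞ :=
  eLpNorm u ∞ (volume.restrict S)

/-- `G` is the weak gradient of `u` in `Ω`. -/
def HasWeakGrad (Ω : Set (E d)) (u : E d → ℝ) (G : E d → E d) : Prop :=
  LocallyIntegrableOn u Ω ∧ LocallyIntegrableOn G Ω ∧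
    ∀ φ : E d → ℝ, ContDiff ℝ ∞ φ → HasCompactSupport φ → tsupport φ ⊆ Ω →
      ∫ x in Ω, u x • gradient φ x = -∫ x in Ω, φ x • G x

/-- `u ∈ H¹(Ω)`, with weak gradient `G`. -/
def MemH1 (Ω : Set (E d)) (u : E d → ℝ) (G : E d → E d) : Prop :=
  MemLp u 2 (volume.restrict Ω) ∧ MemLp G 2 (volume.restrict Ω) ∧ HasWeakGrad Ω u G

/-- `u ∈ W^{1,∞}(Ω)`, with weak gradient `G`. -/
def MemW1inf (Ω : Set (E d)) (u : E d → ℝ) (G : E d → E d) : Prop :=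
  MemLp u ∞ (volume.restrict Ω) ∧ MemLp G ∞ (volume.restrict Ω) ∧ HasWeakGrad Ω u G

/-- The norm `‖u‖₁` of a function `u ∈ H¹(Ω)` with weak gradient `G`. -/
def H1norm (Ω : Set (E d)) (u : E d → ℝ) (G : E d → E d) : ℝ≥0∞ :=
  (L2 Ω u ^ 2 + L2 Ω G ^ 2) ^ (1 / 2 : ℝ)

/-- `t ∈ L²(∂Ω)` is the trace of the function `u ∈ H¹(Ω)` with weak gradient `G`: the trace operator
is the continuous extension of the restriction `w ↦ w|_{∂Ω}` from `H¹(Ω) ∩ C(closure Ω)`. -/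
def IsTrace (Ω : Set (E d)) (u : E d → ℝ) (G : E d → E d) (t : E d → ℝ) : Prop :=
  MemLp t 2 ((surf d).restrict (frontier Ω)) ∧
    ∃ (w : ℕ → E d → ℝ) (H : ℕ → E d → E d),
      (∀ n, MemH1 Ω (w n) (H n) ∧ ContinuousOn (w n) (closure Ω)) ∧
      Tendsto (fun n => L2 Ω (w n - u)) atTop (𝓝 0) ∧
      Tendsto (fun n => L2 Ω (H n - G)) atTop (𝓝 0) ∧
      Tendsto (fun n => eLpNorm (w n - t) 2 ((surf d).restrict (frontier Ω))) atTop (𝓝 0)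

/-- `u ∈ H¹_D(Ω)`, with weak gradient `G`: the trace of `u` vanishes on `ΓD`. -/
def MemH1D (Ω ΓD : Set (E d)) (u : E d → ℝ) (G : E d → E d) : Prop :=
  MemH1 Ω u G ∧ ∃ t, IsTrace Ω u G t ∧ t =ᵐ[(surf d).restrict ΓD] 0

/-- The norm of `H^{1/2}(ΓN)`, the space of traces on `ΓN` of functions of `H¹(Ω)`, with the
quotient norm (the value is `∞` if `s` is not such a trace). -/
def Hhalf (Ω ΓN : Set (E d)) (s : E d → ℝ) : ℝ≥0∞ :=
  ⨅ (u : E d → ℝ) (G : E d → E d) (t : E d → ℝ) (_ : MemH1 Ω u G) (_ : IsTrace Ω u G t)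
    (_ : t =ᵐ[(surf d).restrict ΓN] s), H1norm Ω u G

/-- The dual norm `‖g‖_{H^{-1/2}(ΓN)}`, for the pairing `(g, s)_{ΓN} = ∫_{ΓN} g s`. -/
def HnegHalf (Ω ΓN : Set (E d)) (g : E d → ℝ) : ℝ≥0∞ :=
  ⨆ s : E d → ℝ, ‖∫ x in ΓN, g x * s x ∂(surf d)‖ₑ / Hhalf Ω ΓN s

/-! ### The constants `c₀`, `c₁`, `c₃`

Each is the smallest constant in the inequality that it stands for. -/

/-- `c₀`: the smallest constant with `‖v‖₀ ≤ c₀ |v|₁` for all `v ∈ H¹_D(Ω)`. -/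
def c0 (Ω ΓD : Set (E d)) : ℝ≥0∞ :=
  sInf {c : ℝ≥0∞ | ∀ v G, MemH1D Ω ΓD v G → L2 Ω v ≤ c * L2 Ω G}

/-- `c₃`: the smallest constant with `‖v‖₁ ≤ c₃ |v|₁` for all `v ∈ H¹_D(Ω)`. -/
def c3 (Ω ΓD : Set (E d)) : ℝ≥0∞ :=
  sInf {c : ℝ≥0∞ | ∀ v G, MemH1D Ω ΓD v G → H1norm Ω v G ≤ c * L2 Ω G}

/-- A nondegenerate `d`-simplex in `ℝ^d`, given by its vertices. -/
abbrev Cell (d : ℕ) : Type := AffineBasis (Fin (d + 1)) ℝ (E d)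

/-- The closed simplex `T`. -/
def Cell.carrier (T : Cell d) : Set (E d) := convexHull ℝ (range T)

open Classical in
/-- The bubble function `ψ_T` of degree `d + 1`: the product of the barycentric coordinates
on `T`, extended by zero. -/
def Cell.bubble (T : Cell d) : E d → ℝ :=
  fun x => if x ∈ T.carrier then ∏ i, T.coord i x else 0

/-- `h_T`, the diameter of `T`. -/
def Cell.diam (T : Cell d) : ℝ := Metric.diam T.carrier

/-- `c₁`: the smallest constant with `‖v_h‖_{0,T} ≤ c₁ ‖v_h + v_b‖_{0,T}` for all simplices `T`
of `ℝ^d`, all affine `v_h` and all `v_b ∈ span {ψ_T}`. -/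
def c1 (d : ℕ) : ℝ≥0∞ :=
  sInf {c : ℝ≥0∞ | ∀ (T : Cell d) (a : E d →ᵃ[ℝ] ℝ) (t : ℝ),
    L2 T.carrier (fun x => a x) ≤ c * L2 T.carrier (fun x => a x + t * T.bubble x)}

/-! ### Triangulations and finite element spaces -/

/-- A (conforming) triangulation of `Ω` into closed simplices. -/
structure Triangulation (Ω : Set (E d)) where
  cells : Finset (Cell d)
  cover : (⋃ T ∈ cells, T.carrier) = closure Ω
  disjoint_interior : ∀ S ∈ cells, ∀ T ∈ cells, S ≠ T →
    Disjoint (interior S.carrier) (interior T.carrier)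
  conforming : ∀ S ∈ cells, ∀ T ∈ cells,
    S.carrier ∩ T.carrier = convexHull ℝ (range S ∩ range T)

/-- The mesh size `h = max_T h_T`. -/
def Triangulation.meshSize {Ω : Set (E d)} (𝒯 : Triangulation Ω) : ℝ≥0∞ :=
  𝒯.cells.sup fun T => ENNReal.ofReal T.diam

/-- The linear element space `V_h`: continuous functions on `closure Ω`, affine on each `T`.
By convention the functions are extended by zero outside `closure Ω`. -/
def Vh {Ω : Set (E d)} (𝒯 : Triangulation Ω) : Submodule ℝ (E d → ℝ) where
  carrier := {v | ContinuousOn v (closure Ω) ∧ (∀ x ∉ closure Ω, v x = 0) ∧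
    ∀ T ∈ 𝒯.cells, ∃ a : E d →ᵃ[ℝ] ℝ, EqOn v a T.carrier}
  zero_mem' := ⟨continuousOn_const, fun _ _ => rfl, fun _ _ => ⟨0, fun _ _ => rfl⟩⟩
  add_mem' := by
    rintro u v ⟨hu, hu0, hua⟩ ⟨hv, hv0, hva⟩
    refine ⟨hu.add hv, fun x hx => by simp [hu0 x hx, hv0 x hx], fun T hT => ?_⟩
    obtain ⟨a, ha⟩ := hua T hT
    obtain ⟨b, hb⟩ := hva T hT
    exact ⟨a + b, fun x hx => by simp [ha hx, hb hx]⟩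
  smul_mem' := by
    rintro c v ⟨hv, hv0, hva⟩
    refine ⟨hv.const_smul c, fun x hx => by simp [hv0 x hx], fun T hT => ?_⟩
    obtain ⟨a, ha⟩ := hva T hT
    exact ⟨c • a, fun x hx => by simp [ha hx]⟩

/-- `V_h^D = V_h ∩ H¹_D(Ω)`: the functions of `V_h` whose trace on `ΓD`, which is their restriction
to `ΓD`, vanishes almost everywhere for the surface measure. -/
def VhD {Ω : Set (E d)} (𝒯 : Triangulation Ω) (ΓD : Set (E d)) : Submodule ℝ (E d → ℝ) where
  carrier := {v | v ∈ Vh 𝒯 ∧ v =ᵐ[(surf d).restrict ΓD] 0}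
  zero_mem' := ⟨(Vh 𝒯).zero_mem, EventuallyEq.rfl⟩
  add_mem' := by
    rintro u v ⟨hu, hu0⟩ ⟨hv, hv0⟩
    exact ⟨(Vh 𝒯).add_mem hu hv, by simpa using hu0.add hv0⟩
  smul_mem' := by
    rintro c v ⟨hv, hv0⟩
    exact ⟨(Vh 𝒯).smul_mem c hv, by simpa using hv0.const_smul c⟩

/-- The bubble space `V_b`, spanned by the bubble functions of the cells. -/
def Vb {Ω : Set (E d)} (𝒯 : Triangulation Ω) : Submodule ℝ (E d → ℝ) :=
  Submodule.span ℝ {ψ | ∃ T ∈ 𝒯.cells, ψ = T.bubble}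

/-- `V_{hb}^D = V_h^D ⊕ V_b` (the sum is direct since bubble functions vanish at the vertices). -/
def VhbD {Ω : Set (E d)} (𝒯 : Triangulation Ω) (ΓD : Set (E d)) : Submodule ℝ (E d → ℝ) :=
  VhD 𝒯 ΓD ⊔ Vb 𝒯

/-! ### The convection-diffusion-reaction problem -/

/-- The data of the problem `-ε Δu + β·∇u + σ u = f` in `Ω`, `u = 0` on `ΓD`, `ε ∇u·n = g` on `ΓN`,
together with the two constants `γ` and `cσ` of the assumption on `σ` and `β`. -/
structure Problem (d : ℕ) where
  Ω : Set (E d)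
  ΓD : Set (E d)
  ΓN : Set (E d)
  ε : ℝ
  β : E d → E d
  σ : E d → ℝ
  f : E d → ℝ
  g : E d → ℝ
  γ : ℝ
  cσ : ℝ

/-- The standing assumptions on the data. -/
structure Problem.Admissible (P : Problem d) : Prop where
  domain : IsLipschitzDomain P.Ω
  measurable_ΓD : MeasurableSet P.ΓD
  measurable_ΓN : MeasurableSet P.ΓN
  boundary : closure P.ΓD ∪ closure P.ΓN = frontier P.Ω
  disjoint : Disjoint P.ΓD P.ΓN
  ΓD_subset : P.ΓD ⊆ frontier P.Ω
  ΓN_subset : P.ΓN ⊆ frontier P.Ω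
  ε_pos : 0 < P.ε
  σ_mem : MemLp P.σ ∞ (volume.restrict P.Ω)
  σ_nonneg : ∀ᵐ x ∂(volume.restrict P.Ω), 0 ≤ P.σ x
  f_mem : MemLp P.f 2 (volume.restrict P.Ω)
  g_mem : MemLp P.g 2 ((surf d).restrict P.ΓN)
  /-- `β` is the representative that is continuous up to the boundary. -/
  β_cont : ContinuousOn P.β (closure P.Ω)
  /-- The Dirichlet boundary has positive surface measure. -/
  ΓD_pos : 0 < surf d P.ΓD
  /-- The Dirichlet boundary includes the inflow boundary. -/
  inflow : ∀ x ∈ frontier P.Ω, ∀ n, IsOutwardNormal P.Ω x n → ⟪P.β x, n⟫_ℝ < 0 → x ∈ P.ΓD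
  γ_nonneg : 0 ≤ P.γ
  cσ_nonneg : 0 ≤ P.cσ
  /-- `β ∈ W^{1,∞}(Ω)^d` (with weak gradients `Dβ i` of the components) and
  `σ - (1/2) ∇·β ≥ γ`. -/
  β_mem : ∃ Dβ : Fin d → E d → E d, (∀ i, MemW1inf P.Ω (fun x => P.β x i) (Dβ i)) ∧
    ∀ᵐ x ∂(volume.restrict P.Ω), P.γ ≤ P.σ x - 1 / 2 * ∑ i, Dβ i x i
  σ_le : Linf P.Ω P.σ ≤ ENNReal.ofReal (P.cσ * P.γ)

/-! ### The modified dynamic diffusion scheme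

All functions in `V_{hb}^D` are polynomials on each cell, so `gradient` is their (weak) gradient
almost everywhere. -/

/-- `B(u,v) = ε(∇u,∇v) + (β·∇u,v) + (σu,v)`. -/
def Problem.B (P : Problem d) (u v : E d → ℝ) : ℝ :=
  P.ε * (∫ x in P.Ω, ⟪gradient u x, gradient v x⟫_ℝ)
    + (∫ x in P.Ω, ⟪P.β x, gradient u x⟫_ℝ * v x)
    + ∫ x in P.Ω, P.σ x * u x * v x

/-- The residual `R(w) = β·∇w + σ w - f` of a function which is affine on each cell (so that
`Δ w = 0` there). -/
def Problem.R (P : Problem d) (w : E d → ℝ) : E d → ℝ :=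
  fun x => ⟪P.β x, gradient w x⟫_ℝ + P.σ x * w x - P.f x

/-- The Péclet number `‖β‖_{0,T} h_T / (2ε)`. -/
def Problem.Pe (P : Problem d) (T : Cell d) : ℝ :=
  (L2 T.carrier P.β).toReal * T.diam / (2 * P.ε)

/-- `A_T(w) = ‖β‖_{0,∞,T} |w|_{1,T} + ‖σ‖_{0,∞,T} ‖w‖_{0,T}`. -/
def Problem.A (P : Problem d) (T : Cell d) (w : E d → ℝ) : ℝ :=
  (Linf T.carrier P.β).toReal * (L2 T.carrier (gradient w)).toReal
    + (Linf T.carrier P.σ).toReal * (L2 T.carrier w).toReal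

open Classical in
/-- `τ = ‖f‖_{0,T}` if `f|_T ≠ 0`, and `τ = 1` if `f|_T = 0`. -/
def Problem.τ (P : Problem d) (T : Cell d) : ℝ≥0∞ :=
  if P.f =ᵐ[volume.restrict T.carrier] 0 then 1 else L2 T.carrier P.f

open Classical in
/-- The artificial diffusion `ξ_T(w)`. -/
def Problem.ξ (P : Problem d) (T : Cell d) (w : E d → ℝ) : ℝ :=
  if 1 < P.Pe T then
    T.diam * (L2 T.carrier (P.R w)).toReal / (P.A T w + (P.τ T).toReal)
  else 0

/-- `∫_T ξ_T(w_h) ∇u·∇v`, the value of `D_T(w; u, v)` at a `w` with resolved part `w_h`. -/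
def Problem.DT (P : Problem d) (T : Cell d) (wh u v : E d → ℝ) : ℝ :=
  ∫ x in T.carrier, P.ξ T wh * ⟪gradient u x, gradient v x⟫_ℝ

/-- `u = u_h + u_b ∈ V_{hb}^D` solves the modified DD scheme. -/
def Problem.IsSolution (P : Problem d) (𝒯 : Triangulation P.Ω) (u : E d → ℝ) : Prop :=
  ∃ uh ∈ VhD 𝒯 P.ΓD, ∃ ub ∈ Vb 𝒯, u = uh + ub ∧
    ∀ v ∈ VhbD 𝒯 P.ΓD,
      P.B u v + ∑ T ∈ 𝒯.cells, P.DT T uh u v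
        = (∫ x in P.Ω, P.f x * v x) + ∫ x in P.ΓN, P.g x * v x ∂(surf d)

/-! ### The constants in the smallness condition -/

/-- `√x` for `x ≥ 0`, as an element of `[0, ∞]`. -/
def esqrt (x : ℝ) : ℝ≥0∞ := ENNReal.ofReal (Real.sqrt x)

/-- `D(f,g) = ‖f‖₀ / max {√γ, √ε / c₀} + (c₃ / √ε) ‖g‖_{H^{-1/2}(ΓN)}`. -/
def Problem.D (P : Problem d) : ℝ≥0∞ :=
  L2 P.Ω P.f / max (esqrt P.γ) (esqrt P.ε / c0 P.Ω P.ΓD)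
    + c3 P.Ω P.ΓD / esqrt P.ε * HnegHalf P.Ω P.ΓN P.g

open Classical in
/-- `M_{3,T} = max {‖β‖_{0,∞,T} / √ε, ‖σ‖_{0,∞,T} / √γ}` if `γ > 0`, and `‖β‖_{0,∞,T} / √ε`
if `γ = 0`. -/
def Problem.M3 (P : Problem d) (T : Cell d) : ℝ≥0∞ :=
  if 0 < P.γ then max (Linf T.carrier P.β / esqrt P.ε) (Linf T.carrier P.σ / esqrt P.γ)
  else Linf T.carrier P.β / esqrt P.ε

/-- `M₄ = max_T M_{4,T}` with `M_{4,T} = 2 √2 max {1, c₁} M_{3,T} / τ`. -/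
def Problem.M4 (P : Problem d) (𝒯 : Triangulation P.Ω) : ℝ≥0∞ :=
  𝒯.cells.sup fun T => 2 * esqrt 2 * max 1 (c1 d) * P.M3 T / P.τ T

end DD

end

open scoped Convolution

namespace DD

variable {d : ℕ}

/-! ### Pointwise Lipschitz bounds -/

/-! Freeze the artificial diffusion at a function `w` and solve the resulting linear problem;
solutions of the scheme are the fixed points of this solution map, and the smallness of `h` makes
the map a contraction in the energy norm `|||v|||² = ε|v|₁² + γ‖v‖₀²`
(`existsUnique_of_contraction`).

The frozen form is coercive with constant `1`, whatever `w` is: the artificial diffusion is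
nonnegative, and convection plus reaction dominate `γ‖v‖₀²` (`convection_reaction_ge`). The load is
bounded by `D |||v|||` (`load_le`), so frozen solutions have energy norm at most `D`. The diffusion
is Lipschitz in `w`: on each cell `|ξ_T(w) - ξ_T(w')| ≤ h_T · 2A_T(w_h - w'_h)/τ` (`abs_ξ_sub_le`),
since `τ` bounds the denominator from below and the residual never exceeds the denominator. Moreover
`A_T` of the resolved part is controlled by the energy of the full function (`two_mul_A_div_le`):
bubble gradients have mean zero, so adding a bubble does not decrease the gradient norm, and `c₁`
handles the `L²` norm. The contraction constant is therefore `h M₄ D / ε`.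

The analytic core is the sign of the boundary term `½∫_Γ (β·n) v²` in the coercivity estimate,
obtained without a divergence theorem on `Ω`. The weak divergence of `β` is tested with `v²` times a
cutoff of the distance to the complement. Where a nearest boundary point lies on a single facet
hyperplane, the cutoff gradient is antiparallel to the outward normal there, and the flux of `v²β`
has the right sign up to a small oscillation. This happens in a layer of volume `O(δ)`, which
absorbs the factor `1/δ` of the cutoff gradient. The remaining points are close to two distinct
hyperplanes, a set of volume `O(δ²)`, hence negligible (`exists_flux_cutoff_le`).

The constants `c₀`, `c₁`, `c₃` take values in `[0, ∞]`; the finiteness that the estimates need is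
read off from the smallness condition. -/

/-- `f` satisfies a Lipschitz bound with constant `L` at the point `x`. -/
def PtLip (f : E d → ℝ) (L : ℝ) (x : E d) : Prop :=
  ∀ᶠ y in 𝓝 x, |f y - f x| ≤ L * ‖y - x‖

lemma PtLip.continuousAt {f : E d → ℝ} {L : ℝ} {x : E d} (h : PtLip f L x) :
    ContinuousAt f x := by
  have h1 : Tendsto (fun y => L * ‖y - x‖) (𝓝 x) (𝓝 0) := by
    have : Continuous fun y : E d => L * ‖y - x‖ := by fun_prop
    simpa using this.tendsto x
  have h2 : Tendsto (fun y => f y - f x) (𝓝 x) (𝓝 0) := by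
    rw [tendsto_zero_iff_abs_tendsto_zero]
    exact tendsto_of_tendsto_of_tendsto_of_le_of_le' tendsto_const_nhds h1
      (Eventually.of_forall fun y => abs_nonneg _) h
  exact tendsto_sub_nhds_zero_iff.1 h2

/-- The splitting `f y (g y - g x) + g x (f y - f x)` uses `f` near `x` but `g` only at `x`, whence
the asymmetric bounds. -/
lemma PtLip.mul {f g : E d → ℝ} {L M A B : ℝ} {x : E d} (hf : PtLip f L x) (hg : PtLip g M x)
    (hA : ∀ᶠ y in 𝓝 x, |f y| ≤ A) (hB : |g x| ≤ B) :
    PtLip (fun y => f y * g y) (A * M + B * L) x := by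
  filter_upwards [hf, hg, hA] with y h1 h2 h3
  have h0 : 0 ≤ A := (abs_nonneg _).trans h3
  calc |f y * g y - f x * g x| = |f y * (g y - g x) + g x * (f y - f x)| := by ring_nf
    _ ≤ |f y| * |g y - g x| + |g x| * |f y - f x| := by
        rw [← abs_mul, ← abs_mul]; exact abs_add_le _ _
    _ ≤ A * (M * ‖y - x‖) + B * (L * ‖y - x‖) := by
        gcongr
        exact (abs_nonneg _).trans hB
    _ = _ := by ring

/-- Continuous induction along the segment: the parameters at which the bound holds form a closed
set, and the local bound at each of its points extends it to the right. No differentiability is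
needed. -/
lemma abs_sub_le_of_ptLip_segment {f : E d → ℝ} {L : ℝ} {x y : E d}
    (h : ∀ z ∈ segment ℝ x y, PtLip f L z) : |f y - f x| ≤ L * ‖y - x‖ := by
  set c : ℝ → E d := fun t => x + t • (y - x) with hc
  have hcc : Continuous c := by fun_prop
  have hseg : ∀ t ∈ Icc (0 : ℝ) 1, c t ∈ segment ℝ x y := by
    intro t ht
    rw [segment_eq_image']
    exact ⟨t, ht, rfl⟩
  have hcont : ContinuousOn (fun t => f (c t)) (Icc 0 1) := fun t ht =>
    ((h _ (hseg t ht)).continuousAt.comp hcc.continuousAt).continuousWithinAt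
  set s : Set ℝ := {t | |f (c t) - f x| ≤ L * (t * ‖y - x‖)} with hs
  have hclosed : IsClosed (s ∩ Icc 0 1) := by
    have := (isClosed_Icc (a := (0 : ℝ)) (b := 1)).isClosed_le
      (f := fun t => |f (c t) - f x|) (g := fun t => L * (t * ‖y - x‖))
      ((hcont.sub continuousOn_const).abs) (by fun_prop)
    convert this using 1
    ext t
    simp [hs, and_comm]
  have key := hclosed.Icc_subset_of_forall_mem_nhdsWithin (by simp [hs, hc]) (fun t ht => ?_)
  · have := key (right_mem_Icc.2 zero_le_one)
    simpa [hs, hc] using this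
  · have h1 : ∀ᶠ r in 𝓝[>] t, |f (c r) - f (c t)| ≤ L * ‖c r - c t‖ :=
      (hcc.continuousAt.eventually (h _ (hseg t ⟨ht.2.1, ht.2.2.le⟩))).filter_mono
        nhdsWithin_le_nhds
    filter_upwards [h1, self_mem_nhdsWithin] with r hr hrt
    have h2 : ‖c r - c t‖ = (r - t) * ‖y - x‖ := by
      rw [hc]
      simp only [add_sub_add_left_eq_sub, ← sub_smul]
      rw [norm_smul, Real.norm_of_nonneg (sub_nonneg.2 (le_of_lt hrt))]
    have h3 : |f (c t) - f x| ≤ L * (t * ‖y - x‖) := ht.1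
    change |f (c r) - f x| ≤ L * (r * ‖y - x‖)
    calc |f (c r) - f x| ≤ |f (c r) - f (c t)| + |f (c t) - f x| := abs_sub_le _ _ _
      _ ≤ L * ((r - t) * ‖y - x‖) + L * (t * ‖y - x‖) := by rw [← h2]; gcongr
      _ = _ := by ring

lemma lipschitzWith_of_ptLip {f : E d → ℝ} {L : ℝ} (hL : 0 ≤ L) (h : ∀ x, PtLip f L x) :
    LipschitzWith L.toNNReal f := by
  refine LipschitzWith.of_dist_le_mul fun x y => ?_
  rw [dist_comm, Real.dist_eq, dist_comm x, dist_eq_norm, Real.coe_toNNReal _ hL]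
  exact abs_sub_le_of_ptLip_segment fun z _ => h z

lemma LipschitzWith.ptLip {f : E d → ℝ} {C : ℝ≥0} (h : LipschitzWith C f) (x : E d) :
    PtLip f C x := Eventually.of_forall fun y => by
  simpa [Real.dist_eq, dist_eq_norm] using h.dist_le_mul y x

lemma PtLip.norm_fderiv_le {f : E d → ℝ} {L : ℝ} {x : E d} (hL : 0 ≤ L) (h : PtLip f L x) :
    ‖fderiv ℝ f x‖ ≤ L := by
  by_cases hd : DifferentiableAt ℝ f x
  · exact hd.hasFDerivAt.le_of_lip' hL h
  · simpa [fderiv_zero_of_not_differentiableAt hd]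

lemma inner_gradient_eq {f : E d → ℝ} (x v : E d) :
    ⟪gradient f x, v⟫_ℝ = fderiv ℝ f x v := by
  simp [gradient]

lemma norm_gradient_eq {f : E d → ℝ} (x : E d) : ‖gradient f x‖ = ‖fderiv ℝ f x‖ := by
  simp [gradient]

lemma measurable_gradient (f : E d → ℝ) : Measurable (gradient f) :=
  (InnerProductSpace.toDual ℝ (E d)).symm.continuous.measurable.comp (measurable_fderiv ℝ f)

/-! ### Integration by parts -/

/-- Integration by parts against the constant `1`; the formula reverses the direction, hence the
`-v`. -/
lemma integral_lineDeriv_eq_zero {f : E d → ℝ} {C : ℝ≥0} (hf : LipschitzWith C f)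
    (hc : HasCompactSupport f) (v : E d) : ∫ x, lineDeriv ℝ f x v = 0 := by
  have := LipschitzWith.integral_lineDeriv_mul_eq (μ := (volume : Measure (E d)))
    (LipschitzWith.const (1 : ℝ)) hf hc (-v)
  simpa [lineDeriv] using this.symm

/-- The first conclusion supplies dominating functions for passages to the limit, the second the
integrability of the dominated terms. -/
lemma integrable_of_support_subset {F : Type*} [NormedAddCommGroup F] {Ω K : Set (E d)}
    {u : E d → F} {F' : Type*} [NormedAddCommGroup F'] {h : E d → F'} {C : ℝ}
    (hK : IsCompact K) (hKΩ : K ⊆ Ω) (hu : LocallyIntegrableOn u Ω)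
    (hm : AEStronglyMeasurable h (volume.restrict Ω))
    (hb : ∀ᵐ x ∂(volume.restrict Ω), ‖h x‖ ≤ K.indicator (fun x => C * ‖u x‖) x) :
    Integrable (K.indicator fun x => C * ‖u x‖) (volume.restrict Ω) ∧
      Integrable h (volume.restrict Ω) := by
  have h1 : Integrable (K.indicator fun x => C * ‖u x‖) (volume.restrict Ω) := by
    rw [integrable_indicator_iff hK.measurableSet]
    have h2 := ((hu.integrableOn_compact_subset hKΩ hK).norm.const_mul C)
    exact h2.mono_measure (Measure.restrict_mono_measure Measure.restrict_le_self K)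
  exact ⟨h1, h1.mono' hm hb⟩

lemma norm_normed_convolution_le {φ : ContDiffBump (0 : E d)} {h : E d → ℝ} {B : ℝ}
    (hB : ∀ x, |h x| ≤ B) (x : E d) :
    |((φ.normed volume) ⋆[ContinuousLinearMap.lsmul ℝ ℝ, volume] h) x| ≤ B := by
  have hint : Integrable (fun t => φ.normed volume t * B) :=
    (φ.integrable_normed).mul_const B
  have h1 := norm_integral_le_of_norm_le hint
    (f := fun t => (ContinuousLinearMap.lsmul ℝ ℝ (φ.normed volume t)) (h (x - t)))
    (Eventually.of_forall fun t => by
      simp only [ContinuousLinearMap.lsmul_apply, smul_eq_mul, norm_mul, Real.norm_eq_abs]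
      rw [abs_of_nonneg (φ.nonneg_normed t)]
      exact mul_le_mul_of_nonneg_left (hB _) (φ.nonneg_normed t))
  rw [integral_mul_const, φ.integral_normed, one_mul] at h1
  exact h1

/-- The difference quotients of the convolution are integrals of difference quotients of the
reflected function `y ↦ F (x - y)` in direction `-v`, and the Lipschitz bound allows the limit under
the integral. The line derivative thus falls on `F`, which need not be differentiable everywhere. -/
lemma lineDeriv_normed_convolution {φ : ContDiffBump (0 : E d)} {F : E d → ℝ} {C : ℝ≥0}
    (hF : LipschitzWith C F) (x v : E d) :
    lineDeriv ℝ ((φ.normed volume) ⋆[ContinuousLinearMap.lsmul ℝ ℝ, volume] F) x v =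
      ((φ.normed volume) ⋆[ContinuousLinearMap.lsmul ℝ ℝ, volume]
        fun y => lineDeriv ℝ F y v) x := by
  have hsm : ContDiff ℝ 1 ((φ.normed volume) ⋆[ContinuousLinearMap.lsmul ℝ ℝ, volume] F) :=
    (φ.hasCompactSupport_normed).contDiff_convolution_left _ (φ.contDiff_normed (n := 1))
      hF.continuous.locallyIntegrable
  have hd := ((hsm.differentiable (by simp)) x).lineDifferentiableAt (v := v)
  have h1 := hd.hasLineDerivAt.tendsto_slope_zero_right
  set f' : E d → ℝ := fun y => F (x - y) with hf'
  have hf'L : LipschitzWith C f' := by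
    have := hF.comp ((LipschitzWith.const x).sub LipschitzWith.id)
    simpa [hf', Function.comp_def] using this
  have h2 := LipschitzWith.integral_inv_smul_sub_mul_tendsto_integral_lineDeriv_mul
    (μ := (volume : Measure (E d))) hf'L (φ.integrable_normed) (-v)
  have h3 : ∀ y, lineDeriv ℝ f' y (-v) = lineDeriv ℝ F (x - y) v := by
    intro y
    simp only [lineDeriv, hf']
    congr 1
    ext t
    congr 1
    simp only [smul_neg]
    abel
  have hint : ∀ z, Integrable fun t => φ.normed volume t * F (z - t) := by
    intro z
    refine Continuous.integrable_of_hasCompactSupport ?_ ?_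
    · exact (φ.continuous_normed).mul (hF.continuous.comp (by fun_prop))
    · exact (φ.hasCompactSupport_normed).mul_right
  refine tendsto_nhds_unique h1 (Tendsto.congr (fun t => ?_) (h2.trans_eq ?_))
  · simp only [convolution_def, ContinuousLinearMap.lsmul_apply, smul_eq_mul]
    rw [← integral_sub (hint _) (hint _), ← integral_const_mul]
    congr 1
    ext y
    simp only [hf', smul_neg]
    rw [show x - (y + -(t • v)) = x + t • v - y by abel]
    ring
  · simp only [convolution_def, ContinuousLinearMap.lsmul_apply, smul_eq_mul, h3]
    congr 2
    ext y
    ring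

/-- The weak gradient may be tested with Lipschitz functions of compact support. -/
lemma HasWeakGrad.integral_mul_lineDeriv {Ω : Set (E d)} (hΩ : IsOpen Ω) {u : E d → ℝ}
    {G : E d → E d} (h : HasWeakGrad Ω u G) {F : E d → ℝ} {C : ℝ≥0} (hF : LipschitzWith C F)
    (hFc : HasCompactSupport F) (hFs : tsupport F ⊆ Ω) (v : E d) :
    ∫ x in Ω, u x * lineDeriv ℝ F x v = -∫ x in Ω, F x * ⟪G x, v⟫_ℝ := by
  obtain ⟨hu, hG, hw⟩ := h
  have hum := hu.aestronglyMeasurable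
  have hGm := hG.aestronglyMeasurable
  obtain ⟨δ, hδ, hKΩ⟩ := hFc.isCompact.exists_cthickening_subset_open hΩ hFs
  set K := Metric.cthickening δ (tsupport F) with hK
  have hKc : IsCompact K := hFc.isCompact.cthickening
  -- The ratio of outer to inner radius is fixed at `2`, as required for almost everywhere
  -- convergence of the mollifications. The outer radii are at most `δ / 2`, which keeps all
  -- supports inside `K`.
  let φ : ℕ → ContDiffBump (0 : E d) := fun n =>
    { rIn := δ / (2 * (n + 2))
      rOut := δ / (n + 2)
      rIn_pos := by positivity
      rIn_lt_rOut := by gcongr; nlinarith [(n.cast_nonneg : (0 : ℝ) ≤ n)] }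
  have hφ0 : Tendsto (fun n => (φ n).rOut) atTop (𝓝 0) := by
    have : Tendsto (fun n : ℕ => δ / ((n : ℝ) + 2)) atTop (𝓝 0) :=
      tendsto_const_nhds.div_atTop
        (tendsto_atTop_add_const_right _ _ tendsto_natCast_atTop_atTop)
    exact this
  have hφK : ∀ᶠ n in atTop, (φ n).rOut ≤ 2 * (φ n).rIn := Eventually.of_forall fun n => by
    change δ / ((n : ℝ) + 2) ≤ 2 * (δ / (2 * (n + 2)))
    apply le_of_eq
    field_simp
  set f : ℕ → E d → ℝ := fun n =>
    ((φ n).normed volume) ⋆[ContinuousLinearMap.lsmul ℝ ℝ, volume] F with hf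
  have hfs : ∀ n, tsupport (f n) ⊆ K := by
    intro n
    refine closure_minimal ?_ Metric.isClosed_cthickening
    refine (support_convolution_subset _).trans ?_
    rw [(φ n).support_normed_eq]
    rintro _ ⟨a, ha, b, hb, rfl⟩
    refine Metric.mem_cthickening_of_dist_le _ b _ _ (subset_tsupport _ hb) ?_
    have h1 : ‖a‖ < δ / (n + 2) := by simpa using ha
    have h2 : δ / ((n : ℝ) + 2) ≤ δ := div_le_self hδ.le (by linarith [(n.cast_nonneg : (0 : ℝ) ≤ n)])
    simp only [dist_eq_norm, add_sub_cancel_right]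
    linarith
  have hfc : ∀ n, HasCompactSupport (f n) := fun n => hKc.of_isClosed_subset (isClosed_tsupport _) (hfs n)
  have hsm : ∀ n, ContDiff ℝ ∞ (f n) := fun n =>
    ((φ n).hasCompactSupport_normed).contDiff_convolution_left _ ((φ n).contDiff_normed)
      hF.continuous.locallyIntegrable
  have hld : ∀ n x, lineDeriv ℝ (f n) x v =
      (((φ n).normed volume) ⋆[ContinuousLinearMap.lsmul ℝ ℝ, volume]
        fun y => lineDeriv ℝ F y v) x := fun n x => lineDeriv_normed_convolution hF x v
  have hldb : ∀ n x, |lineDeriv ℝ (f n) x v| ≤ C * ‖v‖ := fun n x => by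
    rw [hld]
    exact norm_normed_convolution_le (fun y => norm_lineDeriv_le_of_lipschitz ℝ hF) x
  obtain ⟨B, hB⟩ : ∃ B, ∀ x, |F x| ≤ B := hF.continuous.bounded_above_of_compact_support hFc
  have hB0 : 0 ≤ B := (abs_nonneg _).trans (hB 0)
  have hfB : ∀ n x, |f n x| ≤ B := fun n x => norm_normed_convolution_le hB x
  have hgr : ∀ n x, ⟪gradient (f n) x, v⟫_ℝ = lineDeriv ℝ (f n) x v := fun n x => by
    rw [inner_gradient_eq, (((hsm n).differentiable (by simp)) x).lineDeriv_eq_fderiv]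
  have hgr0 : ∀ n x, x ∉ K → gradient (f n) x = 0 := fun n x hx => by
    simp [gradient, fderiv_of_notMem_tsupport ℝ (fun h => hx (hfs n h))]
  have hf0 : ∀ n x, x ∉ K → f n x = 0 := fun n x hx =>
    image_eq_zero_of_notMem_tsupport fun h => hx (hfs n h)
  have bl : ∀ n, ∀ x, ‖u x * lineDeriv ℝ (f n) x v‖ ≤
      K.indicator (fun x => (C * ‖v‖) * ‖u x‖) x := fun n x => by
    by_cases hx : x ∈ K
    · rw [indicator_of_mem hx, norm_mul, mul_comm]
      exact mul_le_mul_of_nonneg_right (hldb n x) (norm_nonneg _)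
    · rw [indicator_of_notMem hx, ← hgr, hgr0 n x hx]
      simp
  have br : ∀ n, ∀ x, ‖f n x * ⟪G x, v⟫_ℝ‖ ≤ K.indicator (fun x => (B * ‖v‖) * ‖G x‖) x :=
      fun n x => by
    by_cases hx : x ∈ K
    · rw [indicator_of_mem hx, norm_mul]
      calc ‖f n x‖ * ‖⟪G x, v⟫_ℝ‖ ≤ B * (‖G x‖ * ‖v‖) := by
            gcongr
            · exact hfB n x
            · exact norm_inner_le_norm _ _
        _ = _ := by ring
    · rw [indicator_of_notMem hx, hf0 n x hx]
      simp
  have hml : ∀ n, AEStronglyMeasurable (fun x => u x * lineDeriv ℝ (f n) x v)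
      (volume.restrict Ω) := fun n =>
    hum.mul (aestronglyMeasurable_lineDeriv (hsm n).continuous _)
  have hmr : ∀ n, AEStronglyMeasurable (fun x => f n x * ⟪G x, v⟫_ℝ)
      (volume.restrict Ω) := fun n =>
    (hsm n).continuous.aestronglyMeasurable.mul (hGm.inner aestronglyMeasurable_const)
  have il := fun n => integrable_of_support_subset hKc hKΩ hu (hml n) (Eventually.of_forall (bl n))
  have ir := fun n => integrable_of_support_subset hKc hKΩ hG (hmr n) (Eventually.of_forall (br n))
  have heq : ∀ n, ∫ x in Ω, u x * lineDeriv ℝ (f n) x v = -∫ x in Ω, f n x * ⟪G x, v⟫_ℝ := by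
    intro n
    have h1 := congrArg (fun z => ⟪v, z⟫_ℝ) (hw (f n) (hsm n) (hfc n) ((hfs n).trans hKΩ))
    have I1 : Integrable (fun x => u x • gradient (f n) x) (volume.restrict Ω) := by
      obtain ⟨A, hA⟩ := ((hsm n).continuous_fderiv (by simp)).bounded_above_of_compact_support
        ((hfc n).fderiv ℝ)
      refine (integrable_of_support_subset (C := A) hKc hKΩ hu
        (hum.fun_smul (measurable_gradient (f n)).aestronglyMeasurable)
        (Eventually.of_forall fun x => ?_)).2
      by_cases hx : x ∈ K
      · rw [indicator_of_mem hx, norm_smul, norm_gradient_eq, mul_comm]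
        exact mul_le_mul_of_nonneg_right (hA x) (norm_nonneg _)
      · rw [indicator_of_notMem hx, hgr0 n x hx]
        simp
    have I2 : Integrable (fun x => f n x • G x) (volume.restrict Ω) := by
      refine (integrable_of_support_subset (C := B) hKc hKΩ hG
        ((hsm n).continuous.aestronglyMeasurable.fun_smul hGm)
        (Eventually.of_forall fun x => ?_)).2
      by_cases hx : x ∈ K
      · rw [indicator_of_mem hx, norm_smul]
        exact mul_le_mul_of_nonneg_right (hfB n x) (norm_nonneg _)
      · rw [indicator_of_notMem hx, hf0 n x hx]
        simp
    simp only [inner_neg_right] at h1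
    rw [← integral_inner I1, ← integral_inner I2] at h1
    simpa only [inner_smul_right, fun x => (real_inner_comm (gradient (f n) x) v).trans (hgr n x),
      fun x => real_inner_comm (G x) v] using h1
  -- The line derivative of `F` is only bounded and measurable, so its mollifications converge
  -- merely almost everywhere.
  have hae := ContDiffBump.ae_convolution_tendsto_right_of_locallyIntegrable (K := 2)
    (μ := (volume : Measure (E d))) hφ0 hφK (hF.locallyIntegrable_lineDeriv v)
  have hl : Tendsto (fun n => ∫ x in Ω, u x * lineDeriv ℝ (f n) x v) atTop
      (𝓝 (∫ x in Ω, u x * lineDeriv ℝ F x v)) := by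
    refine tendsto_integral_of_dominated_convergence _ hml (il 0).1
      (fun n => Eventually.of_forall (bl n)) ?_
    filter_upwards [ae_restrict_of_ae hae] with x hx
    simp only [hld]
    exact hx.const_mul _
  have hr : Tendsto (fun n => -∫ x in Ω, f n x * ⟪G x, v⟫_ℝ) atTop
      (𝓝 (-∫ x in Ω, F x * ⟪G x, v⟫_ℝ)) := by
    refine (tendsto_integral_of_dominated_convergence _ hmr (ir 0).1
      (fun n => Eventually.of_forall (br n)) (Eventually.of_forall fun x => ?_)).neg
    exact (ContDiffBump.convolution_tendsto_right_of_continuous hφ0 hF.continuous x).mul_const _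
  simp only [heq] at hl
  exact tendsto_nhds_unique hl hr

/-- A function with pointwise Lipschitz bounds in `Ω` has its classical gradient
as weak gradient. -/
lemma hasWeakGrad_of_ptLip {Ω : Set (E d)} (hΩ : IsOpen Ω) {u : E d → ℝ} {L B : ℝ}
    (hL : 0 ≤ L) (hu : ∀ x ∈ Ω, PtLip u L x) (hB : ∀ x ∈ Ω, |u x| ≤ B)
    (hd : ∀ᵐ x ∂(volume.restrict Ω), DifferentiableAt ℝ u x) :
    HasWeakGrad Ω u (gradient u) := by
  have hc : ContinuousOn u Ω := fun x hx => (hu x hx).continuousAt.continuousWithinAt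
  have hgb : ∀ x ∈ Ω, ‖gradient u x‖ ≤ L := fun x hx => by
    rw [norm_gradient_eq]; exact (hu x hx).norm_fderiv_le hL
  have hgl : LocallyIntegrableOn (gradient u) Ω := by
    rw [locallyIntegrableOn_iff hΩ.isLocallyClosed]
    intro K hKΩ hK
    refine IntegrableOn.of_bound hK.measure_lt_top
      (measurable_gradient u).aestronglyMeasurable L ?_
    filter_upwards [ae_restrict_mem hK.measurableSet] with x hx using hgb x (hKΩ hx)
  refine ⟨hc.locallyIntegrableOn hΩ.measurableSet, hgl, fun φ hφ hφc hφs => ?_⟩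
  obtain ⟨A, hA⟩ := hφ.continuous.bounded_above_of_compact_support hφc
  obtain ⟨D, hD⟩ := ContDiff.lipschitzWith_of_hasCompactSupport hφc hφ (by simp)
  have hB0 : ∀ x ∈ Ω, 0 ≤ B := fun x hx => (abs_nonneg _).trans (hB x hx)
  have hA0 : 0 ≤ A := (norm_nonneg _).trans (hA 0)
  -- The product is Lipschitz on the whole space although `u` is controlled only in `Ω`: off the
  -- support of `φ` it vanishes locally.
  have hlip : LipschitzWith (A * L + |B| * D).toNNReal (fun x => φ x * u x) := by
    refine lipschitzWith_of_ptLip (by positivity) fun x => ?_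
    by_cases hx : x ∈ tsupport φ
    · have := (LipschitzWith.ptLip hD x).mul (hu x (hφs hx)) (A := A) (B := |B|)
        (Eventually.of_forall hA) ((hB x (hφs hx)).trans (le_abs_self _))
      simpa using this
    · have h0 : φ =ᶠ[𝓝 x] 0 := notMem_tsupport_iff_eventuallyEq.1 hx
      filter_upwards [h0] with y hy
      rw [hy, h0.eq_of_nhds]
      simp only [Pi.zero_apply, zero_mul, sub_self, abs_zero]
      positivity
  have hcs : HasCompactSupport (fun x => φ x * u x) := hφc.mul_right
  have I1 : Integrable (fun x => u x • gradient φ x) (volume.restrict Ω) := by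
    refine (integrable_of_support_subset (C := D) hφc hφs (hc.locallyIntegrableOn hΩ.measurableSet)
      ((hc.aestronglyMeasurable hΩ.measurableSet).fun_smul
        (measurable_gradient φ).aestronglyMeasurable) (Eventually.of_forall fun x => ?_)).2
    by_cases hx : x ∈ tsupport φ
    · rw [indicator_of_mem hx, norm_smul, mul_comm, norm_gradient_eq]
      exact mul_le_mul_of_nonneg_right (norm_fderiv_le_of_lipschitz ℝ hD) (norm_nonneg _)
    · rw [indicator_of_notMem hx]
      simp [gradient, fderiv_of_notMem_tsupport ℝ hx]
  have I2 : Integrable (fun x => φ x • gradient u x) (volume.restrict Ω) := by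
    refine (integrable_of_support_subset (C := A) hφc hφs hgl
      (hφ.continuous.aestronglyMeasurable.fun_smul
        (measurable_gradient u).aestronglyMeasurable) (Eventually.of_forall fun x => ?_)).2
    by_cases hx : x ∈ tsupport φ
    · rw [indicator_of_mem hx, norm_smul]
      exact mul_le_mul_of_nonneg_right (hA x) (norm_nonneg _)
    · rw [indicator_of_notMem hx, image_eq_zero_of_notMem_tsupport hx]
      simp
  refine ext_inner_left ℝ fun v => ?_
  rw [inner_neg_right, ← integral_inner I1, ← integral_inner I2, eq_neg_iff_add_eq_zero,
    ← integral_add (I1.const_inner v) (I2.const_inner v)]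
  -- The two integrands add up to the line derivative of the Lipschitz product `φ u`, whose integral
  -- is zero.
  have h0 := integral_lineDeriv_eq_zero hlip hcs v
  rw [← setIntegral_eq_integral_of_forall_compl_eq_zero (s := Ω)] at h0
  · rw [← h0]
    refine integral_congr_ae ?_
    filter_upwards [hd] with x hx
    have h1 : DifferentiableAt ℝ φ x := (hφ.differentiable (by simp)) x
    rw [(h1.fun_mul hx).lineDeriv_eq_fderiv, fderiv_fun_mul h1 hx]
    simp only [real_inner_comm _ v, real_inner_smul_left, inner_gradient_eq]
    simp
    ring
  · intro x hx
    have hx' : x ∉ tsupport φ := fun h => hx (hφs h)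
    have h2 : (fun x => φ x * u x) =ᶠ[𝓝 x] fun _ => 0 := by
      filter_upwards [notMem_tsupport_iff_eventuallyEq.1 hx'] with y hy
      simp [hy]
    rw [h2.lineDeriv_eq]
    simp [lineDeriv]

/-! ### Affine functions -/

/-- The gradient of an affine function. -/
noncomputable def agrad (a : E d →ᵃ[ℝ] ℝ) : E d :=
  (InnerProductSpace.toDual ℝ (E d)).symm (LinearMap.toContinuousLinearMap a.linear)

lemma inner_agrad (a : E d →ᵃ[ℝ] ℝ) (v : E d) : ⟪agrad a, v⟫_ℝ = a.linear v := by
  simp [agrad]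

lemma affine_sub_eq (a : E d →ᵃ[ℝ] ℝ) (x y : E d) : a y - a x = ⟪agrad a, y - x⟫_ℝ := by
  rw [inner_agrad, ← vsub_eq_sub, ← vsub_eq_sub, AffineMap.linearMap_vsub]

lemma affine_eq (a : E d →ᵃ[ℝ] ℝ) (x : E d) : a x = ⟪agrad a, x⟫_ℝ + a 0 := by
  have := affine_sub_eq a 0 x
  rw [sub_zero] at this
  linarith

lemma contDiff_affine (a : E d →ᵃ[ℝ] ℝ) {n : WithTop ℕ∞} : ContDiff ℝ n a := by
  have : (a : E d → ℝ) = fun x => ⟪agrad a, x⟫_ℝ + a 0 := funext (affine_eq a)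
  rw [this]
  exact (contDiff_const.inner ℝ contDiff_id).add contDiff_const

lemma hasGradientAt_affine (a : E d →ᵃ[ℝ] ℝ) (x : E d) : HasGradientAt a (agrad a) x := by
  have : (a : E d → ℝ) = fun x => ⟪agrad a, x⟫_ℝ + a 0 := funext (affine_eq a)
  rw [this, hasGradientAt_iff_hasFDerivAt]
  exact ((InnerProductSpace.toDual ℝ (E d) (agrad a)).hasFDerivAt).add_const _

/-! ### Simplices -/

namespace Cell

variable (T : Cell d)

lemma mem_carrier {x : E d} : x ∈ T.carrier ↔ ∀ i, 0 ≤ T.coord i x := by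
  rw [carrier, AffineBasis.convexHull_eq_nonneg_coord]; rfl

lemma mem_interior {x : E d} : x ∈ interior T.carrier ↔ ∀ i, 0 < T.coord i x := by
  rw [carrier, AffineBasis.interior_convexHull]; rfl

lemma isCompact : IsCompact T.carrier := (finite_range T).isCompact_convexHull ℝ

lemma isClosed : IsClosed T.carrier := T.isCompact.isClosed

lemma convex : Convex ℝ T.carrier := convex_convexHull ℝ _

lemma vertex_mem (i : Fin (d + 1)) : T i ∈ T.carrier := subset_convexHull ℝ _ ⟨i, rfl⟩

lemma interior_nonempty : (interior T.carrier).Nonempty :=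
  ⟨_, T.centroid_mem_interior_convexHull⟩

lemma closure_interior : closure (interior T.carrier) = T.carrier := by
  rw [T.convex.closure_interior_eq_closure_of_nonempty_interior T.interior_nonempty,
    T.isClosed.closure_eq]

lemma volume_frontier : volume (frontier T.carrier) = 0 := T.convex.addHaar_frontier _

lemma measurableSet : MeasurableSet T.carrier := T.isClosed.measurableSet

lemma ae_mem_interior : ∀ᵐ x ∂(volume.restrict T.carrier), x ∈ interior T.carrier := by
  rw [ae_restrict_iff' T.measurableSet]
  have h : ∀ᵐ x ∂(volume : Measure (E d)), x ∉ frontier T.carrier :=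
    measure_eq_zero_iff_ae_notMem.1 T.volume_frontier
  filter_upwards [h] with x hx hxT
  by_contra hxi
  exact hx ⟨subset_closure hxT, hxi⟩

lemma exists_coord_eq_zero {x : E d} (hx : x ∈ T.carrier) (hxi : x ∉ interior T.carrier) :
    ∃ i, T.coord i x = 0 := by
  rw [mem_interior] at hxi
  push Not at hxi
  obtain ⟨i, hi⟩ := hxi
  exact ⟨i, le_antisymm hi (T.mem_carrier.1 hx i)⟩

/-- The polynomial that the bubble function equals on the simplex. -/
noncomputable def poly : E d → ℝ := fun x => ∏ i, T.coord i x

lemma contDiff_poly {n : WithTop ℕ∞} : ContDiff ℝ n T.poly :=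
  contDiff_prod fun _ _ => contDiff_affine _

lemma bubble_eqOn : EqOn T.bubble T.poly T.carrier := fun x hx => by
  simp [bubble, poly, hx]

lemma bubble_eq_zero_of_notMem_interior {x : E d} (hx : x ∉ interior T.carrier) :
    T.bubble x = 0 := by
  unfold bubble
  split_ifs with h
  · obtain ⟨i, hi⟩ := T.exists_coord_eq_zero h hx
    exact Finset.prod_eq_zero (Finset.mem_univ i) hi
  · rfl

/-- A continuously differentiable function is Lipschitz on a simplex. -/
lemma exists_lipschitz {p : E d → ℝ} (hp : ContDiff ℝ 1 p) :
    ∃ L : ℝ, 0 ≤ L ∧ ∀ x ∈ T.carrier, ∀ y ∈ T.carrier, |p y - p x| ≤ L * ‖y - x‖ := by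
  obtain ⟨L, hL⟩ := T.isCompact.exists_bound_of_continuousOn
    (hp.continuous_fderiv (by simp)).continuousOn
  refine ⟨max L 0, le_max_right _ _, fun x hx y hy => ?_⟩
  exact T.convex.norm_image_sub_le_of_norm_fderiv_le
    (fun z _ => (hp.differentiable (by simp)) z) (fun z hz => (hL z hz).trans (le_max_left _ _))
    hx hy

/-- By `lipschitzWith_of_ptLip` it is enough to argue pointwise. The only delicate points are those
on the boundary of the simplex, where the polynomial vanishes and so matches the extension by zero.
-/
lemma exists_lipschitzWith_bubble : ∃ C, LipschitzWith C T.bubble := by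
  obtain ⟨L, hL0, hL⟩ := T.exists_lipschitz T.contDiff_poly
  refine ⟨_, lipschitzWith_of_ptLip hL0 fun x => ?_⟩
  have h0 : ∀ y, 0 ≤ L * ‖y - x‖ := fun y => by positivity
  by_cases hx : x ∈ T.carrier
  · by_cases hxi : x ∈ interior T.carrier
    · filter_upwards [isOpen_interior.mem_nhds hxi] with y hy
      rw [T.bubble_eqOn hx, T.bubble_eqOn (interior_subset hy)]
      exact hL x hx y (interior_subset hy)
    · refine Eventually.of_forall fun y => ?_
      by_cases hy : y ∈ T.carrier
      · rw [T.bubble_eqOn hx, T.bubble_eqOn hy]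
        exact hL x hx y hy
      · rw [T.bubble_eq_zero_of_notMem_interior hxi,
          T.bubble_eq_zero_of_notMem_interior fun h => hy (interior_subset h)]
        simpa using h0 y
  · filter_upwards [T.isClosed.isOpen_compl.mem_nhds hx] with y hy
    rw [T.bubble_eq_zero_of_notMem_interior fun h => hx (interior_subset h),
      T.bubble_eq_zero_of_notMem_interior fun h => hy (interior_subset h)]
    simpa using h0 y

lemma continuous_bubble : Continuous T.bubble :=
  T.exists_lipschitzWith_bubble.choose_spec.continuous

lemma tsupport_bubble_subset : tsupport T.bubble ⊆ T.carrier := by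
  refine closure_minimal (fun x hx => ?_) T.isClosed
  by_contra h
  exact hx (T.bubble_eq_zero_of_notMem_interior fun h' => h (interior_subset h'))

/-- The mean of the gradient of a bubble function vanishes. -/
lemma integral_inner_gradient_bubble (v : E d) :
    ∫ x in T.carrier, ⟪v, gradient T.bubble x⟫_ℝ = 0 := by
  obtain ⟨C, hC⟩ := T.exists_lipschitzWith_bubble
  have h0 := integral_lineDeriv_eq_zero hC
    (T.isCompact.of_isClosed_subset (isClosed_tsupport _) T.tsupport_bubble_subset) v
  rw [← setIntegral_eq_integral_of_forall_compl_eq_zero (s := T.carrier)] at h0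
  · rw [← h0]
    refine integral_congr_ae ?_
    filter_upwards [T.ae_mem_interior] with x hx
    have hd : DifferentiableAt ℝ T.bubble x :=
      ((T.contDiff_poly (n := 1)).differentiable (by simp) x).congr_of_eventuallyEq
        (T.bubble_eqOn.eventuallyEq_of_mem (mem_interior_iff_mem_nhds.1 hx))
    rw [hd.lineDeriv_eq_fderiv, real_inner_comm, inner_gradient_eq]
  · intro x hx
    have h2 : T.bubble =ᶠ[𝓝 x] fun _ => 0 := by
      filter_upwards [T.isClosed.isOpen_compl.mem_nhds hx] with y hy
      exact T.bubble_eq_zero_of_notMem_interior fun h => hy (interior_subset h)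
    rw [h2.lineDeriv_eq]
    simp [lineDeriv]

end Cell

/-! ### Lipschitz domains and triangulations -/

/-- A graph domain lies on one side of its boundary: moving from a boundary point in the direction
`-e` leads strictly below the graph, into an open region that locally misses `Ω`. This excludes
slits and lets interiors of cells be placed in `Ω`, not just in its closure. -/
lemma IsLipschitzDomain.interior_closure {Ω : Set (E d)} (h : IsLipschitzDomain Ω) :
    interior (closure Ω) = Ω := by
  refine Subset.antisymm (fun x hx => ?_) h.isOpen.subset_interior_closure
  by_contra hxΩ
  have hxf : x ∈ frontier Ω := ⟨interior_subset hx, by rwa [h.isOpen.interior_eq]⟩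
  obtain ⟨e, φ, K, he, hφ, hinv, hev⟩ := h.lipschitz_boundary x hxf
  have hx1 : ⟪e, x⟫_ℝ ≤ φ x := not_lt.1 fun hlt => hxΩ (hev.self_of_nhds.2 hlt)
  have hc : Continuous fun t : ℝ => x - t • e := by fun_prop
  have ht0 : Tendsto (fun t : ℝ => x - t • e) (𝓝[>] 0) (𝓝 x) := by
    have h2 := hc.tendsto 0
    simp only [zero_smul, sub_zero] at h2
    exact h2.mono_left nhdsWithin_le_nhds
  have h1 : ∀ᶠ t in 𝓝[>] (0 : ℝ), x - t • e ∈ closure Ω :=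
    ht0.eventually (mem_interior_iff_mem_nhds.1 hx)
  have h2 := ht0.eventually hev.eventually_nhds
  obtain ⟨t, ⟨ht1, ht2⟩, ht⟩ := ((h1.and h2).and self_mem_nhdsWithin).exists
  have hlt : ⟪e, x - t • e⟫_ℝ < φ (x - t • e) := by
    have h3 := hinv x (-t)
    rw [neg_smul, ← sub_eq_add_neg] at h3
    rw [h3, inner_sub_right, real_inner_smul_right, real_inner_self_eq_norm_sq, he]
    have : (0 : ℝ) < t := ht
    nlinarith
  have hopen : ∀ᶠ y in 𝓝 (x - t • e), ⟪e, y⟫_ℝ < φ y :=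
    (isOpen_lt (by fun_prop) hφ.continuous).mem_nhds hlt
  obtain ⟨y, hy, hyΩ⟩ := mem_closure_iff_nhds.1 ht1 _ (hopen.and ht2)
  exact absurd (hy.2.1 hyΩ) (not_lt.2 hy.1.le)

namespace Triangulation

variable {Ω : Set (E d)} (𝒯 : Triangulation Ω)

include 𝒯 in
lemma isCompact_closure : IsCompact (closure Ω) := by
  rw [← 𝒯.cover]
  exact 𝒯.cells.isCompact_biUnion fun T _ => T.isCompact

lemma carrier_subset {T : Cell d} (hT : T ∈ 𝒯.cells) : T.carrier ⊆ closure Ω := by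
  rw [← 𝒯.cover]
  exact subset_biUnion_of_mem (u := fun T : Cell d => T.carrier) hT

lemma exists_cell {x : E d} (hx : x ∈ closure Ω) : ∃ T ∈ 𝒯.cells, x ∈ T.carrier := by
  rw [← 𝒯.cover] at hx
  simpa using hx

lemma interior_subset (hΩ : IsLipschitzDomain Ω) {T : Cell d} (hT : T ∈ 𝒯.cells) :
    interior T.carrier ⊆ Ω := by
  rw [← hΩ.interior_closure]
  exact interior_mono (𝒯.carrier_subset hT)

/-- A simplex is the closure of its interior, so an open set meeting `T` meets `interior T`. -/
lemma notMem_of_mem_interior {S T : Cell d} (hS : S ∈ 𝒯.cells) (hT : T ∈ 𝒯.cells) (hne : S ≠ T)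
    {x : E d} (hx : x ∈ interior S.carrier) : x ∉ T.carrier := by
  intro hxT
  rw [← T.closure_interior] at hxT
  obtain ⟨y, hyS, hyT⟩ := mem_closure_iff.1 hxT _ isOpen_interior hx
  exact disjoint_left.1 (𝒯.disjoint_interior S hS T hT hne) hyS hyT

include 𝒯 in
-- Interiors of cells lie in `Ω`, so the boundary is covered by the finitely many, null, boundaries
-- of cells.
lemma volume_frontier (hΩ : IsLipschitzDomain Ω) : volume (frontier Ω) = 0 := by
  refine measure_mono_null (t := ⋃ T ∈ 𝒯.cells, frontier T.carrier) (fun x hx => ?_) ?_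
  · obtain ⟨T, hT, hxT⟩ := 𝒯.exists_cell hx.1
    refine mem_biUnion hT ⟨subset_closure hxT, fun h => hx.2 ?_⟩
    rw [hΩ.isOpen.interior_eq]
    exact 𝒯.interior_subset hΩ hT h
  · exact (measure_biUnion_null_iff 𝒯.cells.countable_toSet).2 fun T _ => T.volume_frontier

include 𝒯 in
lemma restrict_closure (hΩ : IsLipschitzDomain Ω) :
    (volume : Measure (E d)).restrict (closure Ω) = volume.restrict Ω := by
  refine Measure.restrict_congr_set ?_
  rw [closure_eq_self_union_frontier]
  exact union_ae_eq_left_of_ae_eq_empty (ae_eq_empty.2 (𝒯.volume_frontier hΩ))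

lemma restrict_eq_sum (hΩ : IsLipschitzDomain Ω) :
    (volume : Measure (E d)).restrict Ω = ∑ T ∈ 𝒯.cells, volume.restrict T.carrier := by
  rw [← 𝒯.restrict_closure hΩ, ← 𝒯.cover]
  ext s hs
  rw [Measure.restrict_apply hs, Measure.finsetSum_apply]
  rw [inter_iUnion₂, measure_biUnion_finset₀]
  · exact Finset.sum_congr rfl fun T _ => (Measure.restrict_apply hs).symm
  · intro S hS T hT hne
    refine measure_mono_null (fun x hx => ?_) S.volume_frontier
    refine ⟨subset_closure hx.1.2, fun h => ?_⟩
    exact 𝒯.notMem_of_mem_interior hS hT hne h hx.2.2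
  · exact fun T _ => (hs.inter T.measurableSet).nullMeasurableSet

lemma restrict_le (hΩ : IsLipschitzDomain Ω) {T : Cell d} (hT : T ∈ 𝒯.cells) :
    (volume : Measure (E d)).restrict T.carrier ≤ volume.restrict Ω := by
  rw [← 𝒯.restrict_closure hΩ]
  exact Measure.restrict_mono_set _ (𝒯.carrier_subset hT)

lemma setIntegral_eq_sum (hΩ : IsLipschitzDomain Ω) {F : Type*} [NormedAddCommGroup F]
    [NormedSpace ℝ F] {f : E d → F} (hf : IntegrableOn f Ω) :
    ∫ x in Ω, f x = ∑ T ∈ 𝒯.cells, ∫ x in T.carrier, f x := by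
  rw [𝒯.restrict_eq_sum hΩ, integral_finsetSum_measure]
  exact fun T hT => Integrable.mono_measure hf (𝒯.restrict_le hΩ hT)

lemma ae_of_forall_interior (hΩ : IsLipschitzDomain Ω) {p : E d → Prop}
    (h : ∀ T ∈ 𝒯.cells, ∀ x ∈ interior T.carrier, p x) : ∀ᵐ x ∂(volume.restrict Ω), p x := by
  have h2 : ∀ᵐ x ∂(volume : Measure (E d)), ∀ T ∈ 𝒯.cells, x ∉ frontier T.carrier :=
    (ae_ball_iff 𝒯.cells.countable_toSet).2 fun T _ =>
      measure_eq_zero_iff_ae_notMem.1 T.volume_frontier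
  rw [ae_restrict_iff' hΩ.isOpen.measurableSet]
  filter_upwards [h2] with x hx hxΩ
  obtain ⟨T, hT, hxT⟩ := 𝒯.exists_cell (subset_closure hxΩ)
  refine h T hT x ?_
  by_contra hxi
  exact hx T hT ⟨subset_closure hxT, hxi⟩

end Triangulation

/-! ### Volumes of slabs -/

/-- After completing `w` to an orthonormal basis, the set sits in a box with `k` sides of length
`2s` and `d - k` sides of length `2R`. -/
lemma exists_volume_le_of_orthonormal {k : ℕ} {w : Fin k → E d} (hw : Orthonormal ℝ w) (R : ℝ)
    (hR : 0 ≤ R) : ∃ C : ℝ, 0 ≤ C ∧ ∀ (c : Fin k → ℝ) (s : ℝ), 0 ≤ s →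
      volume {y : E d | ‖y‖ ≤ R ∧ ∀ j, |⟪w j, y⟫_ℝ - c j| ≤ s} ≤ ENNReal.ofReal (C * s ^ k) := by
  have hkd : k ≤ d := by
    simpa using hw.linearIndependent.fintype_card_le_finrank
  set v : Fin d → E d := fun i => if h : (i : ℕ) < k then w ⟨i, h⟩ else 0 with hv
  set S : Set (Fin d) := {i | (i : ℕ) < k} with hS
  have hvS : Orthonormal ℝ (S.domRestrict v) := by
    have : S.domRestrict v = w ∘ (fun i : S => (⟨i.1, i.2⟩ : Fin k)) := by
      ext1 ⟨i, hi⟩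
      have hi' : (i : ℕ) < k := hi
      simp [hv, hi']
    rw [this]
    refine hw.comp _ fun i j hij => ?_
    simp only [Fin.mk.injEq] at hij
    exact Subtype.ext (Fin.ext hij)
  obtain ⟨b, hb⟩ := hvS.exists_orthonormalBasis_extension_of_card_eq (by simp)
  refine ⟨2 ^ k * (2 * R) ^ (d - k), by positivity, fun c s hs => ?_⟩
  set c' : Fin d → ℝ := fun i => if h : (i : ℕ) < k then c ⟨i, h⟩ else 0 with hc'
  set s' : Fin d → ℝ := fun i => if (i : ℕ) < k then s else R with hs'
  have hsub : {y : E d | ‖y‖ ≤ R ∧ ∀ j, |⟪w j, y⟫_ℝ - c j| ≤ s} ⊆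
      b.repr ⁻¹' ((WithLp.ofLp : E d → (Fin d → ℝ)) ⁻¹'
        Icc (fun i => c' i - s' i) (fun i => c' i + s' i)) := by
    rintro y ⟨hy, hyj⟩
    simp only [mem_preimage, mem_Icc, Pi.le_def]
    have key : ∀ i, |b.repr y i - c' i| ≤ s' i := by
      intro i
      rw [b.repr_apply_apply]
      by_cases hi : (i : ℕ) < k
      · rw [hb i hi]
        simpa [hv, hc', hs', hi] using hyj ⟨i, hi⟩
      · have h1 := abs_real_inner_le_norm (b i) y
        rw [b.orthonormal.1 i, one_mul] at h1
        simpa [hc', hs', hi] using h1.trans hy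
    refine ⟨fun i => ?_, fun i => ?_⟩
    · linarith [(abs_le.1 (key i)).1]
    · linarith [(abs_le.1 (key i)).2]
  refine (measure_mono hsub).trans ?_
  have hmp := (PiLp.volume_preserving_ofLp (Fin d))
  have hm : MeasurableSet (Icc (fun i => c' i - s' i) (fun i => c' i + s' i)) := measurableSet_Icc
  rw [b.measurePreserving_repr.measure_preimage (hmp.measurable hm).nullMeasurableSet,
    hmp.measure_preimage hm.nullMeasurableSet, Real.volume_Icc_pi]
  have hs0 : ∀ i, 0 ≤ s' i := fun i => by simp only [hs']; split_ifs <;> assumption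
  rw [← ENNReal.ofReal_prod_of_nonneg (fun i _ => by linarith [hs0 i])]
  apply ENNReal.ofReal_le_ofReal
  have h1 : ∀ i : Fin d, c' i + s' i - (c' i - s' i) = if (i : ℕ) < k then 2 * s else 2 * R := by
    intro i
    simp only [hs']
    split_ifs <;> ring
  have h2 : (Finset.univ.filter fun i : Fin d => (i : ℕ) < k).card = k := by
    rw [Fin.card_filter_val_lt, min_eq_right hkd]
  have h3 : (Finset.univ.filter fun i : Fin d => ¬ (i : ℕ) < k).card = d - k := by
    have := Finset.card_filter_add_card_filter_not (s := (Finset.univ : Finset (Fin d)))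
      (fun i => (i : ℕ) < k)
    simp only [Finset.card_univ, Fintype.card_fin] at this
    omega
  simp only [h1, Finset.prod_ite, Finset.prod_const, h2, h3]
  rw [mul_pow]
  apply le_of_eq
  ring

lemma exists_volume_slab_le {a : E d →ᵃ[ℝ] ℝ} (ha : agrad a ≠ 0) (R : ℝ) (hR : 0 ≤ R) :
    ∃ C : ℝ, 0 ≤ C ∧ ∀ s : ℝ, 0 ≤ s →
      volume {y : E d | ‖y‖ ≤ R ∧ |a y| ≤ s} ≤ ENNReal.ofReal (C * s) := by
  have hn : 0 < ‖agrad a‖ := norm_pos_iff.2 ha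
  set w : Fin 1 → E d := fun _ => ‖agrad a‖⁻¹ • agrad a with hw
  have how : Orthonormal ℝ w := by
    refine ⟨fun _ => ?_, fun i j hij => absurd (Subsingleton.elim i j) hij⟩
    simp [hw, norm_smul, hn.ne']
  obtain ⟨C, hC, h⟩ := exists_volume_le_of_orthonormal how R hR
  refine ⟨C * ‖agrad a‖⁻¹, by positivity, fun s hs => ?_⟩
  refine le_trans (measure_mono ?_)
    ((h (fun _ => -(‖agrad a‖⁻¹ * a 0)) (‖agrad a‖⁻¹ * s) (by positivity)).trans_eq ?_)
  · rintro y ⟨hy, hya⟩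
    refine ⟨hy, fun _ => ?_⟩
    rw [affine_eq] at hya
    simp only [hw, real_inner_smul_left]
    rw [show ‖agrad a‖⁻¹ * ⟪agrad a, y⟫_ℝ - -(‖agrad a‖⁻¹ * a 0) =
      ‖agrad a‖⁻¹ * (⟪agrad a, y⟫_ℝ + a 0) by ring, abs_mul, abs_of_pos (inv_pos.2 hn)]
    gcongr
  · congr 1
    ring

/-- Two distinct hyperplanes are either parallel, and then thin slabs around them are disjoint, or
transversal, and then Gram-Schmidt on the normals gives two orthonormal directions in which the set
has width `O(s)`. -/
lemma exists_volume_double_slab_le {a b : E d →ᵃ[ℝ] ℝ} (ha : agrad a ≠ 0) (hb : agrad b ≠ 0)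
    (hab : ¬ ∀ y, a y = 0 ↔ b y = 0) (R : ℝ) (hR : 0 ≤ R) :
    ∃ C t : ℝ, 0 ≤ C ∧ 0 < t ∧ ∀ s : ℝ, 0 ≤ s → s < t →
      volume {y : E d | ‖y‖ ≤ R ∧ |a y| ≤ s ∧ |b y| ≤ s} ≤ ENNReal.ofReal (C * s ^ 2) := by
  have hn : 0 < ‖agrad a‖ := norm_pos_iff.2 ha
  set u := ‖agrad a‖⁻¹ • agrad a with hu
  have hu1 : ‖u‖ = 1 := by simp [hu, norm_smul, hn.ne']
  set m := ⟪u, agrad b⟫_ℝ with hm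
  set g := agrad b - m • u with hg
  have hau : ∀ y, ⟪u, y⟫_ℝ = ‖agrad a‖⁻¹ * (a y - a 0) := fun y => by
    rw [affine_eq a y, hu, real_inner_smul_left]
    ring
  have hgy : ∀ y, ⟪g, y⟫_ℝ = b y - b 0 - m * (‖agrad a‖⁻¹ * (a y - a 0)) := fun y => by
    rw [hg, inner_sub_left, real_inner_smul_left, hau, affine_eq b y]
    ring
  -- `g` is the part of the normal of `b` orthogonal to that of `a`. If it vanishes, `b` is a
  -- nonzero multiple of `a` plus a constant `k`, and `k ≠ 0` because the zero sets differ.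
  by_cases hg0 : g = 0
  · set k := b 0 - m * (‖agrad a‖⁻¹ * a 0) with hk
    have hbk : ∀ y, b y = (m * ‖agrad a‖⁻¹) * a y + k := fun y => by
      have := hgy y
      rw [hg0, inner_zero_left] at this
      linarith
    have hm0 : m ≠ 0 := by
      rintro h0
      rw [h0, zero_smul, sub_zero] at hg
      exact hb (hg ▸ hg0)
    have hk0 : k ≠ 0 := by
      intro h0
      apply hab
      intro y
      rw [hbk, h0, add_zero, mul_eq_zero]
      simp [hm0, hn.ne', ha]
    -- The bounds `|a y| ≤ s` and `|b y| ≤ s` force `|k| ≤ (1 + |m| / ‖agrad a‖) s`; below this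
    -- threshold the double slab is empty.
    have hpos : 0 < |k| / (1 + |m * ‖agrad a‖⁻¹|) := by positivity
    refine ⟨0, _, le_rfl, hpos, fun s hs hst => ?_⟩
    rw [lt_div_iff₀ (by positivity)] at hst
    have hempty : {y : E d | ‖y‖ ≤ R ∧ |a y| ≤ s ∧ |b y| ≤ s} = ∅ := by
      rw [eq_empty_iff_forall_notMem]
      rintro y ⟨-, h1, h2⟩
      have h3 : |k| ≤ |b y| + |m * ‖agrad a‖⁻¹| * |a y| := by
        rw [← abs_mul]
        calc |k| = |b y - (m * ‖agrad a‖⁻¹) * a y| := by rw [hbk y]; ring_nf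
          _ ≤ _ := abs_sub _ _
      have h4 : |m * ‖agrad a‖⁻¹| * |a y| ≤ |m * ‖agrad a‖⁻¹| * s := by gcongr
      nlinarith
    simp [hempty]
  · have hgn : 0 < ‖g‖ := norm_pos_iff.2 hg0
    set w : Fin 2 → E d := ![u, ‖g‖⁻¹ • g] with hw
    have hug : ⟪u, g⟫_ℝ = 0 := by
      rw [hg, inner_sub_right, real_inner_smul_right, real_inner_self_eq_norm_sq, hu1, ← hm]
      ring
    have how : Orthonormal ℝ w := by
      constructor
      · intro i
        fin_cases i
        · simpa [hw] using hu1
        · simp [hw, norm_smul, hgn.ne']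
      · intro i j hij
        fin_cases i <;> fin_cases j <;>
          simp_all [real_inner_smul_right, real_inner_smul_left, real_inner_comm]
    obtain ⟨C, hC, h⟩ := exists_volume_le_of_orthonormal how R hR
    set D := ‖agrad a‖⁻¹ + ‖g‖⁻¹ * (1 + |m| * ‖agrad a‖⁻¹) with hD
    have hD0 : 0 ≤ D := by positivity
    refine ⟨C * D ^ 2, 1, by positivity, one_pos, fun s hs _ => ?_⟩
    refine le_trans (measure_mono ?_)
      ((h ![-(‖agrad a‖⁻¹ * a 0), ‖g‖⁻¹ * (m * (‖agrad a‖⁻¹ * a 0) - b 0)] (D * s)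
        (by positivity)).trans_eq ?_)
    · rintro y ⟨hy, h1, h2⟩
      refine ⟨hy, fun j => ?_⟩
      fin_cases j
      · change |⟪u, y⟫_ℝ - -(‖agrad a‖⁻¹ * a 0)| ≤ D * s
        rw [hau, show ‖agrad a‖⁻¹ * (a y - a 0) - -(‖agrad a‖⁻¹ * a 0) = ‖agrad a‖⁻¹ * a y by ring,
          abs_mul, abs_of_pos (inv_pos.2 hn)]
        have : ‖agrad a‖⁻¹ ≤ D := by
          rw [hD]
          have : 0 ≤ ‖g‖⁻¹ * (1 + |m| * ‖agrad a‖⁻¹) := by positivity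
          linarith
        gcongr
      · change |⟪‖g‖⁻¹ • g, y⟫_ℝ - ‖g‖⁻¹ * (m * (‖agrad a‖⁻¹ * a 0) - b 0)| ≤ D * s
        rw [real_inner_smul_left, hgy, show ‖g‖⁻¹ * (b y - b 0 - m * (‖agrad a‖⁻¹ * (a y - a 0))) -
          ‖g‖⁻¹ * (m * (‖agrad a‖⁻¹ * a 0) - b 0) = ‖g‖⁻¹ * (b y - m * (‖agrad a‖⁻¹ * a y)) by ring,
          abs_mul, abs_of_pos (inv_pos.2 hgn)]
        have h3 : |b y - m * (‖agrad a‖⁻¹ * a y)| ≤ s + |m| * (‖agrad a‖⁻¹ * s) := by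
          refine (abs_sub _ _).trans ?_
          rw [abs_mul, abs_mul, abs_of_pos (inv_pos.2 hn)]
          gcongr
        calc ‖g‖⁻¹ * |b y - m * (‖agrad a‖⁻¹ * a y)|
            ≤ ‖g‖⁻¹ * (s + |m| * (‖agrad a‖⁻¹ * s)) := by gcongr
          _ = (‖g‖⁻¹ * (1 + |m| * ‖agrad a‖⁻¹)) * s := by ring
          _ ≤ D * s := by
            rw [hD]
            have : 0 ≤ ‖agrad a‖⁻¹ * s := by positivity
            nlinarith
    · congr 1
      ring

/-! ### Surface measure of pieces of hyperplanes -/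

/-- Translation identifies the disk isometrically with a ball of the hyperplane orthogonal to `n`.
In dimension `d - 1` the normalized Hausdorff measure gives such balls positive and finite mass,
which is all that is used later. -/
lemma surf_disk (x n : E d) (r : ℝ) :
    surf d {y | ‖y - x‖ < r ∧ ⟪n, y - x⟫_ℝ = 0} =
      Measure.euclideanHausdorffMeasure (d - 1) (Metric.ball (0 : (ℝ ∙ n)ᗮ) r) := by
  have hiso : Isometry fun k : (ℝ ∙ n)ᗮ => x + (k : E d) :=
    (isometry_add_left x).comp isometry_subtype_coe
  rw [← hiso.euclideanHausdorffMeasure_image, surf]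
  congr 1
  ext y
  simp only [mem_ofPred_eq, mem_image, Metric.mem_ball, dist_zero_right]
  constructor
  · rintro ⟨h1, h2⟩
    exact ⟨⟨y - x, Submodule.mem_orthogonal_singleton_iff_inner_right.2 h2⟩, h1, by simp⟩
  · rintro ⟨k, hk, rfl⟩
    have := Submodule.mem_orthogonal_singleton_iff_inner_right.1 k.2
    simpa using ⟨hk, this⟩

lemma finrank_orthogonal {n : E d} (hd : 0 < d) (hn : n ≠ 0) :
    Module.finrank ℝ (ℝ ∙ n)ᗮ = d - 1 := by
  have : Fact (Module.finrank ℝ (E d) = (d - 1) + 1) := ⟨by simp; omega⟩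
  exact Submodule.finrank_orthogonal_span_singleton hn

lemma surf_disk_pos (hd : 0 < d) (x : E d) {n : E d} (hn : n ≠ 0) {r : ℝ} (hr : 0 < r) :
    0 < surf d {y | ‖y - x‖ < r ∧ ⟪n, y - x⟫_ℝ = 0} := by
  rw [surf_disk x n, ← finrank_orthogonal hd hn]
  exact Metric.measure_ball_pos _ _ hr

lemma surf_disk_lt_top (hd : 0 < d) (x : E d) {n : E d} (hn : n ≠ 0) (r : ℝ) :
    surf d {y | ‖y - x‖ < r ∧ ⟪n, y - x⟫_ℝ = 0} < ⊤ := by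
  rw [surf_disk x n, ← finrank_orthogonal hd hn]
  exact measure_ball_lt_top

lemma Cell.agrad_coord_ne_zero (hd : 0 < d) (T : Cell d) (i : Fin (d + 1)) :
    agrad (T.coord i) ≠ 0 := by
  intro h
  have : Nontrivial (Fin (d + 1)) := Fin.nontrivial_iff_two_le.2 (by omega)
  obtain ⟨j, hj⟩ := exists_ne i
  have h1 := affine_sub_eq (T.coord i) (T j) (T i)
  rw [h, inner_zero_left, T.coord_apply_eq, T.coord_apply_ne hj.symm] at h1
  norm_num at h1

/-- Affine functions with the same zero set are proportional. -/
lemma exists_eq_mul_of_zero_iff {a b : E d →ᵃ[ℝ] ℝ} (ha : agrad a ≠ 0)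
    (h : ∀ y, a y = 0 ↔ b y = 0) : ∃ c : ℝ, ∀ y, b y = c * a y := by
  have hn : ‖agrad a‖ ^ 2 ≠ 0 := by simpa using ha
  refine ⟨⟪agrad b, agrad a⟫_ℝ / ‖agrad a‖ ^ 2, fun y => ?_⟩
  -- `z` is the orthogonal projection of `y` onto the hyperplane `a = 0`, where `b` vanishes as
  -- well.
  set z := y - (a y / ‖agrad a‖ ^ 2) • agrad a with hz
  have h1 := affine_sub_eq a y z
  have h2 := affine_sub_eq b y z
  have hzy : z - y = -((a y / ‖agrad a‖ ^ 2) • agrad a) := by rw [hz]; abel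
  rw [hzy, inner_neg_right, real_inner_smul_right] at h1 h2
  rw [real_inner_self_eq_norm_sq, div_mul_cancel₀ _ hn] at h1
  have h3 : b z = 0 := (h z).1 (by linarith)
  rw [h3] at h2
  field_simp at h2 ⊢
  linarith

/-! ### Facet hyperplanes and the local shape of the boundary. -/

namespace Triangulation

variable {Ω : Set (E d)} (𝒯 : Triangulation Ω)

open Classical in
/-- The barycentric coordinates of all cells: their zero sets are the hyperplanes spanned
by the facets. -/
noncomputable def facets : Finset (E d →ᵃ[ℝ] ℝ) :=
  𝒯.cells.biUnion fun T => Finset.univ.image T.coord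

lemma coord_mem_facets {T : Cell d} (hT : T ∈ 𝒯.cells) (i : Fin (d + 1)) :
    T.coord i ∈ 𝒯.facets := by
  classical
  exact Finset.mem_biUnion.2 ⟨T, hT, Finset.mem_image_of_mem _ (Finset.mem_univ i)⟩

lemma agrad_ne_zero_of_mem_facets (hd : 0 < d) {a : E d →ᵃ[ℝ] ℝ} (ha : a ∈ 𝒯.facets) :
    agrad a ≠ 0 := by
  classical
  obtain ⟨T, -, h⟩ := Finset.mem_biUnion.1 ha
  obtain ⟨i, -, rfl⟩ := Finset.mem_image.1 h
  exact T.agrad_coord_ne_zero hd i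

lemma exists_facet_of_mem_frontier (hΩ : IsLipschitzDomain Ω) {x : E d} (hx : x ∈ frontier Ω)
    {T : Cell d} (hT : T ∈ 𝒯.cells) (hxT : x ∈ T.carrier) : ∃ i, T.coord i x = 0 := by
  refine T.exists_coord_eq_zero hxT fun h => hx.2 ?_
  rw [hΩ.isOpen.interior_eq]
  exact 𝒯.interior_subset hΩ hT h

/-- `x` lies on at most one of the hyperplanes spanned by the facets. -/
def IsGood (x : E d) : Prop :=
  ∀ a ∈ 𝒯.facets, ∀ b ∈ 𝒯.facets, a x = 0 → b x = 0 → ∀ y, a y = 0 ↔ b y = 0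

/-- Near a boundary point on only one facet hyperplane, the domain is a half ball. -/
lemma exists_normal (hd : 0 < d) (hΩ : IsLipschitzDomain Ω) {x : E d} (hx : x ∈ frontier Ω)
    (hg : 𝒯.IsGood x) :
    ∃ (n : E d) (r : ℝ), ‖n‖ = 1 ∧ 0 < r ∧ ∀ y, ‖y - x‖ < r → (y ∈ Ω ↔ ⟪n, y - x⟫_ℝ < 0) := by
  obtain ⟨T, hT, hxT⟩ := 𝒯.exists_cell hx.1
  obtain ⟨i, hi⟩ := 𝒯.exists_facet_of_mem_frontier hΩ hx hT hxT
  set a := T.coord i with ha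
  have haf : a ∈ 𝒯.facets := 𝒯.coord_mem_facets hT i
  have hag : agrad a ≠ 0 := 𝒯.agrad_ne_zero_of_mem_facets hd haf
  have hagp : 0 < ‖agrad a‖ := norm_pos_iff.2 hag
  have hay : ∀ y, a y = ⟪agrad a, y - x⟫_ℝ := fun y => by
    rw [← affine_sub_eq, hi, sub_zero]
  -- each cell at `x` is locally a half ball bounded by the hyperplane `a = 0`
  have hcell : ∀ S ∈ 𝒯.cells, x ∈ S.carrier → ∃ c : ℝ, c ≠ 0 ∧
      ∀ᶠ y in 𝓝 x, (y ∈ S.carrier ↔ 0 ≤ c * a y) := by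
    intro S hS hxS
    obtain ⟨j, hj⟩ := 𝒯.exists_facet_of_mem_frontier hΩ hx hS hxS
    obtain ⟨c, hc⟩ := exists_eq_mul_of_zero_iff hag
      (hg a haf (S.coord j) (𝒯.coord_mem_facets hS j) hi hj)
    refine ⟨c, ?_, ?_⟩
    · rintro rfl
      have := hc (S j)
      rw [S.coord_apply_eq] at this
      norm_num at this
    · have hne : ∀ k, k ≠ j → 0 < S.coord k x := by
        intro k hk
        refine lt_of_le_of_ne (S.mem_carrier.1 hxS k) fun h0 => ?_
        -- If coordinate `k` also vanished at `x`, it would have the same zero set as coordinate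
        -- `j`; vertex `k` separates the two.
        have h1 := hg _ (𝒯.coord_mem_facets hS k) _ (𝒯.coord_mem_facets hS j) h0.symm hj (S k)
        rw [S.coord_apply_eq, S.coord_apply_ne hk.symm] at h1
        norm_num at h1
      have hev : ∀ᶠ y in 𝓝 x, ∀ k, k ≠ j → 0 < S.coord k y := by
        rw [eventually_all]
        intro k
        by_cases hk : k = j
        · exact Eventually.of_forall fun y h => absurd hk h
        · have hc : Continuous (S.coord k) := (contDiff_affine (S.coord k) (n := 0)).continuous
          filter_upwards [(isOpen_lt continuous_const hc).mem_nhds (hne k hk)] with y hy _ using hy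
      filter_upwards [hev] with y hy
      rw [S.mem_carrier, ← hc y]
      refine ⟨fun h => h j, fun h k => ?_⟩
      by_cases hk : k = j
      · rwa [hk]
      · exact (hy k hk).le
  have hfar : ∀ᶠ y in 𝓝 x, ∀ S ∈ 𝒯.cells, x ∉ S.carrier → y ∉ S.carrier := by
    rw [Filter.eventually_all_finset]
    intro S _
    by_cases h : x ∈ S.carrier
    · exact Eventually.of_forall fun y h' => absurd h h'
    · filter_upwards [S.isClosed.isOpen_compl.mem_nhds h] with y hy _ using hy
  have hTa : ∀ᶠ y in 𝓝 x, 0 ≤ a y → y ∈ closure Ω := by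
    have hev : ∀ᶠ y in 𝓝 x, ∀ k, 0 < T.coord k x → 0 < T.coord k y := by
      rw [eventually_all]
      intro k
      by_cases hk : 0 < T.coord k x
      · have hc : Continuous (T.coord k) := (contDiff_affine (T.coord k) (n := 0)).continuous
        filter_upwards [(isOpen_lt continuous_const hc).mem_nhds hk] with y hy _ using hy
      · exact Eventually.of_forall fun y h => absurd h hk
    filter_upwards [hev] with y hy h0
    refine 𝒯.carrier_subset hT (T.mem_carrier.2 fun k => ?_)
    rcases (T.mem_carrier.1 hxT k).lt_or_eq with hk | hk
    · exact (hy k hk).le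
    · by_cases hki : k = i
      · rwa [hki]
      · have h1 := hg _ (𝒯.coord_mem_facets hT k) _ haf hk.symm hi (T k)
        rw [T.coord_apply_eq, ha, T.coord_apply_ne (Ne.symm hki)] at h1
        norm_num at h1
  have hpos : ∀ S ∈ 𝒯.cells, x ∈ S.carrier → ∀ᶠ y in 𝓝 x, y ∈ S.carrier → 0 ≤ a y := by
    intro S hS hxS
    obtain ⟨c, hc0, hc⟩ := hcell S hS hxS
    rcases lt_or_gt_of_ne hc0 with hneg | hp
    -- Here `S` fills the half ball opposite to the one filled by `T`. Together they cover a
    -- neighbourhood of `x`, making `x` interior to `closure Ω` and hence a point of `Ω`.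
    · exfalso
      apply hx.2
      rw [hΩ.isOpen.interior_eq, ← hΩ.interior_closure, mem_interior_iff_mem_nhds]
      filter_upwards [hc, hTa] with y h1 h2
      rcases le_total 0 (a y) with h | h
      · exact h2 h
      · exact 𝒯.carrier_subset hS (h1.2 (mul_nonneg_of_nonpos_of_nonpos hneg.le h))
    · filter_upwards [hc] with y hy hyS
      exact nonneg_of_mul_nonneg_right (hy.1 hyS) hp
  have hpos' : ∀ᶠ y in 𝓝 x, ∀ S ∈ 𝒯.cells, x ∈ S.carrier → y ∈ S.carrier → 0 ≤ a y := by
    rw [Filter.eventually_all_finset]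
    intro S hS
    by_cases h : x ∈ S.carrier
    · filter_upwards [hpos S hS h] with y hy _ using hy
    · exact Eventually.of_forall fun y h' => absurd h' h
  have hclo : ∀ᶠ y in 𝓝 x, (y ∈ closure Ω ↔ 0 ≤ a y) := by
    filter_upwards [hfar, hpos', hTa] with y h1 h2 h3
    refine ⟨fun hy => ?_, h3⟩
    obtain ⟨S, hS, hyS⟩ := 𝒯.exists_cell hy
    by_cases hxS : x ∈ S.carrier
    · exact h2 S hS hxS hyS
    · exact absurd hyS (h1 S hS hxS)
  obtain ⟨r, hr, hball⟩ := Metric.eventually_nhds_iff_ball.1 hclo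
  refine ⟨-(‖agrad a‖⁻¹ • agrad a), r, ?_, hr, fun y hy => ?_⟩
  · rw [norm_neg, norm_smul, norm_inv, norm_norm, inv_mul_cancel₀ hagp.ne']
  · rw [inner_neg_left, real_inner_smul_left, ← hay, neg_lt_zero,
      mul_pos_iff_of_pos_left (inv_pos.2 hagp)]
    have hyb : y ∈ Metric.ball x r := by rwa [Metric.mem_ball, dist_eq_norm]
    have hac : Continuous a := (contDiff_affine a (n := 0)).continuous
    conv_lhs => rw [← hΩ.interior_closure]
    constructor
    · intro hyi
      -- On the hyperplane itself, a small displacement along `-agrad a` would stay in `closure Ω`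
      -- while making `a` negative.
      refine lt_of_le_of_ne ((hball y hyb).1 (_root_.interior_subset hyi)) fun hz => ?_
      have hc : Continuous fun t : ℝ => y - t • agrad a := by fun_prop
      have ht : Tendsto (fun t : ℝ => y - t • agrad a) (𝓝[>] 0) (𝓝 y) := by
        have h2 := hc.tendsto 0
        simp only [zero_smul, sub_zero] at h2
        exact h2.mono_left nhdsWithin_le_nhds
      have h0 : ∀ᶠ z in 𝓝 y, z ∈ closure Ω := mem_interior_iff_mem_nhds.1 hyi
      have h1 := ht.eventually (h0.and (Metric.isOpen_ball.mem_nhds hyb))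
      obtain ⟨t, ⟨ht1, ht2⟩, htp⟩ := (h1.and self_mem_nhdsWithin).exists
      have h3 := (hball _ ht2).1 ht1
      have h4 := affine_sub_eq a y (y - t • agrad a)
      rw [sub_sub_cancel_left, inner_neg_right, real_inner_smul_right,
        real_inner_self_eq_norm_sq] at h4
      have htp' : (0 : ℝ) < t := htp
      have : 0 < t * ‖agrad a‖ ^ 2 := by positivity
      linarith
    · intro h0
      rw [mem_interior_iff_mem_nhds]
      filter_upwards [Metric.isOpen_ball.mem_nhds hyb, (isOpen_lt continuous_const hac).mem_nhds h0]
        with z hz hz'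
      exact (hball z hz).2 (le_of_lt hz')

include 𝒯 in
/-- The surface measure of the boundary is finite. -/
lemma surf_frontier_lt_top (hd : 0 < d) (hΩ : IsLipschitzDomain Ω) :
    surf d (frontier Ω) < ⊤ := by
  obtain ⟨R, hR⟩ := hΩ.isBounded.closure.subset_ball 0
  have hsub : frontier Ω ⊆ ⋃ a ∈ 𝒯.facets, {y | ‖y‖ < R ∧ a y = 0} := by
    intro x hx
    obtain ⟨T, hT, hxT⟩ := 𝒯.exists_cell hx.1
    obtain ⟨i, hi⟩ := 𝒯.exists_facet_of_mem_frontier hΩ hx hT hxT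
    exact mem_biUnion (𝒯.coord_mem_facets hT i) ⟨by simpa using hR hx.1, hi⟩
  refine (measure_mono hsub).trans_lt (measure_biUnion_lt_top 𝒯.facets.finite_toSet fun a ha => ?_)
  by_cases hne : ∃ x, a x = 0
  · obtain ⟨x, hx⟩ := hne
    refine (measure_mono ?_).trans_lt
      (surf_disk_lt_top hd x (𝒯.agrad_ne_zero_of_mem_facets hd ha) (R + ‖x‖))
    rintro y ⟨hy, hay⟩
    refine ⟨(norm_sub_le _ _).trans_lt (by linarith), ?_⟩
    rw [← affine_sub_eq, hx, hay, sub_zero]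
  · have : {y | ‖y‖ < R ∧ a y = 0} = ∅ := by
      rw [eq_empty_iff_forall_notMem]
      exact fun y hy => hne ⟨y, hy.2⟩
    simp [this]

end Triangulation

/-- A function vanishing a.e. on `ΓD` has no inflow through boundary points on only one facet
hyperplane. -/
lemma Problem.Admissible.sq_mul_flux_nonneg {P : Problem d} (hd : 0 < d) (hP : P.Admissible)
    {v : E d → ℝ} (hv : ContinuousOn v (closure P.Ω))
    (hv0 : v =ᵐ[(surf d).restrict P.ΓD] 0) {x n : E d} {r : ℝ} (hx : x ∈ frontier P.Ω)
    (hn : ‖n‖ = 1) (hr : 0 < r) (hball : ∀ y, ‖y - x‖ < r → (y ∈ P.Ω ↔ ⟪n, y - x⟫_ℝ < 0)) :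
    0 ≤ v x ^ 2 * ⟪P.β x, n⟫_ℝ := by
  have hn0 : n ≠ 0 := by rintro rfl; simp at hn
  by_contra! hlt
  have hvx : v x ≠ 0 := by
    intro h
    simp [h] at hlt
  have hβx : ⟪P.β x, n⟫_ℝ < 0 := by
    by_contra! h
    exact absurd hlt (not_lt.2 (by positivity))
  have hev : ∀ᶠ y in 𝓝[closure P.Ω] x, v y ≠ 0 ∧ ⟪P.β y, n⟫_ℝ < 0 := by
    have h1 := (hv x hx.1).eventually_ne hvx
    have h2 : ContinuousWithinAt (fun y => ⟪P.β y, n⟫_ℝ) (closure P.Ω) x :=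
      ContinuousWithinAt.inner (hP.β_cont x hx.1) continuousWithinAt_const
    exact h1.and (h2.eventually_lt_const hβx)
  rw [eventually_nhdsWithin_iff, Metric.eventually_nhds_iff_ball] at hev
  obtain ⟨s, hs, hs'⟩ := hev
  -- If the product were negative, every point of this flat disk would be a boundary point with the
  -- same normal `n`, with inflow and with `v ≠ 0`. So the disk would lie in `ΓD`, and its positive
  -- surface measure contradicts the vanishing of `v` almost everywhere there.
  set D := {y | ‖y - x‖ < min r s ∧ ⟪n, y - x⟫_ℝ = 0} with hD
  have hDf : ∀ y ∈ D, y ∈ frontier P.Ω ∧ IsOutwardNormal P.Ω y n := by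
    rintro y ⟨hy1, hy2⟩
    have hyr : ‖y - x‖ < r := hy1.trans_le (min_le_left _ _)
    have hnear : ∀ᶠ z in 𝓝 y, (z ∈ P.Ω ↔ ⟪n, z - y⟫_ℝ < 0) := by
      have : ∀ᶠ z in 𝓝 y, ‖z - x‖ < r :=
        (isOpen_lt (by fun_prop) continuous_const).mem_nhds hyr
      filter_upwards [this] with z hz
      rw [hball z hz]
      have : z - x = (z - y) + (y - x) := by abel
      rw [this, inner_add_right, hy2, add_zero]
    refine ⟨⟨?_, ?_⟩, hn, fun η hη => ?_⟩
    · rw [mem_closure_iff_frequently]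
      have hc : Continuous fun t : ℝ => y - t • n := by fun_prop
      have ht : Tendsto (fun t : ℝ => y - t • n) (𝓝[>] 0) (𝓝 y) := by
        have h2 := hc.tendsto 0
        simp only [zero_smul, sub_zero] at h2
        exact h2.mono_left nhdsWithin_le_nhds
      refine ht.frequently (Eventually.frequently ?_)
      filter_upwards [ht.eventually hnear, self_mem_nhdsWithin] with t h1 h2
      rw [h1, sub_sub_cancel_left, inner_neg_right, real_inner_smul_right,
        real_inner_self_eq_norm_sq, hn]
      have : (0 : ℝ) < t := h2
      linarith
    · rw [hP.domain.isOpen.interior_eq, hnear.self_of_nhds]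
      simp
    · filter_upwards [hnear] with z hz
      have : 0 ≤ η * ‖z - y‖ := by positivity
      rw [hz]
      exact ⟨fun h => by linarith, fun h => by linarith⟩
  have hDΓ : D ⊆ {y | v y ≠ 0} ∩ P.ΓD := by
    intro y hy
    have hys := hs' y (by
      rw [Metric.mem_ball, dist_eq_norm]; exact hy.1.trans_le (min_le_right _ _)) (hDf y hy).1.1
    exact ⟨hys.1, hP.inflow y (hDf y hy).1 n (hDf y hy).2 hys.2⟩
  have h0 : surf d ({y | v y ≠ 0} ∩ P.ΓD) = 0 := by
    rw [EventuallyEq, ae_restrict_iff' hP.measurable_ΓD, ae_iff] at hv0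
    convert hv0 using 2
    ext y
    simp [and_comm]
  exact (surf_disk_pos hd x hn0 (lt_min hr hs)).ne' (measure_mono_null hDΓ h0)

lemma Triangulation.isFiniteMeasure_restrict {Ω : Set (E d)} (𝒯 : Triangulation Ω) :
    IsFiniteMeasure ((volume : Measure (E d)).restrict Ω) :=
  ⟨by
    rw [Measure.restrict_apply_univ]
    exact (measure_mono subset_closure).trans_lt 𝒯.isCompact_closure.measure_lt_top⟩

/-! ### Piecewise continuously differentiable functions -/

/-- `v` is continuous on `closure Ω` and continuously differentiable up to the boundary
on each cell. -/
structure IsPw {Ω : Set (E d)} (𝒯 : Triangulation Ω) (v : E d → ℝ) : Prop where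
  cont : ContinuousOn v (closure Ω)
  poly : ∀ T ∈ 𝒯.cells, ∃ p : E d → ℝ, ContDiff ℝ 1 p ∧ EqOn v p T.carrier

namespace IsPw

variable {Ω : Set (E d)} {𝒯 : Triangulation Ω} {u v : E d → ℝ}

lemma mul (hu : IsPw 𝒯 u) (hv : IsPw 𝒯 v) : IsPw 𝒯 (fun x => u x * v x) := by
  refine ⟨hu.cont.mul hv.cont, fun T hT => ?_⟩
  obtain ⟨p, hp, hup⟩ := hu.poly T hT
  obtain ⟨q, hq, hvq⟩ := hv.poly T hT
  exact ⟨fun x => p x * q x, hp.mul hq, fun x hx => by simp [hup hx, hvq hx]⟩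

lemma exists_bound (hv : IsPw 𝒯 v) : ∃ B : ℝ, 0 ≤ B ∧ ∀ x ∈ closure Ω, |v x| ≤ B := by
  obtain ⟨B, hB⟩ := 𝒯.isCompact_closure.exists_bound_of_continuousOn hv.cont
  exact ⟨max B 0, le_max_right _ _, fun x hx => (hB x hx).trans (le_max_left _ _)⟩

include 𝒯 in
-- Any point close enough to `x` shares a cell with `x`, so one of the cell constants applies; their
-- sum serves for all cells at once. Only pointwise bounds result, as `Ω` need not be convex.
lemma ptLip_of_forall_cell (hΩ : IsOpen Ω) {L : Cell d → ℝ} (hL0 : ∀ T ∈ 𝒯.cells, 0 ≤ L T)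
    (hL : ∀ T ∈ 𝒯.cells, ∀ x ∈ T.carrier, ∀ y ∈ T.carrier, |v y - v x| ≤ L T * ‖y - x‖)
    {x : E d} (hx : x ∈ Ω) : PtLip v (∑ T ∈ 𝒯.cells, L T) x := by
  have hfar : ∀ᶠ y in 𝓝 x, ∀ S ∈ 𝒯.cells, x ∉ S.carrier → y ∉ S.carrier := by
    rw [Filter.eventually_all_finset]
    intro S _
    by_cases h : x ∈ S.carrier
    · exact Eventually.of_forall fun y h' => absurd h h'
    · filter_upwards [S.isClosed.isOpen_compl.mem_nhds h] with y hy _ using hy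
  filter_upwards [hfar, hΩ.mem_nhds hx] with y hy hyΩ
  obtain ⟨S, hS, hyS⟩ := 𝒯.exists_cell (subset_closure hyΩ)
  have hxS : x ∈ S.carrier := by
    by_contra h
    exact hy S hS h hyS
  exact (hL S hS x hxS y hyS).trans
    (mul_le_mul_of_nonneg_right (Finset.single_le_sum hL0 hS) (norm_nonneg _))

lemma exists_ptLip (hΩ : IsOpen Ω) (hv : IsPw 𝒯 v) : ∃ L : ℝ, 0 ≤ L ∧ ∀ x ∈ Ω, PtLip v L x := by
  have h : ∀ T ∈ 𝒯.cells, ∃ L : ℝ, 0 ≤ L ∧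
      ∀ x ∈ T.carrier, ∀ y ∈ T.carrier, |v y - v x| ≤ L * ‖y - x‖ := by
    intro T hT
    obtain ⟨p, hp, hvp⟩ := hv.poly T hT
    obtain ⟨L, hL, h⟩ := T.exists_lipschitz hp
    exact ⟨L, hL, fun x hx y hy => by rw [hvp hx, hvp hy]; exact h x hx y hy⟩
  choose! L hL0 hL using h
  exact ⟨∑ T ∈ 𝒯.cells, L T, Finset.sum_nonneg hL0,
    fun x hx => ptLip_of_forall_cell hΩ hL0 hL hx⟩

lemma differentiableAt (hv : IsPw 𝒯 v) {T : Cell d} (hT : T ∈ 𝒯.cells) {x : E d}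
    (hx : x ∈ interior T.carrier) : DifferentiableAt ℝ v x := by
  obtain ⟨p, hp, hvp⟩ := hv.poly T hT
  exact (hp.differentiable (by simp) x).congr_of_eventuallyEq
    (hvp.eventuallyEq_of_mem (mem_interior_iff_mem_nhds.1 hx))

lemma ae_differentiableAt (hΩ : IsLipschitzDomain Ω) (hv : IsPw 𝒯 v) :
    ∀ᵐ x ∂(volume.restrict Ω), DifferentiableAt ℝ v x :=
  𝒯.ae_of_forall_interior hΩ fun _ hT _ hx => hv.differentiableAt hT hx

lemma aestronglyMeasurable (hΩ : IsLipschitzDomain Ω) (hv : IsPw 𝒯 v) :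
    AEStronglyMeasurable v (volume.restrict Ω) :=
  (hv.cont.mono subset_closure).aestronglyMeasurable hΩ.isOpen.measurableSet

lemma exists_gradient_bound (hΩ : IsOpen Ω) (hv : IsPw 𝒯 v) :
    ∃ L : ℝ, 0 ≤ L ∧ ∀ x ∈ Ω, ‖gradient v x‖ ≤ L := by
  obtain ⟨L, hL0, hL⟩ := hv.exists_ptLip hΩ
  refine ⟨L, hL0, fun x hx => ?_⟩
  rw [norm_gradient_eq]
  exact (hL x hx).norm_fderiv_le hL0

lemma memLp (hΩ : IsLipschitzDomain Ω) (hv : IsPw 𝒯 v) (p : ℝ≥0∞) :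
    MemLp v p (volume.restrict Ω) := by
  have := 𝒯.isFiniteMeasure_restrict
  obtain ⟨B, -, hB⟩ := hv.exists_bound
  refine MemLp.of_bound (hv.aestronglyMeasurable hΩ) B ?_
  filter_upwards [ae_restrict_mem hΩ.isOpen.measurableSet] with x hx
    using hB x (subset_closure hx)

lemma memLp_gradient (hΩ : IsLipschitzDomain Ω) (hv : IsPw 𝒯 v) (p : ℝ≥0∞) :
    MemLp (gradient v) p (volume.restrict Ω) := by
  have := 𝒯.isFiniteMeasure_restrict
  obtain ⟨B, -, hB⟩ := hv.exists_gradient_bound hΩ.isOpen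
  refine MemLp.of_bound (measurable_gradient v).aestronglyMeasurable B ?_
  filter_upwards [ae_restrict_mem hΩ.isOpen.measurableSet] with x hx using hB x hx

lemma memH1 (hΩ : IsLipschitzDomain Ω) (hv : IsPw 𝒯 v) : MemH1 Ω v (gradient v) := by
  obtain ⟨B, -, hB⟩ := hv.exists_bound
  obtain ⟨L, hL0, hL⟩ := hv.exists_ptLip hΩ.isOpen
  exact ⟨hv.memLp hΩ 2, hv.memLp_gradient hΩ 2, hasWeakGrad_of_ptLip hΩ.isOpen hL0 hL
    (fun x hx => hB x (subset_closure hx)) (hv.ae_differentiableAt hΩ)⟩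

lemma memLp_frontier (hd : 0 < d) (hΩ : IsLipschitzDomain Ω) (hv : IsPw 𝒯 v) :
    MemLp v 2 ((surf d).restrict (frontier Ω)) := by
  have : IsFiniteMeasure ((surf d).restrict (frontier Ω)) :=
    ⟨by rw [Measure.restrict_apply_univ]; exact 𝒯.surf_frontier_lt_top hd hΩ⟩
  obtain ⟨B, -, hB⟩ := hv.exists_bound
  refine MemLp.of_bound ((hv.cont.mono frontier_subset_closure).aestronglyMeasurable
    isClosed_frontier.measurableSet) B ?_
  filter_upwards [ae_restrict_mem isClosed_frontier.measurableSet] with x hx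
    using hB x (frontier_subset_closure hx)

lemma isTrace (hd : 0 < d) (hΩ : IsLipschitzDomain Ω) (hv : IsPw 𝒯 v) :
    IsTrace Ω v (gradient v) v := by
  refine ⟨hv.memLp_frontier hd hΩ, fun _ => v, fun _ => gradient v,
    fun _ => ⟨hv.memH1 hΩ, hv.cont⟩, ?_, ?_, ?_⟩ <;> simp [L2]

end IsPw

/-! ### The distance to the complement -/

/-- Where the distance to the complement is differentiable, its gradient is the unit vector
pointing away from a nearest boundary point. -/
lemma exists_gradient_infDist_eq {Ω : Set (E d)} (hΩ : IsOpen Ω) (hne : Ωᶜ.Nonempty) {x : E d}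
    (hx : x ∈ Ω) (hdiff : DifferentiableAt ℝ (fun y => Metric.infDist y Ωᶜ) x) :
    ∃ y ∈ frontier Ω, 0 < Metric.infDist x Ωᶜ ∧ ‖y - x‖ = Metric.infDist x Ωᶜ ∧
      gradient (fun y => Metric.infDist y Ωᶜ) x = -((Metric.infDist x Ωᶜ)⁻¹ • (y - x)) := by
  set D := fun y => Metric.infDist y Ωᶜ with hD
  have hcl : IsClosed Ωᶜ := hΩ.isClosed_compl
  obtain ⟨y, hy, hyd⟩ := hcl.exists_infDist_eq_dist hne x
  have hyn : ‖y - x‖ = D x := by rw [← dist_eq_norm, dist_comm]; exact hyd.symm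
  have hpos : 0 < D x := by
    rw [← hyn, norm_pos_iff, sub_ne_zero]
    rintro rfl
    exact hy hx
  -- Moving towards the nearest point `y` decreases the distance at least at unit rate.
  have hseg : ∀ t : ℝ, 0 < t → t ≤ 1 → D (x + t • (y - x)) ≤ (1 - t) * D x := by
    intro t ht ht1
    refine (Metric.infDist_le_dist_of_mem hy).trans_eq ?_
    rw [dist_eq_norm, show x + t • (y - x) - y = -((1 - t) • (y - x)) by module, norm_neg,
      norm_smul, Real.norm_of_nonneg (by linarith), hyn]
  have hIoc : ∀ᶠ t in 𝓝[>] (0 : ℝ), 0 < t ∧ t ≤ 1 := by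
    filter_upwards [Ioc_mem_nhdsGT (zero_lt_one (α := ℝ))] with t ht using ⟨ht.1, ht.2⟩
  refine ⟨y, ⟨?_, ?_⟩, hpos, hyn, ?_⟩
  · -- the points of the open segment from `x` to `y` belong to `Ω`
    rw [mem_closure_iff_frequently]
    have hc : Continuous fun t : ℝ => x + (1 - t) • (y - x) := by fun_prop
    have ht : Tendsto (fun t : ℝ => x + (1 - t) • (y - x)) (𝓝[>] 0) (𝓝 y) := by
      have h2 := hc.tendsto 0
      simp only [sub_zero, one_smul, add_sub_cancel] at h2
      exact h2.mono_left nhdsWithin_le_nhds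
    refine ht.frequently (Eventually.frequently ?_)
    filter_upwards [hIoc] with t ht
    by_contra hnot
    refine Metric.notMem_of_dist_lt_infDist (x := x) (s := Ωᶜ) ?_ hnot
    rw [dist_comm, dist_eq_norm, add_sub_cancel_left, norm_smul, hyn,
      Real.norm_of_nonneg (by linarith)]
    change (1 - t) * D x < D x
    nlinarith
  · rw [hΩ.interior_eq]
    exact hy
  · have hle : fderiv ℝ D x (y - x) ≤ -D x := by
      have h1 := (hdiff.hasFDerivAt.hasLineDerivAt (y - x)).tendsto_slope_zero_right
      refine le_of_tendsto h1 ?_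
      filter_upwards [hIoc] with t ht
      have h2 := hseg t ht.1 ht.2
      rw [smul_eq_mul, inv_mul_le_iff₀ ht.1]
      linarith
    have hg1 : ‖gradient D x‖ ≤ 1 := by
      rw [norm_gradient_eq]
      simpa using norm_fderiv_le_of_lipschitz ℝ (Metric.lipschitz_infDist_pt (s := Ωᶜ)) (x₀ := x)
    rw [← inner_gradient_eq] at hle
    -- Slope at most `-1` towards `y` and gradient norm at most `1` form the equality case of
    -- Cauchy-Schwarz: the squared norm of the sum is at most `1 - 2 + 1`.
    rw [eq_neg_iff_add_eq_zero, ← norm_eq_zero, ← sq_eq_zero_iff]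
    refine le_antisymm ?_ (by positivity)
    rw [norm_add_sq_real, real_inner_smul_right, norm_smul, hyn, norm_inv,
      Real.norm_of_nonneg hpos.le, inv_mul_cancel₀ hpos.ne']
    have h3 : (D x)⁻¹ * ⟪gradient D x, y - x⟫_ℝ ≤ (D x)⁻¹ * (-D x) := by gcongr
    rw [mul_neg, inv_mul_cancel₀ hpos.ne'] at h3
    nlinarith [norm_nonneg (gradient D x)]

/-- The normal at a boundary point touched by an interior ball is radial. -/
lemma normal_eq_of_touching {Ω : Set (E d)} {x y n : E d} {r : ℝ} (hn : ‖n‖ = 1) (hr : 0 < r)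
    (hball : ∀ z, ‖z - y‖ < r → (z ∈ Ω ↔ ⟪n, z - y⟫_ℝ < 0)) (hpos : 0 < ‖y - x‖)
    (hin : ∀ z, ‖z - x‖ < ‖y - x‖ → z ∈ Ω) : ‖y - x‖⁻¹ • (y - x) = n := by
  set ρ := ‖y - x‖ with hρ
  set u := ρ⁻¹ • (y - x) with hu
  have hu1 : ‖u‖ = 1 := by
    rw [hu, norm_smul, norm_inv, Real.norm_of_nonneg hpos.le, ← hρ, inv_mul_cancel₀ hpos.ne']
  have hyx : y - x = ρ • u := by rw [hu, smul_smul, mul_inv_cancel₀ hpos.ne', one_smul]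
  by_contra hne
  have hm : ⟪u, n⟫_ℝ < 1 := by
    refine lt_of_le_of_ne ?_ fun h => hne ((inner_eq_one_iff_of_norm_eq_one hu1 hn).1 h)
    have := real_inner_le_norm u n
    rwa [hu1, hn, one_mul] at this
  set m := ⟪u, n⟫_ℝ with hmdef
  -- The displacement `t • (n - u)` from `y` enters the inner ball when `u ≠ n` and `t < ρ`, yet has
  -- positive component along `n`, so it leaves `Ω`. Since `‖n - u‖ ≤ 2`, the bound `r / 4` keeps it
  -- where the half space description holds.
  set t := min (ρ / 2) (r / 4) with ht
  have ht0 : 0 < t := by positivity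
  have htρ : t ≤ ρ / 2 := min_le_left _ _
  have htr : t ≤ r / 4 := min_le_right _ _
  have hz2 : ‖n - u‖ ^ 2 = 2 - 2 * m := by
    rw [norm_sub_sq_real, hn, hu1, real_inner_comm, ← hmdef]; ring
  have hmem : y + t • (n - u) ∈ Ω := by
    apply hin
    rw [show y + t • (n - u) - x = ρ • u + t • (n - u) by rw [← hyx]; abel]
    refine lt_of_pow_lt_pow_left₀ 2 hpos.le ?_
    rw [norm_add_sq_real, norm_smul ρ u, norm_smul t (n - u), real_inner_smul_left, real_inner_smul_right,
      inner_sub_right, real_inner_self_eq_norm_sq, ← hmdef, mul_pow, mul_pow, hu1, hz2,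
      Real.norm_of_nonneg hpos.le, Real.norm_of_nonneg ht0.le]
    have : 0 < t * (1 - m) * (ρ - t) := by
      have : 0 < ρ - t := by linarith
      have : 0 < 1 - m := by linarith
      positivity
    nlinarith
  have hlt := (hball (y + t • (n - u)) (by
    rw [add_sub_cancel_left, norm_smul, Real.norm_of_nonneg ht0.le]
    have : ‖n - u‖ ≤ 2 := (norm_sub_le _ _).trans (by rw [hn, hu1]; norm_num)
    nlinarith)).1 hmem
  rw [add_sub_cancel_left, real_inner_smul_right, inner_sub_right, real_inner_self_eq_norm_sq, hn,
    real_inner_comm, ← hmdef] at hlt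
  nlinarith

/-! ### Cutoff functions -/

/-- The sign of the derivative is essential: it makes the cutoff gradient a nonnegative multiple of
the gradient of the distance, so that a one-sided flux bound survives. -/
lemma monotone_smoothTransition : Monotone Real.smoothTransition := by
  intro x y hxy
  have h1 := expNegInvGlue.monotone hxy
  have h2 := expNegInvGlue.monotone (show 1 - y ≤ 1 - x by linarith)
  have h3 := expNegInvGlue.nonneg x
  have h4 := expNegInvGlue.nonneg (1 - y)
  unfold Real.smoothTransition
  rw [div_le_div_iff₀ (Real.smoothTransition.pos_denom x) (Real.smoothTransition.pos_denom y)]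
  nlinarith [mul_le_mul h1 h2 h4 (h3.trans h1)]

lemma deriv_smoothTransition_nonneg (x : ℝ) : 0 ≤ deriv Real.smoothTransition x :=
  monotone_smoothTransition.deriv_nonneg

lemma differentiable_smoothTransition : Differentiable ℝ Real.smoothTransition :=
  (Real.smoothTransition.contDiff (n := 1)).differentiable (by simp)

lemma deriv_smoothTransition_eq_zero {x : ℝ} (hx : x ∉ Icc (0 : ℝ) 1) :
    deriv Real.smoothTransition x = 0 := by
  rw [mem_Icc, not_and_or, not_le, not_le] at hx
  rcases hx with h | h
  · have : Real.smoothTransition =ᶠ[𝓝 x] fun _ => 0 := by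
      filter_upwards [Iio_mem_nhds h] with y hy
      exact Real.smoothTransition.zero_of_nonpos (le_of_lt hy)
    rw [this.deriv_eq, deriv_const]
  · have : Real.smoothTransition =ᶠ[𝓝 x] fun _ => 1 := by
      filter_upwards [Ioi_mem_nhds h] with y hy
      exact Real.smoothTransition.one_of_one_le (le_of_lt hy)
    rw [this.deriv_eq, deriv_const]

lemma exists_deriv_smoothTransition_le :
    ∃ M : ℝ≥0, ∀ x, deriv Real.smoothTransition x ≤ M := by
  obtain ⟨M, hM⟩ := (isCompact_Icc (a := (0 : ℝ)) (b := 1)).exists_bound_of_continuousOn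
    ((Real.smoothTransition.contDiff (n := 1)).continuous_deriv (by simp)).continuousOn
  refine ⟨M.toNNReal, fun x => ?_⟩
  by_cases hx : x ∈ Icc (0 : ℝ) 1
  · exact (le_abs_self _).trans ((hM x hx).trans (Real.le_coe_toNNReal M))
  · rw [deriv_smoothTransition_eq_zero hx]
    positivity

/-- A cutoff function, equal to `1` at distance `2δ` from the complement of `Ω` and vanishing at
distance `δ`. -/
noncomputable def cutoff (Ω : Set (E d)) (δ : ℝ) (x : E d) : ℝ :=
  Real.smoothTransition (Metric.infDist x Ωᶜ / δ - 1)

lemma cutoff_nonneg (Ω : Set (E d)) (δ : ℝ) (x : E d) : 0 ≤ cutoff Ω δ x :=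
  Real.smoothTransition.nonneg _

lemma abs_cutoff_le (Ω : Set (E d)) (δ : ℝ) (x : E d) : |cutoff Ω δ x| ≤ 1 := by
  rw [abs_of_nonneg (cutoff_nonneg Ω δ x)]
  exact Real.smoothTransition.le_one _

lemma cutoff_eq_zero {Ω : Set (E d)} {δ : ℝ} (hδ : 0 < δ) {x : E d}
    (hx : Metric.infDist x Ωᶜ ≤ δ) : cutoff Ω δ x = 0 := by
  apply Real.smoothTransition.zero_of_nonpos
  rw [sub_nonpos, div_le_one hδ]
  exact hx

lemma cutoff_eq_one {Ω : Set (E d)} {δ : ℝ} (hδ : 0 < δ) {x : E d}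
    (hx : 2 * δ ≤ Metric.infDist x Ωᶜ) : cutoff Ω δ x = 1 := by
  apply Real.smoothTransition.one_of_one_le
  rw [le_sub_iff_add_le, le_div_iff₀ hδ]
  linarith

lemma lipschitzWith_cutoff {M : ℝ≥0} (hM : ∀ x, deriv Real.smoothTransition x ≤ M)
    (Ω : Set (E d)) {δ : ℝ≥0} (hδ : 0 < δ) : LipschitzWith (M / δ) (cutoff Ω δ) := by
  have h1 : LipschitzWith M Real.smoothTransition := by
    refine lipschitzWith_of_nnnorm_deriv_le differentiable_smoothTransition fun x => ?_
    rw [← NNReal.coe_le_coe, coe_nnnorm, Real.norm_of_nonneg (deriv_smoothTransition_nonneg x)]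
    exact hM x
  refine LipschitzWith.of_dist_le_mul fun x y => ?_
  have hδ' : (0 : ℝ) < δ := hδ
  refine (h1.dist_le_mul _ _).trans ?_
  rw [Real.dist_eq, sub_sub_sub_cancel_right, ← sub_div, abs_div, abs_of_pos hδ']
  have h2 := (Metric.lipschitz_infDist_pt (s := Ωᶜ)).dist_le_mul x y
  rw [Real.dist_eq, NNReal.coe_one, one_mul] at h2
  push_cast
  rw [div_mul_eq_mul_div, mul_div_assoc]
  gcongr

lemma gradient_cutoff {Ω : Set (E d)} {δ : ℝ} {x : E d}
    (h : DifferentiableAt ℝ (fun y => Metric.infDist y Ωᶜ) x) :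
    DifferentiableAt ℝ (cutoff Ω δ) x ∧ gradient (cutoff Ω δ) x =
      (deriv Real.smoothTransition (Metric.infDist x Ωᶜ / δ - 1) / δ) •
        gradient (fun y => Metric.infDist y Ωᶜ) x := by
  have h1 : HasFDerivAt (fun y => Metric.infDist y Ωᶜ / δ - 1)
      (δ⁻¹ • fderiv ℝ (fun y => Metric.infDist y Ωᶜ) x) x := by
    simpa [div_eq_inv_mul] using (h.hasFDerivAt.const_mul δ⁻¹).sub_const 1
  have h2 := (differentiable_smoothTransition _).hasDerivAt.comp_hasFDerivAt x h1
  refine ⟨h2.differentiableAt, ?_⟩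
  have h3 : fderiv ℝ (cutoff Ω δ) x = _ := h2.fderiv
  refine ext_inner_right ℝ fun v => ?_
  rw [inner_gradient_eq, h3, real_inner_smul_left, inner_gradient_eq]
  simp
  ring

lemma exists_volume_biUnion_le {ι : Type*} (Q : Finset ι) (S : ι → ℝ → Set (E d)) (k : ℕ)
    (h : ∀ i ∈ Q, ∃ C t : ℝ, 0 ≤ C ∧ 0 < t ∧ ∀ s : ℝ, 0 ≤ s → s < t →
      volume (S i s) ≤ ENNReal.ofReal (C * s ^ k)) :
    ∃ C t : ℝ, 0 ≤ C ∧ 0 < t ∧ ∀ s : ℝ, 0 ≤ s → s < t →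
      volume (⋃ i ∈ Q, S i s) ≤ ENNReal.ofReal (C * s ^ k) := by
  classical
  induction Q using Finset.induction_on with
  | empty => exact ⟨0, 1, le_rfl, one_pos, fun s _ _ => by simp⟩
  | insert i Q hi ih =>
    obtain ⟨C, t, hC, ht, h1⟩ := ih fun j hj => h j (Finset.mem_insert_of_mem hj)
    obtain ⟨C', t', hC', ht', h2⟩ := h i (Finset.mem_insert_self i Q)
    refine ⟨C' + C, min t' t, by positivity, lt_min ht' ht, fun s hs hst => ?_⟩
    rw [Finset.set_biUnion_insert, add_mul, ENNReal.ofReal_add (by positivity) (by positivity)]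
    exact (measure_union_le _ _).trans (add_le_add (h2 s hs (hst.trans_le (min_le_left _ _)))
      (h1 s hs (hst.trans_le (min_le_right _ _))))

/-! ### Neighbourhoods of the facet hyperplanes. -/

namespace Triangulation

variable {Ω : Set (E d)} (𝒯 : Triangulation Ω)

/-- The points of the ball of radius `R` that are close to a facet hyperplane. -/
def layer (R s : ℝ) : Set (E d) := ⋃ a ∈ 𝒯.facets, {y | ‖y‖ ≤ R ∧ |a y| ≤ s}

open Classical in
/-- The points of the ball of radius `R` that are close to two distinct facet hyperplanes. -/
def ridge (R s : ℝ) : Set (E d) :=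
  ⋃ p ∈ (𝒯.facets ×ˢ 𝒯.facets).filter fun p => ¬ ∀ y, p.1 y = 0 ↔ p.2 y = 0,
    {y | ‖y‖ ≤ R ∧ |p.1 y| ≤ s ∧ |p.2 y| ≤ s}

lemma measurableSet_slab (a : E d →ᵃ[ℝ] ℝ) (s : ℝ) : MeasurableSet {y | |a y| ≤ s} :=
  (isClosed_le (contDiff_affine a (n := 0)).continuous.abs continuous_const).measurableSet

lemma measurableSet_layer (R s : ℝ) : MeasurableSet (𝒯.layer R s) :=
  Finset.measurableSet_biUnion _ fun a _ =>
    (isClosed_le continuous_norm continuous_const).measurableSet.inter (measurableSet_slab a s)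

lemma measurableSet_ridge (R s : ℝ) : MeasurableSet (𝒯.ridge R s) :=
  Finset.measurableSet_biUnion _ fun p _ =>
    (isClosed_le continuous_norm continuous_const).measurableSet.inter
      ((measurableSet_slab p.1 s).inter (measurableSet_slab p.2 s))

lemma exists_volume_layer_le (hd : 0 < d) {R : ℝ} (hR : 0 ≤ R) :
    ∃ C t : ℝ, 0 ≤ C ∧ 0 < t ∧ ∀ s : ℝ, 0 ≤ s → s < t →
      volume (𝒯.layer R s) ≤ ENNReal.ofReal (C * s ^ 1) := by
  refine exists_volume_biUnion_le 𝒯.facets (fun a s => {y | ‖y‖ ≤ R ∧ |a y| ≤ s}) 1 fun a ha => ?_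
  obtain ⟨C, hC, h⟩ := exists_volume_slab_le (𝒯.agrad_ne_zero_of_mem_facets hd ha) R hR
  exact ⟨C, 1, hC, one_pos, fun s hs _ => by simpa using h s hs⟩

/-- The quadratic rate is what beats the factor `1 / δ` from the cutoff gradient, so that no sign
information is needed near ridges. -/
lemma exists_volume_ridge_le (hd : 0 < d) {R : ℝ} (hR : 0 ≤ R) :
    ∃ C t : ℝ, 0 ≤ C ∧ 0 < t ∧ ∀ s : ℝ, 0 ≤ s → s < t →
      volume (𝒯.ridge R s) ≤ ENNReal.ofReal (C * s ^ 2) := by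
  classical
  refine exists_volume_biUnion_le _
    (fun (p : (E d →ᵃ[ℝ] ℝ) × (E d →ᵃ[ℝ] ℝ)) s => {y | ‖y‖ ≤ R ∧ |p.1 y| ≤ s ∧ |p.2 y| ≤ s}) 2 fun p hp => ?_
  obtain ⟨hp1, hp2⟩ := Finset.mem_filter.1 hp
  obtain ⟨ha, hb⟩ := Finset.mem_product.1 hp1
  exact exists_volume_double_slab_le (𝒯.agrad_ne_zero_of_mem_facets hd ha)
    (𝒯.agrad_ne_zero_of_mem_facets hd hb) hp2 R hR

end Triangulation

/-! ### Boundary flux and coercivity of convection and reaction. -/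

/-- The inflow through the boundary layer at a point, for a field with oscillation `κ` at
distances up to `2δ`. -/
lemma inner_gradient_cutoff_le (hd : 0 < d) {Ω : Set (E d)} (hΩ : IsLipschitzDomain Ω)
    (𝒯 : Triangulation Ω) (hne : Ωᶜ.Nonempty) {b : E d → E d}
    (hflux : ∀ x ∈ frontier Ω, ∀ (n : E d) (r : ℝ), ‖n‖ = 1 → 0 < r →
      (∀ y, ‖y - x‖ < r → (y ∈ Ω ↔ ⟪n, y - x⟫_ℝ < 0)) → 0 ≤ ⟪b x, n⟫_ℝ)
    {M : ℝ≥0} (hM : ∀ x, deriv Real.smoothTransition x ≤ M)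
    {R W G κ s δ : ℝ} (hR : ∀ x ∈ closure Ω, ‖x‖ ≤ R) (hW0 : 0 ≤ W)
    (hW : ∀ x ∈ closure Ω, ‖b x‖ ≤ W) (hG0 : 0 ≤ G) (hG : ∀ a ∈ 𝒯.facets, ‖agrad a‖ ≤ G)
    (hκ0 : 0 < κ) (hδ' : 0 < δ) (hs : s = 2 * δ * G)
    (huc : ∀ x ∈ closure Ω, ∀ y ∈ closure Ω, dist x y ≤ 2 * δ → dist (b x) (b y) ≤ κ)
    {x : E d} (hx : x ∈ Ω) (hdiff : DifferentiableAt ℝ (fun y => Metric.infDist y Ωᶜ) x) :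
    ⟪b x, gradient (cutoff Ω δ) x⟫_ℝ ≤
      M / δ * ((𝒯.layer R s).indicator (fun _ => κ) x +
        (𝒯.ridge R s).indicator (fun _ => W) x) := by
  have hI1 : 0 ≤ (𝒯.layer R s).indicator (fun _ => κ) x := indicator_nonneg (fun _ _ => hκ0.le) _
  have hI2 : 0 ≤ (𝒯.ridge R s).indicator (fun _ => W) x := indicator_nonneg (fun _ _ => hW0) _
  rw [(gradient_cutoff hdiff).2, real_inner_smul_right]
  obtain ⟨y, hy, hDpos, hyx, hgrad⟩ := exists_gradient_infDist_eq hΩ.isOpen hne hx hdiff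
  set D := Metric.infDist x Ωᶜ with hD
  set σ' := deriv Real.smoothTransition (D / δ - 1) with hσ'
  by_cases hσ0 : σ' = 0
  · rw [hσ0, zero_div, zero_mul]
    positivity
  have hD2 : D ≤ 2 * δ := by
    by_contra! h
    refine hσ0 (deriv_smoothTransition_eq_zero fun h' => ?_)
    have := h'.2
    rw [sub_le_iff_le_add, div_le_iff₀ hδ'] at this
    linarith
  -- A facet function vanishing at the nearest boundary point `y` is small at `x`, because `x` is
  -- within `2δ` of `y` and its slope is at most `G`.
  have hfac : ∀ a ∈ 𝒯.facets, a y = 0 → |a x| ≤ s := by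
    intro a ha hay
    have h1 := affine_sub_eq a y x
    rw [hay, sub_zero] at h1
    rw [h1]
    calc |⟪agrad a, x - y⟫_ℝ| ≤ ‖agrad a‖ * ‖x - y‖ := abs_real_inner_le_norm _ _
      _ ≤ G * (2 * δ) := by
          rw [norm_sub_rev, hyx]
          gcongr
          exact hG a ha
      _ = s := by rw [hs]; ring
  have hxR : ‖x‖ ≤ R := hR x (subset_closure hx)
  set u := D⁻¹ • (y - x) with hu
  have hu1 : ‖u‖ = 1 := by
    rw [hu, norm_smul, hyx, norm_inv, Real.norm_of_nonneg hDpos.le, inv_mul_cancel₀ hDpos.ne']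
  have key : -⟪b x, u⟫_ℝ ≤ (𝒯.layer R s).indicator (fun _ => κ) x +
        (𝒯.ridge R s).indicator (fun _ => W) x := by
    -- The boundary is flat near `y`, and the ball around `x` touches it from inside, so `u` is the
    -- outward normal at `y`. The sign of the flux at `y` passes to `x` up to the oscillation `κ`.
    by_cases hg : 𝒯.IsGood y
    · obtain ⟨T, hT, hyT⟩ := 𝒯.exists_cell hy.1
      obtain ⟨i, hi⟩ := 𝒯.exists_facet_of_mem_frontier hΩ hy hT hyT
      have hmem : x ∈ 𝒯.layer R s :=
        mem_biUnion (𝒯.coord_mem_facets hT i) ⟨hxR, hfac _ (𝒯.coord_mem_facets hT i) hi⟩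
      obtain ⟨n, r, hn, hr, hball⟩ := 𝒯.exists_normal hd hΩ hy hg
      have hun : u = n := by
        have := normal_eq_of_touching hn hr hball (x := x) (by rw [hyx]; exact hDpos) ?_
        · rwa [hyx] at this
        · intro z hz
          by_contra hzΩ
          refine Metric.notMem_of_dist_lt_infDist (x := x) (s := Ωᶜ) ?_ hzΩ
          rw [dist_comm, dist_eq_norm]
          exact hz.trans_eq hyx
      have h1 := hflux y hy n r hn hr hball
      have h2 := huc x (subset_closure hx) y hy.1 (by
        rw [dist_comm, dist_eq_norm, hyx]
        exact hD2)
      rw [dist_eq_norm] at h2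
      have h3 : |⟪b x - b y, u⟫_ℝ| ≤ κ :=
        (abs_real_inner_le_norm _ _).trans (by rw [hu1, mul_one]; exact h2)
      rw [inner_sub_left, hun] at h3
      rw [indicator_of_mem hmem, hun]
      linarith [(abs_le.1 h3).1]
    -- At other points the normal is unknown; the crude bound `W` suffices on this small set.
    · have hmem : x ∈ 𝒯.ridge R s := by
        simp only [Triangulation.IsGood] at hg
        push Not at hg
        obtain ⟨a, ha, a', ha', h0, h0', h⟩ := hg
        refine mem_biUnion (x := (a, a')) ?_ ⟨hxR, hfac a ha h0, hfac a' ha' h0'⟩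
        simp only [Finset.mem_coe, Finset.mem_filter, Finset.mem_product]
        refine ⟨⟨ha, ha'⟩, fun hall => ?_⟩
        obtain ⟨z, hz⟩ := h
        have := hall z
        tauto
      rw [indicator_of_mem hmem]
      have h3 := abs_real_inner_le_norm (b x) u
      rw [hu1, mul_one] at h3
      linarith [(abs_le.1 (h3.trans (hW x (subset_closure hx)))).1]
  have h4 : 0 ≤ σ' := deriv_smoothTransition_nonneg _
  have h5 : σ' ≤ M := hM _
  rw [hgrad, inner_neg_right]
  calc σ' / δ * -⟪b x, u⟫_ℝ ≤ σ' / δ * ((𝒯.layer R s).indicator (fun _ => κ) x +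
        (𝒯.ridge R s).indicator (fun _ => W) x) := by gcongr
    _ ≤ _ := by gcongr

/-- If the field `b` has no inflow at the boundary points on only one facet hyperplane, then
its inflow through the boundary layer is asymptotically nonpositive. -/
lemma exists_flux_cutoff_le (hd : 0 < d) {Ω : Set (E d)} (hΩ : IsLipschitzDomain Ω)
    (𝒯 : Triangulation Ω) {b : E d → E d} (hb : ContinuousOn b (closure Ω))
    (hflux : ∀ x ∈ frontier Ω, ∀ (n : E d) (r : ℝ), ‖n‖ = 1 → 0 < r →
      (∀ y, ‖y - x‖ < r → (y ∈ Ω ↔ ⟪n, y - x⟫_ℝ < 0)) → 0 ≤ ⟪b x, n⟫_ℝ) {η : ℝ} (hη : 0 < η) :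
    ∃ δ₀ : ℝ, 0 < δ₀ ∧ ∀ δ : ℝ≥0, 0 < δ → (δ : ℝ) < δ₀ →
      ∫ x in Ω, ⟪b x, gradient (cutoff Ω δ) x⟫_ℝ ≤ η := by
  have := 𝒯.isFiniteMeasure_restrict
  have : Nontrivial (E d) := by
    have : Nonempty (Fin d) := ⟨⟨0, hd⟩⟩
    infer_instance
  have hne : Ωᶜ.Nonempty := by
    rw [nonempty_compl]
    rintro rfl
    exact NormedSpace.unbounded_univ ℝ (E d) hΩ.isBounded
  obtain ⟨M, hM⟩ := exists_deriv_smoothTransition_le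
  obtain ⟨R, hR0, hR⟩ : ∃ R : ℝ, 0 ≤ R ∧ ∀ x ∈ closure Ω, ‖x‖ ≤ R := by
    obtain ⟨R, hR⟩ := hΩ.isBounded.closure.exists_norm_le
    exact ⟨max R 0, le_max_right _ _, fun x hx => (hR x hx).trans (le_max_left _ _)⟩
  obtain ⟨W, hW0, hW⟩ : ∃ W : ℝ, 0 ≤ W ∧ ∀ x ∈ closure Ω, ‖b x‖ ≤ W := by
    obtain ⟨W, hW⟩ := 𝒯.isCompact_closure.exists_bound_of_continuousOn hb
    exact ⟨max W 0, le_max_right _ _, fun x hx => (hW x hx).trans (le_max_left _ _)⟩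
  set G := ∑ a ∈ 𝒯.facets, ‖agrad a‖ with hG
  have hG0 : 0 ≤ G := Finset.sum_nonneg fun _ _ => norm_nonneg _
  have hGa : ∀ a ∈ 𝒯.facets, ‖agrad a‖ ≤ G := fun a ha =>
    Finset.single_le_sum (f := fun a : E d →ᵃ[ℝ] ℝ => ‖agrad a‖) (fun _ _ => norm_nonneg _) ha
  obtain ⟨A, t, hA, ht, hAv⟩ := 𝒯.exists_volume_layer_le hd hR0
  obtain ⟨A', t', hA', ht', hAv'⟩ := 𝒯.exists_volume_ridge_le hd hR0
  -- The layer has volume at most `A · 2δG`, so it contributes `M · A · 2G · κ`, independently of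
  -- `δ`. This `κ` makes it at most `η / 2`, and the `+ 1` avoids a zero denominator.
  set κ := η / (2 * (M * (A * (2 * G)) + 1)) with hκ
  have hκ0 : 0 < κ := by positivity
  obtain ⟨τ, hτ, huc⟩ := Metric.uniformContinuousOn_iff_le.1
    (𝒯.isCompact_closure.uniformContinuousOn_of_continuous hb) κ hκ0
  set c := M * (W * (A' * (2 * G) ^ 2)) with hc
  have hc0 : 0 ≤ c := by positivity
  -- The three bounds on `δ` serve uniform continuity at distance `2δ`, the ridge contribution `c δ
  -- ≤ η / 2`, and the validity of both volume estimates at `s = 2δG`.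
  refine ⟨min (min (τ / 2) (η / (2 * (c + 1)))) (min t t' / (2 * (G + 1))), by positivity,
    fun δ hδ hδlt => ?_⟩
  have hδ' : (0 : ℝ) < δ := hδ
  have hδτ : 2 * (δ : ℝ) ≤ τ := by
    linarith [hδlt.trans_le ((min_le_left _ _).trans (min_le_left _ _))]
  have hδη : c * δ ≤ η / 2 := by
    have h1 := (hδlt.trans_le ((min_le_left _ _).trans (min_le_right _ _))).le
    rw [le_div_iff₀ (by positivity)] at h1
    nlinarith
  have hδt : 2 * δ * G < min t t' := by
    have h1 := hδlt.trans_le (min_le_right _ _)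
    rw [lt_div_iff₀ (by positivity)] at h1
    nlinarith
  set s : ℝ := 2 * δ * G with hs
  have hs0 : 0 ≤ s := by positivity
  have hpt : ∀ x ∈ Ω, DifferentiableAt ℝ (fun y => Metric.infDist y Ωᶜ) x →
      ⟪b x, gradient (cutoff Ω δ) x⟫_ℝ ≤
        M / δ * ((𝒯.layer R s).indicator (fun _ => κ) x +
          (𝒯.ridge R s).indicator (fun _ => W) x) := fun x hx hdiff =>
    inner_gradient_cutoff_le hd hΩ 𝒯 hne hflux hM hR hW0 hW hG0 hGa hκ0 hδ' hs
      (fun x hx y hy hxy => huc x hx y hy (hxy.trans hδτ)) hx hdiff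
  have hi1 : Integrable ((𝒯.layer R s).indicator fun _ => κ) (volume.restrict Ω) :=
    (integrable_const κ).indicator (𝒯.measurableSet_layer R s)
  have hi2 : Integrable ((𝒯.ridge R s).indicator fun _ => W) (volume.restrict Ω) :=
    (integrable_const W).indicator (𝒯.measurableSet_ridge R s)
  have hlip := lipschitzWith_cutoff hM Ω hδ
  have hint : Integrable (fun x => ⟪b x, gradient (cutoff Ω δ) x⟫_ℝ) (volume.restrict Ω) := by
    refine Integrable.of_bound (C := W * (M / δ)) (((hb.mono subset_closure).aestronglyMeasurable
      hΩ.isOpen.measurableSet).inner (measurable_gradient _).aestronglyMeasurable) ?_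
    filter_upwards [ae_restrict_mem hΩ.isOpen.measurableSet] with x hx
    refine (norm_inner_le_norm _ _).trans ?_
    rw [norm_gradient_eq]
    gcongr
    · exact hW x (subset_closure hx)
    · simpa using norm_fderiv_le_of_lipschitz ℝ hlip (x₀ := x)
  have hle : ∫ x in Ω, ⟪b x, gradient (cutoff Ω δ) x⟫_ℝ ≤
      ∫ x in Ω, M / δ * ((𝒯.layer R s).indicator (fun _ => κ) x +
          (𝒯.ridge R s).indicator (fun _ => W) x) := by
    refine integral_mono_ae hint ((hi1.add hi2).const_mul _) ?_
    filter_upwards [ae_restrict_mem hΩ.isOpen.measurableSet, ae_restrict_of_ae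
      (Metric.lipschitz_infDist_pt (s := Ωᶜ)).ae_differentiableAt] with x hx hdx
    exact hpt x hx hdx
  refine hle.trans ?_
  rw [integral_const_mul, integral_add hi1 hi2,
    integral_indicator_const _ (𝒯.measurableSet_layer R s),
    integral_indicator_const _ (𝒯.measurableSet_ridge R s), smul_eq_mul, smul_eq_mul]
  have hv1 : (volume.restrict Ω).real (𝒯.layer R s) ≤ A * s := by
    refine ENNReal.toReal_le_of_le_ofReal (by positivity) ((Measure.restrict_apply_le _ _).trans ?_)
    simpa using hAv s hs0 (hδt.trans_le (min_le_left _ _))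
  have hv2 : (volume.restrict Ω).real (𝒯.ridge R s) ≤ A' * s ^ 2 :=
    ENNReal.toReal_le_of_le_ofReal (by positivity) ((Measure.restrict_apply_le _ _).trans
      (hAv' s hs0 (hδt.trans_le (min_le_right _ _))))
  calc M / δ * ((volume.restrict Ω).real (𝒯.layer R s) * κ +
        (volume.restrict Ω).real (𝒯.ridge R s) * W)
      ≤ M / δ * ((A * s) * κ + (A' * s ^ 2) * W) := by gcongr
    _ = (M * (A * (2 * G))) * κ + c * δ := by
        rw [hs, hc]
        field_simp
    _ ≤ η / 2 + η / 2 := by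
        refine add_le_add ?_ hδη
        rw [hκ, mul_div_assoc', div_le_div_iff₀ (by positivity) (by positivity)]
        have : 0 ≤ M * (A * (2 * G)) := by positivity
        nlinarith
    _ = η := by ring

lemma inner_eq_sum_fderiv {F : E d → ℝ} (b x : E d) :
    ⟪b, gradient F x⟫_ℝ = ∑ i, b i * fderiv ℝ F x (EuclideanSpace.single i 1) := by
  rw [PiLp.inner_apply]
  refine Finset.sum_congr rfl fun i _ => ?_
  rw [← inner_gradient_eq, EuclideanSpace.inner_single_right]
  simp [mul_comm]

/-- Integration by parts against a field of class `W^{1,∞}`, for the product of a piecewise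
continuously differentiable function with a cutoff function. -/
lemma integral_cutoff_mul_flux {Ω : Set (E d)} (hΩ : IsLipschitzDomain Ω)
    (𝒯 : Triangulation Ω) {b : E d → E d} {Db : Fin d → E d → E d}
    (hb : ContinuousOn b (closure Ω)) (hDb : ∀ i, MemW1inf Ω (fun x => b x i) (Db i))
    {w : E d → ℝ} (hw : IsPw 𝒯 w) {δ : ℝ≥0} (hδ : 0 < δ) :
    ∫ x in Ω, cutoff Ω δ x * (⟪b x, gradient w x⟫_ℝ + (∑ i, Db i x i) * w x) =
      -∫ x in Ω, ⟪w x • b x, gradient (cutoff Ω δ) x⟫_ℝ := by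
  have := 𝒯.isFiniteMeasure_restrict
  obtain ⟨M, hM⟩ := exists_deriv_smoothTransition_le
  have hlip := lipschitzWith_cutoff hM Ω hδ
  obtain ⟨B, hB0, hB⟩ := hw.exists_bound
  obtain ⟨L, hL0, hL⟩ := hw.exists_ptLip hΩ.isOpen
  obtain ⟨W, hW⟩ := 𝒯.isCompact_closure.exists_bound_of_continuousOn hb
  have hδ' : (0 : ℝ) < δ := hδ
  have hms := hΩ.isOpen.measurableSet
  have hbm : AEStronglyMeasurable b (volume.restrict Ω) :=
    (hb.mono subset_closure).aestronglyMeasurable hms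
  set F : E d → ℝ := fun x => cutoff Ω δ x * w x with hF
  -- The cutoff vanishes near the complement of `Ω`, which makes the product globally Lipschitz and
  -- admissible as a test function for the weak gradients of the components of `b`.
  have hFlip : LipschitzWith (1 * L + B * (M / δ : ℝ≥0)).toNNReal F := by
    refine lipschitzWith_of_ptLip (by positivity) fun x => ?_
    by_cases hx : x ∈ Ω
    · exact (LipschitzWith.ptLip hlip x).mul (hL x hx)
        (Eventually.of_forall fun y => abs_cutoff_le Ω δ y) (hB x (subset_closure hx))
    · have h0 : ∀ᶠ y in 𝓝 x, Metric.infDist y Ωᶜ < δ := by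
        refine ((Metric.lipschitz_infDist_pt Ωᶜ).continuous.tendsto x).eventually_lt_const ?_
        rw [Metric.infDist_zero_of_mem (show x ∈ Ωᶜ from hx)]
        exact hδ'
      filter_upwards [h0] with y hy
      simp only [hF, cutoff_eq_zero hδ' hy.le, cutoff_eq_zero hδ' h0.self_of_nhds.le, zero_mul,
        sub_self, abs_zero]
      positivity
  set K := {x | (δ : ℝ) ≤ Metric.infDist x Ωᶜ} with hK
  have hKcl : IsClosed K :=
    isClosed_le continuous_const (Metric.lipschitz_infDist_pt Ωᶜ).continuous
  have hKΩ : K ⊆ Ω := by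
    intro x hx
    by_contra h
    have h1 : (δ : ℝ) ≤ Metric.infDist x Ωᶜ := hx
    rw [Metric.infDist_zero_of_mem (show x ∈ Ωᶜ from h)] at h1
    linarith
  have hFs : tsupport F ⊆ K := by
    refine closure_minimal (fun x hx => ?_) hKcl
    by_contra h
    refine hx ?_
    simp only [hF]
    rw [cutoff_eq_zero hδ' (not_le.1 h).le, zero_mul]
  have hFc : HasCompactSupport F :=
    𝒯.isCompact_closure.of_isClosed_subset (isClosed_tsupport _)
      ((hFs.trans hKΩ).trans subset_closure)
  have hFm : AEStronglyMeasurable F (volume.restrict Ω) := hFlip.continuous.aestronglyMeasurable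
  have hFb : ∀ x ∈ Ω, ‖F x‖ ≤ 1 * B := fun x hx => by
    rw [hF, norm_mul]
    exact mul_le_mul (abs_cutoff_le Ω δ x) (hB x (subset_closure hx)) (norm_nonneg _) zero_le_one
  have hDi : ∀ i, Integrable (fun x => Db i x i) (volume.restrict Ω) := fun i =>
    ((hDb i).2.1.integrable le_top).eval_piLp i
  have hI1 : ∀ i, Integrable
      (fun x => b x i * lineDeriv ℝ F x (EuclideanSpace.single i 1)) (volume.restrict Ω) := by
    intro i
    refine Integrable.of_bound (C := W * (((1 * L + B * (M / δ : ℝ≥0)).toNNReal : ℝ≥0) *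
      ‖(EuclideanSpace.single i 1 : E d)‖))
      ((EuclideanSpace.proj (𝕜 := ℝ) i).continuous.comp_aestronglyMeasurable hbm |>.mul
        (aestronglyMeasurable_lineDeriv hFlip.continuous _)) ?_
    filter_upwards [ae_restrict_mem hms] with x hx
    rw [norm_mul]
    exact mul_le_mul ((PiLp.norm_apply_le (b x) i).trans (hW x (subset_closure hx)))
      (norm_lineDeriv_le_of_lipschitz ℝ hFlip) (norm_nonneg _)
      ((norm_nonneg _).trans (hW x (subset_closure hx)))
  have hI2 : ∀ i, Integrable (fun x => F x * Db i x i) (volume.restrict Ω) := by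
    intro i
    refine (hDi i).bdd_mul hFm (c := 1 * B) ?_
    filter_upwards [ae_restrict_mem hms] with x hx using hFb x hx
  have hsum : ∫ x in Ω, ∑ i, b x i * lineDeriv ℝ F x (EuclideanSpace.single i 1) =
      -∫ x in Ω, ∑ i, F x * Db i x i := by
    rw [integral_finsetSum _ fun i _ => hI1 i, integral_finsetSum _ fun i _ => hI2 i,
      ← Finset.sum_neg_distrib]
    refine Finset.sum_congr rfl fun i _ => ?_
    rw [(hDb i).2.2.integral_mul_lineDeriv hΩ.isOpen hFlip hFc (hFs.trans hKΩ)]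
    congr 2
    ext x
    rw [EuclideanSpace.inner_single_right]
    simp
  have hdiff : ∀ᵐ x ∂(volume.restrict Ω), DifferentiableAt ℝ (cutoff Ω δ) x :=
    ae_restrict_of_ae hlip.ae_differentiableAt
  have hJ1 : Integrable (fun x => ∑ i, b x i * lineDeriv ℝ F x (EuclideanSpace.single i 1))
      (volume.restrict Ω) := integrable_finsetSum _ fun i _ => hI1 i
  have hJ2 : Integrable (fun x => ∑ i, F x * Db i x i) (volume.restrict Ω) :=
    integrable_finsetSum _ fun i _ => hI2 i
  have hJ3 : Integrable (fun x => ⟪w x • b x, gradient (cutoff Ω δ) x⟫_ℝ)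
      (volume.restrict Ω) := by
    refine Integrable.of_bound (C := B * W * (M / δ : ℝ≥0))
      (((hw.aestronglyMeasurable hΩ).fun_smul hbm).inner
        (measurable_gradient _).aestronglyMeasurable) ?_
    filter_upwards [ae_restrict_mem hms] with x hx
    refine (norm_inner_le_norm _ _).trans ?_
    rw [norm_gradient_eq, norm_smul]
    have hx' := subset_closure (s := Ω) hx
    have hW0 : 0 ≤ W := (norm_nonneg _).trans (hW x hx')
    gcongr
    · exact hB x hx'
    · exact hW x hx'
    · exact norm_fderiv_le_of_lipschitz ℝ hlip
  rw [eq_neg_iff_add_eq_zero] at hsum ⊢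
  rw [← hsum, ← integral_add hJ1 hJ2]
  have hpt : ∀ᵐ x ∂(volume.restrict Ω),
      (∑ i, b x i * lineDeriv ℝ F x (EuclideanSpace.single i 1)) + (∑ i, F x * Db i x i) -
        ⟪w x • b x, gradient (cutoff Ω δ) x⟫_ℝ =
      cutoff Ω δ x * (⟪b x, gradient w x⟫_ℝ + (∑ i, Db i x i) * w x) := by
    filter_upwards [hdiff, hw.ae_differentiableAt hΩ] with x h1 h2
    have h3 : ∀ v, lineDeriv ℝ F x v = cutoff Ω δ x * fderiv ℝ w x v +
        w x * fderiv ℝ (cutoff Ω δ) x v := fun v => by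
      rw [hF, (h1.fun_mul h2).lineDeriv_eq_fderiv, fderiv_fun_mul h1 h2]
      simp
    simp only [h3, mul_add, Finset.sum_add_distrib]
    rw [real_inner_smul_left, inner_eq_sum_fderiv, inner_eq_sum_fderiv, Finset.mul_sum,
      Finset.mul_sum, Finset.sum_mul, Finset.mul_sum]
    have e1 : ∀ i, b x i * (cutoff Ω δ x * fderiv ℝ w x (EuclideanSpace.single i 1)) =
      cutoff Ω δ x * (b x i * fderiv ℝ w x (EuclideanSpace.single i 1)) := fun i => by ring
    have e2 : ∀ i, b x i * (w x * fderiv ℝ (cutoff Ω δ) x (EuclideanSpace.single i 1)) =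
      w x * (b x i * fderiv ℝ (cutoff Ω δ) x (EuclideanSpace.single i 1)) := fun i => by ring
    have e3 : ∀ i, F x * Db i x i = cutoff Ω δ x * (Db i x i * w x) := fun i => by
      simp only [hF]; ring
    simp only [e1, e2, e3]
    ring
  have hJ : Integrable (fun x => (∑ i, b x i * lineDeriv ℝ F x (EuclideanSpace.single i 1)) +
      ∑ i, F x * Db i x i) (volume.restrict Ω) := hJ1.add hJ2
  rw [← integral_congr_ae hpt, integral_sub hJ hJ3, sub_add_cancel]

/-- The total flux of `w b` through the boundary is nonnegative if `w b` has no inflow. -/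
lemma integral_flux_nonneg (hd : 0 < d) {Ω : Set (E d)} (hΩ : IsLipschitzDomain Ω)
    (𝒯 : Triangulation Ω) {b : E d → E d} {Db : Fin d → E d → E d}
    (hb : ContinuousOn b (closure Ω)) (hDb : ∀ i, MemW1inf Ω (fun x => b x i) (Db i))
    {w : E d → ℝ} (hw : IsPw 𝒯 w)
    (hflux : ∀ x ∈ frontier Ω, ∀ (n : E d) (r : ℝ), ‖n‖ = 1 → 0 < r →
      (∀ y, ‖y - x‖ < r → (y ∈ Ω ↔ ⟪n, y - x⟫_ℝ < 0)) → 0 ≤ ⟪w x • b x, n⟫_ℝ) :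
    Integrable (fun x => ⟪b x, gradient w x⟫_ℝ + (∑ i, Db i x i) * w x) (volume.restrict Ω) ∧
    0 ≤ ∫ x in Ω, (⟪b x, gradient w x⟫_ℝ + (∑ i, Db i x i) * w x) := by
  have := 𝒯.isFiniteMeasure_restrict
  have : Nontrivial (E d) := by
    have : Nonempty (Fin d) := ⟨⟨0, hd⟩⟩
    infer_instance
  have hne : Ωᶜ.Nonempty := by
    rw [nonempty_compl]
    rintro rfl
    exact NormedSpace.unbounded_univ ℝ (E d) hΩ.isBounded
  have hms := hΩ.isOpen.measurableSet
  have hbm : AEStronglyMeasurable b (volume.restrict Ω) :=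
    (hb.mono subset_closure).aestronglyMeasurable hms
  obtain ⟨B, hB0, hB⟩ := hw.exists_bound
  obtain ⟨L, hL0, hL⟩ := hw.exists_gradient_bound hΩ.isOpen
  obtain ⟨W, hW⟩ := 𝒯.isCompact_closure.exists_bound_of_continuousOn hb
  have hi1 : Integrable (fun x => ⟪b x, gradient w x⟫_ℝ) (volume.restrict Ω) := by
    refine Integrable.of_bound (C := W * L) (hbm.inner
      (measurable_gradient _).aestronglyMeasurable) ?_
    filter_upwards [ae_restrict_mem hms] with x hx
    have hx' := subset_closure (s := Ω) hx
    refine (norm_inner_le_norm _ _).trans ?_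
    exact mul_le_mul (hW x hx') (hL x hx) (norm_nonneg _) ((norm_nonneg _).trans (hW x hx'))
  have hi2 : Integrable (fun x => (∑ i, Db i x i) * w x) (volume.restrict Ω) := by
    refine Integrable.mul_bdd (c := B) (integrable_finsetSum _ fun i _ =>
      ((hDb i).2.1.integrable le_top).eval_piLp i) (hw.aestronglyMeasurable hΩ) ?_
    filter_upwards [ae_restrict_mem hms] with x hx using hB x (subset_closure hx)
  have hi := hi1.add hi2
  refine ⟨hi, ?_⟩
  set h := fun x => ⟪b x, gradient w x⟫_ℝ + (∑ i, Db i x i) * w x with hh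
  let δ : ℕ → ℝ≥0 := fun n => 1 / (n + 1)
  have hδpos : ∀ n, 0 < δ n := fun n => by positivity
  have hδ0 : Tendsto (fun n => (δ n : ℝ)) atTop (𝓝 0) := by
    simpa [δ] using tendsto_one_div_add_atTop_nhds_zero_nat (𝕜 := ℝ)
  have hlim : Tendsto (fun n => ∫ x in Ω, cutoff Ω (δ n) x * h x) atTop (𝓝 (∫ x in Ω, h x)) := by
    obtain ⟨M, hM⟩ := exists_deriv_smoothTransition_le
    refine tendsto_integral_of_dominated_convergence (fun x => ‖h x‖)
      (fun n => ((lipschitzWith_cutoff hM Ω (hδpos n)).continuous.aestronglyMeasurable).mul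
        hi.aestronglyMeasurable) hi.norm (fun n => Eventually.of_forall fun x => ?_) ?_
    · rw [norm_mul]
      exact mul_le_of_le_one_left (norm_nonneg _) (abs_cutoff_le Ω _ x)
    · filter_upwards [ae_restrict_mem hms] with x hx
      have hD : 0 < Metric.infDist x Ωᶜ :=
        (hΩ.isOpen.isClosed_compl.notMem_iff_infDist_pos hne).1 (fun h => h hx)
      have hev : ∀ᶠ n in atTop, cutoff Ω (δ n) x * h x = h x := by
        filter_upwards [hδ0.eventually_lt_const (half_pos hD)] with n hn
        rw [cutoff_eq_one (δ := δ n) (NNReal.coe_pos.2 (hδpos n)) (by linarith), one_mul]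
      exact tendsto_const_nhds.congr' (hev.mono fun n hn => hn.symm)
  refine le_of_forall_pos_lt_add fun η hη => ?_
  -- For small `δ` the truncated integral is minus a boundary layer flux of `w • b`, hence at least
  -- `-(η / 2)`; letting `δ → 0` keeps this bound.
  obtain ⟨δ₀, hδ₀, hle⟩ := exists_flux_cutoff_le hd hΩ 𝒯 (hw.cont.smul hb) hflux (half_pos hη)
  have hge : -(η / 2) ≤ ∫ x in Ω, h x := by
    refine ge_of_tendsto hlim ?_
    filter_upwards [hδ0.eventually_lt_const hδ₀] with n hn
    rw [integral_cutoff_mul_flux hΩ 𝒯 hb hDb hw (hδpos n)]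
    exact neg_le_neg (hle (δ n) (hδpos n) hn)
  linarith

/-- Coercivity of the convection-reaction part. -/
lemma Problem.Admissible.convection_reaction_ge {P : Problem d} (hd : 0 < d) (hP : P.Admissible)
    (𝒯 : Triangulation P.Ω) {v : E d → ℝ} (hv : IsPw 𝒯 v)
    (hv0 : v =ᵐ[(surf d).restrict P.ΓD] 0) :
    P.γ * ∫ x in P.Ω, v x * v x ≤
      (∫ x in P.Ω, ⟪P.β x, gradient v x⟫_ℝ * v x) + ∫ x in P.Ω, P.σ x * v x * v x := by
  have := 𝒯.isFiniteMeasure_restrict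
  have hΩ := hP.domain
  have hms := hΩ.isOpen.measurableSet
  obtain ⟨Dβ, hDβ, hγ⟩ := hP.β_mem
  have hw := hv.mul hv
  obtain ⟨hint, hflux⟩ := integral_flux_nonneg hd hΩ 𝒯 hP.β_cont hDβ hw (by
    intro x hx n r hn hr hball
    have := hP.sq_mul_flux_nonneg hd hv.cont hv0 hx hn hr hball
    rwa [real_inner_smul_left, ← sq])
  obtain ⟨B, hB0, hB⟩ := hv.exists_bound
  obtain ⟨L, hL0, hL⟩ := hv.exists_gradient_bound hΩ.isOpen
  obtain ⟨W, hW⟩ := 𝒯.isCompact_closure.exists_bound_of_continuousOn hP.β_cont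
  have hbm : AEStronglyMeasurable P.β (volume.restrict P.Ω) :=
    (hP.β_cont.mono subset_closure).aestronglyMeasurable hms
  have hvm := hv.aestronglyMeasurable hΩ
  have hbd : ∀ᵐ x ∂(volume.restrict P.Ω), ‖v x‖ ≤ B := by
    filter_upwards [ae_restrict_mem hms] with x hx using hB x (subset_closure hx)
  have i1 : Integrable (fun x => ⟪P.β x, gradient v x⟫_ℝ) (volume.restrict P.Ω) := by
    refine Integrable.of_bound (C := W * L) (hbm.inner
      (measurable_gradient _).aestronglyMeasurable) ?_
    filter_upwards [ae_restrict_mem hms] with x hx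
    have hx' := subset_closure (s := P.Ω) hx
    refine (norm_inner_le_norm _ _).trans ?_
    exact mul_le_mul (hW x hx') (hL x hx) (norm_nonneg _) ((norm_nonneg _).trans (hW x hx'))
  have i2 : Integrable (fun x => ⟪P.β x, gradient v x⟫_ℝ * v x) (volume.restrict P.Ω) :=
    i1.mul_bdd hvm hbd
  have i3 : Integrable (fun x => P.σ x * v x * v x) (volume.restrict P.Ω) :=
    (((hP.σ_mem.integrable le_top).mul_bdd hvm hbd).mul_bdd hvm hbd)
  have i4 : Integrable (fun x => v x * v x) (volume.restrict P.Ω) :=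
    ((hw.memLp hΩ 1).integrable le_rfl)
  rw [← integral_add i2 i3, ← integral_const_mul]
  -- Since `∇(v²) = 2v∇v`, subtracting half the divergence of `v²β` turns the integrand into `(σ - ½
  -- div β) v² ≥ γ v²`. The subtracted integral is nonnegative by the flux estimate.
  have hle : ∫ x in P.Ω, P.γ * (v x * v x) ≤ ∫ x in P.Ω,
      ((⟪P.β x, gradient v x⟫_ℝ * v x + P.σ x * v x * v x) -
        1 / 2 * (⟪P.β x, gradient (fun y => v y * v y) x⟫_ℝ + (∑ i, Dβ i x i) * (v x * v x))) := by
    refine integral_mono_ae (i4.const_mul _) ((i2.add i3).sub (hint.const_mul _)) ?_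
    filter_upwards [hγ, hv.ae_differentiableAt hΩ] with x hx hd
    have hg : ⟪P.β x, gradient (fun y => v y * v y) x⟫_ℝ = 2 * (⟪P.β x, gradient v x⟫_ℝ * v x) := by
      rw [real_inner_comm, inner_gradient_eq, fderiv_fun_mul hd hd, real_inner_comm,
        inner_gradient_eq]
      simp
      ring
    simp only [hg]
    nlinarith [mul_le_mul_of_nonneg_right hx (mul_self_nonneg (v x))]
  have i23 : Integrable (fun x => ⟪P.β x, gradient v x⟫_ℝ * v x + P.σ x * v x * v x)
      (volume.restrict P.Ω) := i2.add i3
  rw [integral_sub i23 (hint.const_mul _), integral_const_mul (1 / 2 : ℝ)] at hle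
  have : (0 : ℝ) ≤ 1 / 2 * ∫ x in P.Ω, (⟪P.β x, gradient (fun y => v y * v y) x⟫_ℝ +
    (∑ i, Dβ i x i) * (v x * v x)) := by positivity
  exact hle.trans (sub_le_self _ this)

/-! ### Norms and inner products in `L²` -/

section L2

variable {X : Type*} [MeasurableSpace X] {μ : Measure X} {F : Type*} [NormedAddCommGroup F]

lemma MemLp.toReal_eLpNorm_eq {f : X → F} (hf : MemLp f 2 μ) :
    (eLpNorm f 2 μ).toReal = ‖hf.toLp f‖ := by
  rw [Lp.norm_toLp]

lemma abs_toReal_eLpNorm_sub_le {f g : X → F} (hf : MemLp f 2 μ) (hg : MemLp g 2 μ) :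
    |(eLpNorm f 2 μ).toReal - (eLpNorm g 2 μ).toReal| ≤ (eLpNorm (f - g) 2 μ).toReal := by
  rw [MemLp.toReal_eLpNorm_eq hf, MemLp.toReal_eLpNorm_eq hg,
    MemLp.toReal_eLpNorm_eq (hf.sub hg), MemLp.toLp_sub]
  exact abs_norm_sub_norm_le _ _

variable [InnerProductSpace ℝ F]

lemma inner_toLp {f g : X → F} (hf : MemLp f 2 μ) (hg : MemLp g 2 μ) :
    ⟪hf.toLp f, hg.toLp g⟫_ℝ = ∫ x, ⟪f x, g x⟫_ℝ ∂μ := by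
  rw [MeasureTheory.L2.inner_def]
  refine integral_congr_ae ?_
  filter_upwards [hf.coeFn_toLp, hg.coeFn_toLp] with x h1 h2
  rw [h1, h2]

lemma integrable_inner_of_memLp {f g : X → F} (hf : MemLp f 2 μ) (hg : MemLp g 2 μ) :
    Integrable (fun x => ⟪f x, g x⟫_ℝ) μ := by
  refine (MeasureTheory.L2.integrable_inner (𝕜 := ℝ) (hf.toLp f) (hg.toLp g)).congr ?_
  filter_upwards [hf.coeFn_toLp, hg.coeFn_toLp] with x h1 h2
  rw [h1, h2]

lemma abs_integral_inner_le {f g : X → F} (hf : MemLp f 2 μ) (hg : MemLp g 2 μ) :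
    |∫ x, ⟪f x, g x⟫_ℝ ∂μ| ≤ (eLpNorm f 2 μ).toReal * (eLpNorm g 2 μ).toReal := by
  rw [← inner_toLp hf hg, MemLp.toReal_eLpNorm_eq hf, MemLp.toReal_eLpNorm_eq hg]
  exact abs_real_inner_le_norm _ _

lemma sq_toReal_eLpNorm {f : X → F} (hf : MemLp f 2 μ) :
    (eLpNorm f 2 μ).toReal ^ 2 = ∫ x, ⟪f x, f x⟫_ℝ ∂μ := by
  rw [← inner_toLp hf hf, MemLp.toReal_eLpNorm_eq hf, real_inner_self_eq_norm_sq]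

end L2

/-! ### Bilinear forms on piecewise continuously differentiable functions -/

namespace IsPw

variable {Ω : Set (E d)} {𝒯 : Triangulation Ω} {u v : E d → ℝ}

lemma add (hu : IsPw 𝒯 u) (hv : IsPw 𝒯 v) : IsPw 𝒯 (u + v) := by
  refine ⟨hu.cont.add hv.cont, fun T hT => ?_⟩
  obtain ⟨p, hp, hup⟩ := hu.poly T hT
  obtain ⟨q, hq, hvq⟩ := hv.poly T hT
  exact ⟨fun x => p x + q x, hp.add hq, fun x hx => by simp [hup hx, hvq hx]⟩

lemma smul (c : ℝ) (hv : IsPw 𝒯 v) : IsPw 𝒯 (c • v) := by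
  refine ⟨hv.cont.const_smul c, fun T hT => ?_⟩
  obtain ⟨q, hq, hvq⟩ := hv.poly T hT
  exact ⟨fun x => c * q x, contDiff_const.mul hq, fun x hx => by simp [hvq hx]⟩

/-- Linearity holds only almost everywhere, as `gradient` takes the default value `0` at points of
nondifferentiability. -/
lemma gradient_add (hΩ : IsLipschitzDomain Ω) (hu : IsPw 𝒯 u) (hv : IsPw 𝒯 v) :
    gradient (u + v) =ᵐ[volume.restrict Ω] gradient u + gradient v := by
  filter_upwards [hu.ae_differentiableAt hΩ, hv.ae_differentiableAt hΩ] with x h1 h2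
  refine ext_inner_right ℝ fun w => ?_
  simp only [Pi.add_apply, inner_add_left, inner_gradient_eq, fderiv_add h1 h2,
    add_apply]

lemma gradient_smul (hΩ : IsLipschitzDomain Ω) (c : ℝ) (hv : IsPw 𝒯 v) :
    gradient (c • v) =ᵐ[volume.restrict Ω] c • gradient v := by
  filter_upwards [hv.ae_differentiableAt hΩ] with x h2
  refine ext_inner_right ℝ fun w => ?_
  simp only [Pi.smul_apply, real_inner_smul_left, inner_gradient_eq, fderiv_const_smul h2,
    smul_apply, smul_eq_mul]

end IsPw

/-- The space of piecewise continuously differentiable functions. -/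
def pwSpace {Ω : Set (E d)} (𝒯 : Triangulation Ω) : Submodule ℝ (E d → ℝ) where
  carrier := {v | IsPw 𝒯 v}
  zero_mem' := ⟨continuousOn_const, fun _ _ => ⟨0, contDiff_const, fun _ _ => rfl⟩⟩
  add_mem' hu hv := hu.add hv
  smul_mem' c _ hv := hv.smul c

/-- The bilinear form given by integration of an integrand that is bilinear almost everywhere. -/
noncomputable def integralForm {X : Type*} [MeasurableSpace X] (μ : Measure X) {V : Type*}
    [AddCommGroup V] [Module ℝ V] (φ : V → V → X → ℝ) (hint : ∀ u v, Integrable (φ u v) μ)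
    (add_left : ∀ u u' v, φ (u + u') v =ᵐ[μ] φ u v + φ u' v)
    (smul_left : ∀ (c : ℝ) u v, φ (c • u) v =ᵐ[μ] c • φ u v)
    (add_right : ∀ u v v', φ u (v + v') =ᵐ[μ] φ u v + φ u v')
    (smul_right : ∀ (c : ℝ) u v, φ u (c • v) =ᵐ[μ] c • φ u v) : V →ₗ[ℝ] V →ₗ[ℝ] ℝ :=
  LinearMap.mk₂ ℝ (fun u v => ∫ x, φ u v x ∂μ)
    (fun u u' v => by
      rw [integral_congr_ae (add_left u u' v)]
      exact integral_add (hint _ _) (hint _ _))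
    (fun c u v => by
      rw [integral_congr_ae (smul_left c u v)]
      exact integral_smul c _)
    (fun u v v' => by
      rw [integral_congr_ae (add_right u v v')]
      exact integral_add (hint _ _) (hint _ _))
    (fun c u v => by
      rw [integral_congr_ae (smul_right c u v)]
      exact integral_smul c _)

section Forms

variable {Ω : Set (E d)} (𝒯 : Triangulation Ω) (hΩ : IsLipschitzDomain Ω)

/-- The form `(∇u, ∇v)_{0,S}`, for `μ` the Lebesgue measure on `S`. -/
noncomputable def gradForm (μ : Measure (E d)) (hμ : μ ≤ volume.restrict Ω) :
    pwSpace 𝒯 →ₗ[ℝ] pwSpace 𝒯 →ₗ[ℝ] ℝ :=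
  integralForm μ (fun u v x => ⟪gradient u.1 x, gradient v.1 x⟫_ℝ)
    (fun u v => (integrable_inner_of_memLp (IsPw.memLp_gradient hΩ u.2 2)
      (IsPw.memLp_gradient hΩ v.2 2)).mono_measure hμ)
    (fun u u' v => by
      filter_upwards [ae_mono hμ (IsPw.gradient_add hΩ u.2 u'.2)] with x hx
      simp [Submodule.coe_add, hx, inner_add_left])
    (fun c u v => by
      filter_upwards [ae_mono hμ (IsPw.gradient_smul hΩ c u.2)] with x hx
      simp only [Submodule.coe_smul, Pi.smul_apply, hx, real_inner_smul_left, smul_eq_mul])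
    (fun u v v' => by
      filter_upwards [ae_mono hμ (IsPw.gradient_add hΩ v.2 v'.2)] with x hx
      simp [Submodule.coe_add, hx, inner_add_right])
    (fun c u v => by
      filter_upwards [ae_mono hμ (IsPw.gradient_smul hΩ c v.2)] with x hx
      simp only [Submodule.coe_smul, Pi.smul_apply, hx, real_inner_smul_right, smul_eq_mul])

/-- The form `(ρ u, v)`. -/
noncomputable def massForm {ρ : E d → ℝ} (hρ : MemLp ρ ∞ (volume.restrict Ω)) :
    pwSpace 𝒯 →ₗ[ℝ] pwSpace 𝒯 →ₗ[ℝ] ℝ :=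
  integralForm (volume.restrict Ω) (fun u v x => ρ x * u.1 x * v.1 x)
    (fun u v => by
      have h1 : MemLp (fun x => ρ x * u.1 x) 2 (volume.restrict Ω) :=
        (IsPw.memLp hΩ u.2 2).mul hρ
      exact h1.integrable_mul (IsPw.memLp hΩ v.2 2))
    (fun u u' v => Eventually.of_forall fun x => by simp; ring)
    (fun c u v => Eventually.of_forall fun x => by simp; ring)
    (fun u v v' => Eventually.of_forall fun x => by simp; ring)
    (fun c u v => Eventually.of_forall fun x => by simp; ring)

/-- The form `(b·∇u, v)`. -/
noncomputable def convectionForm {b : E d → E d} (hb : MemLp b ∞ (volume.restrict Ω)) :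
    pwSpace 𝒯 →ₗ[ℝ] pwSpace 𝒯 →ₗ[ℝ] ℝ :=
  integralForm (volume.restrict Ω) (fun u v x => ⟪b x, gradient u.1 x⟫_ℝ * v.1 x)
    (fun u v => by
      have := 𝒯.isFiniteMeasure_restrict
      have h1 : Integrable (fun x => ⟪b x, gradient u.1 x⟫_ℝ) (volume.restrict Ω) :=
        integrable_inner_of_memLp (hb.mono_exponent le_top)
          (IsPw.memLp_gradient hΩ u.2 2)
      obtain ⟨B, -, hB⟩ := IsPw.exists_bound v.2
      refine h1.mul_bdd (c := B) (IsPw.aestronglyMeasurable hΩ v.2) ?_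
      filter_upwards [ae_restrict_mem hΩ.isOpen.measurableSet] with x hx
        using hB x (subset_closure hx))
    (fun u u' v => by
      filter_upwards [IsPw.gradient_add hΩ u.2 u'.2] with x hx
      simp [Submodule.coe_add, hx, inner_add_right, add_mul])
    (fun c u v => by
      filter_upwards [IsPw.gradient_smul hΩ c u.2] with x hx
      simp [Submodule.coe_smul, hx, real_inner_smul_right, mul_assoc])
    (fun u v v' => Eventually.of_forall fun x => by simp; ring)
    (fun c u v => Eventually.of_forall fun x => by simp; ring)

lemma gradForm_apply (μ : Measure (E d)) (hμ : μ ≤ volume.restrict Ω) (u v : pwSpace 𝒯) :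
    gradForm 𝒯 hΩ μ hμ u v = ∫ x, ⟪gradient u.1 x, gradient v.1 x⟫_ℝ ∂μ := rfl

lemma massForm_apply {ρ : E d → ℝ} (hρ : MemLp ρ ∞ (volume.restrict Ω)) (u v : pwSpace 𝒯) :
    massForm 𝒯 hΩ hρ u v = ∫ x in Ω, ρ x * u.1 x * v.1 x := rfl

lemma convectionForm_apply {b : E d → E d} (hb : MemLp b ∞ (volume.restrict Ω))
    (u v : pwSpace 𝒯) :
    convectionForm 𝒯 hΩ hb u v = ∫ x in Ω, ⟪b x, gradient u.1 x⟫_ℝ * v.1 x := rfl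

end Forms

/-! ### A nonlinear variational problem -/

/-- A variational problem whose coercive form depends on the solution in a Lipschitz way has
exactly one solution if the data are small. -/
theorem existsUnique_of_contraction {V : Type*} [AddCommGroup V] [Module ℝ V]
    [FiniteDimensional ℝ V] (s : V →ₗ[ℝ] V →ₗ[ℝ] ℝ) (hsymm : ∀ u v, s u v = s v u)
    (hpos : ∀ v, v ≠ 0 → 0 < s v v) (a : V → V →ₗ[ℝ] V →ₗ[ℝ] ℝ) (F : V →ₗ[ℝ] ℝ) {D κ : ℝ}
    (hD0 : 0 ≤ D) (hκ0 : 0 ≤ κ) (hco : ∀ w v, s v v ≤ a w v v)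
    (hF : ∀ v, F v ≤ D * √(s v v))
    (ha : ∀ w w' u v, |a w u v - a w' u v| ≤ κ * √(s (w - w') (w - w')) * √(s u u) * √(s v v))
    (hκ : κ * D < 1) : ∃! u, ∀ v, a u u v = F v := by
  have hnn : ∀ v, 0 ≤ s v v := fun v => by
    by_cases hv : v = 0
    · simp [hv]
    · exact (hpos v hv).le
  let core : InnerProductSpace.Core ℝ V :=
    { inner := fun u v => s u v
      conj_inner_symm := fun u v => by simpa using hsymm v u
      re_inner_nonneg := fun v => by simpa using hnn v
      add_left := fun u v w => by simp
      smul_left := fun u v r => by simp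
      definite := fun v hv => by
        by_contra h
        exact (hpos v h).ne' hv }
  letI : NormedAddCommGroup V := core.toNormedAddCommGroup
  letI : InnerProductSpace ℝ V := InnerProductSpace.ofCore core.toCore
  have : CompleteSpace V := FiniteDimensional.complete ℝ V
  have hnorm : ∀ v : V, ‖v‖ = √(s v v) := fun v => rfl
  have hsq : ∀ v : V, s v v = ‖v‖ ^ 2 := fun v => by rw [hnorm, Real.sq_sqrt (hnn v)]
  -- Coercivity gives injectivity, and in finite dimension injectivity gives solvability of the
  -- frozen problem.
  have hsurj : ∀ w, Function.Surjective (a w) := by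
    intro w
    refine (LinearMap.injective_iff_surjective_of_finrank_eq_finrank
      (Subspace.dual_finrank_eq (K := ℝ) (V := V)).symm).1 ?_
    rw [injective_iff_map_eq_zero]
    intro v hv
    by_contra h
    have h1 := hco w v
    rw [hv, LinearMap.zero_apply] at h1
    exact absurd h1 (not_le.2 (hpos v h))
  choose Φ hΦ using fun w => hsurj w F
  have hΦ' : ∀ w v, a w (Φ w) v = F v := fun w v => by rw [hΦ]
  -- Testing with `u` itself gives `‖u‖² ≤ F u ≤ D ‖u‖`.
  have hbound : ∀ w u, (∀ v, a w u v = F v) → ‖u‖ ≤ D := by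
    intro w u hu
    have h1 := (hco w u).trans_eq (hu u)
    have h2 := h1.trans (hF u)
    rw [← hnorm, hsq] at h2
    by_contra! h
    have : 0 < ‖u‖ := hD0.trans_lt h
    nlinarith
  have hcontr : ∀ w w' u u', (∀ v, a w u v = F v) → (∀ v, a w' u' v = F v) →
      ‖u - u'‖ ≤ κ * D * ‖w - w'‖ := by
    intro w w' u u' hu hu'
    -- The loads cancel: `a w (u - u') = F - a w u' = a w' u' - a w u'`. The difference of two
    -- frozen solutions is thus driven only by the change of the form on `u'`, which is bounded by
    -- `D`.
    have h1 : s (u - u') (u - u') ≤ a w' u' (u - u') - a w u' (u - u') := by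
      refine (hco w (u - u')).trans_eq ?_
      rw [map_sub (a w) u u', LinearMap.sub_apply, hu (u - u'), hu' (u - u')]
    have h2 := h1.trans ((le_abs_self _).trans (ha w' w u' (u - u')))
    rw [← hnorm, ← hnorm, ← hnorm, hsq, norm_sub_rev w' w] at h2
    have h3 := hbound w' u' hu'
    have h4 : κ * ‖w - w'‖ * ‖u'‖ * ‖u - u'‖ ≤ κ * ‖w - w'‖ * D * ‖u - u'‖ := by gcongr
    by_contra! h
    have h5 : 0 < ‖u - u'‖ := lt_of_le_of_lt (by positivity) h
    nlinarith
  have hκD : 0 ≤ κ * D := by positivity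
  have hC : ContractingWith ⟨κ * D, hκD⟩ Φ := by
    refine ⟨hκ, LipschitzWith.of_dist_le_mul fun w w' => ?_⟩
    rw [dist_eq_norm, dist_eq_norm]
    exact hcontr w w' _ _ (hΦ' w) (hΦ' w')
  have : Nonempty V := ⟨0⟩
  have hfix := hC.fixedPoint_isFixedPt
  set u := ContractingWith.fixedPoint Φ hC with hu
  refine ⟨u, fun v => ?_, fun u' hu' => ?_⟩
  · have h := hΦ' u v
    rwa [hfix.eq] at h
  -- Any solution is a frozen solution at itself, so the contraction estimate applies to it
  -- directly.
  · have h1 := hcontr u' u u' u hu' (fun v => by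
      have h := hΦ' u v
      rwa [hfix.eq] at h)
    rw [← sub_eq_zero, ← norm_eq_zero]
    nlinarith [norm_nonneg (u' - u)]

/-! ### The finite element spaces -/

lemma gradient_congr {u v : E d → ℝ} {S : Set (E d)} (h : EqOn u v S) {x : E d}
    (hx : x ∈ interior S) : gradient u x = gradient v x := by
  unfold gradient
  rw [(h.eventuallyEq_of_mem (mem_interior_iff_mem_nhds.1 hx)).fderiv_eq]

lemma Cell.bubble_vertex (hd : 0 < d) (T : Cell d) (i : Fin (d + 1)) : T.bubble (T i) = 0 := by
  have : Nontrivial (Fin (d + 1)) := Fin.nontrivial_iff_two_le.2 (by lia)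
  obtain ⟨j, hj⟩ := exists_ne i
  refine T.bubble_eq_zero_of_notMem_interior fun h => ?_
  have h1 := T.mem_interior.1 h j
  rw [T.coord_apply_ne hj] at h1
  exact lt_irrefl _ h1

lemma Cell.eqOn_zero_of_vertices {T : Cell d} {a : E d →ᵃ[ℝ] ℝ} (h : ∀ i, a (T i) = 0) :
    EqOn a 0 T.carrier := by
  have hc : Convex ℝ (a ⁻¹' {0}) := (convex_singleton (0 : ℝ)).affine_preimage a
  intro x hx
  have : T.carrier ⊆ a ⁻¹' {0} := convexHull_min (by rintro _ ⟨i, rfl⟩; exact h i) hc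
  exact this hx

section Spaces

variable {Ω : Set (E d)} {𝒯 : Triangulation Ω} {u v : E d → ℝ}

/-- On a cell the gradient of the smooth piece is continuous, so it vanishes on the whole cell. The
pieces are constant, the function is locally constant in `Ω` by continuity across cells, and `Ω` is
connected. -/
lemma IsPw.exists_eq_of_gradient_ae_eq_zero (hΩ : IsLipschitzDomain Ω) (hv : IsPw 𝒯 v)
    (h : gradient v =ᵐ[volume.restrict Ω] 0) : ∃ c, ∀ x ∈ closure Ω, v x = c := by
  have hT : ∀ T ∈ 𝒯.cells, ∀ x ∈ T.carrier, ∀ y ∈ T.carrier, |v y - v x| ≤ 0 * ‖y - x‖ := by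
    intro T hT x hx y hy
    obtain ⟨p, hp, hvp⟩ := hv.poly T hT
    have hcont : Continuous (fderiv ℝ p) := hp.continuous_fderiv (by simp)
    have h1 : fderiv ℝ p =ᵐ[volume.restrict (interior T.carrier)] 0 := by
      filter_upwards [ae_restrict_mem isOpen_interior.measurableSet,
        ae_restrict_of_ae_restrict_of_subset (𝒯.interior_subset hΩ hT) h] with z hz hz0
      rw [gradient_congr hvp hz] at hz0
      simpa [gradient] using hz0
    have h2 : EqOn (fderiv ℝ p) 0 (interior T.carrier) :=
      Measure.eqOn_open_of_ae_eq h1 isOpen_interior hcont.continuousOn continuousOn_const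
    have h3 : EqOn (fderiv ℝ p) 0 T.carrier := by
      have := h2.closure hcont continuous_const
      rwa [T.closure_interior] at this
    rw [hvp hx, hvp hy]
    exact T.convex.norm_image_sub_le_of_norm_fderiv_le
      (fun z _ => (hp.differentiable (by simp)) z) (fun z hz => by simp [h3 hz]) hx hy
  have hder : ∀ x ∈ Ω, HasFDerivAt v (0 : E d →L[ℝ] ℝ) x := by
    intro x hx
    refine (hasFDerivAt_const (v x) x).congr_of_eventuallyEq ?_
    filter_upwards [IsPw.ptLip_of_forall_cell hΩ.isOpen (L := fun _ => 0) (by simp) hT hx]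
      with y hy
    simpa [sub_eq_zero] using hy
  obtain ⟨x₀, hx₀⟩ := hΩ.isConnected.nonempty
  refine ⟨v x₀, fun x hx => ?_⟩
  have h4 : EqOn v (fun _ => v x₀) Ω := fun y hy =>
    hΩ.isOpen.is_const_of_fderiv_eq_zero hΩ.isConnected.isPreconnected
      (fun z hz => (hder z hz).differentiableAt.differentiableWithinAt)
      (fun z hz => (hder z hz).fderiv) hy hx₀
  exact h4.of_subset_closure hv.cont continuousOn_const subset_closure subset_rfl hx

lemma isPw_of_mem_Vh (hv : v ∈ Vh 𝒯) : IsPw 𝒯 v :=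
  ⟨hv.1, fun T hT => by
    obtain ⟨a, ha⟩ := hv.2.2 T hT
    exact ⟨a, contDiff_affine a, ha⟩⟩

lemma continuous_of_mem_Vb (hv : v ∈ Vb 𝒯) : Continuous v := by
  induction hv using Submodule.span_induction with
  | mem x h =>
    obtain ⟨T, -, rfl⟩ := h
    exact T.continuous_bubble
  | zero => exact continuous_const
  | add x y _ _ hx hy => exact hx.add hy
  | smul c x _ hx => exact hx.const_smul c

lemma eq_zero_of_mem_Vb (hΩ : IsLipschitzDomain Ω) (hv : v ∈ Vb 𝒯) {x : E d} (hx : x ∉ Ω) :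
    v x = 0 := by
  induction hv using Submodule.span_induction with
  | mem ψ h =>
    obtain ⟨T, hT, rfl⟩ := h
    exact T.bubble_eq_zero_of_notMem_interior fun h => hx (𝒯.interior_subset hΩ hT h)
  | zero => rfl
  | add y z _ _ hy hz => simp [hy, hz]
  | smul c y _ hy => simp [hy]

lemma exists_eqOn_of_mem_Vb (hv : v ∈ Vb 𝒯) {T : Cell d} (hT : T ∈ 𝒯.cells) :
    ∃ t : ℝ, EqOn v (fun x => t * T.bubble x) T.carrier := by
  induction hv using Submodule.span_induction with
  | mem ψ h =>
    obtain ⟨S, hS, rfl⟩ := h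
    by_cases hST : S = T
    · exact ⟨1, fun x _ => by simp [hST]⟩
    · refine ⟨0, fun x hx => ?_⟩
      simp only [zero_mul]
      exact S.bubble_eq_zero_of_notMem_interior
        fun h => 𝒯.notMem_of_mem_interior hS hT hST h hx
  | zero => exact ⟨0, fun x _ => by simp⟩
  | add y z _ _ hy hz =>
    obtain ⟨s, hs⟩ := hy
    obtain ⟨t, ht⟩ := hz
    exact ⟨s + t, fun x hx => by simp [hs hx, ht hx, add_mul]⟩
  | smul c y _ hy =>
    obtain ⟨s, hs⟩ := hy
    exact ⟨c * s, fun x hx => by simp [hs hx, mul_assoc]⟩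

lemma isPw_of_mem_Vb (hv : v ∈ Vb 𝒯) : IsPw 𝒯 v :=
  ⟨(continuous_of_mem_Vb hv).continuousOn, fun T hT => by
    obtain ⟨t, ht⟩ := exists_eqOn_of_mem_Vb hv hT
    exact ⟨fun x => t * T.poly x, contDiff_const.mul T.contDiff_poly,
      fun x hx => by simp only [ht hx, T.bubble_eqOn hx]⟩⟩

lemma Cell.differentiableAt_bubble {T : Cell d} {x : E d} (hx : x ∈ interior T.carrier) :
    DifferentiableAt ℝ T.bubble x :=
  (T.contDiff_poly.differentiable (n := 1) (by simp) x).congr_of_eventuallyEq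
    (T.bubble_eqOn.eventuallyEq_of_mem (mem_interior_iff_mem_nhds.1 hx))

/-- The restriction to a cell of a function in `V_h ⊕ V_b`. -/
lemma exists_eq_on_cell {uh ub : E d → ℝ} (hh : uh ∈ Vh 𝒯) (hb : ub ∈ Vb 𝒯) {T : Cell d}
    (hT : T ∈ 𝒯.cells) : ∃ (a : E d →ᵃ[ℝ] ℝ) (t : ℝ), EqOn uh a T.carrier ∧
      EqOn (uh + ub) (fun x => a x + t * T.bubble x) T.carrier ∧
      (∀ x ∈ interior T.carrier, gradient uh x = agrad a) ∧
      ∀ x ∈ interior T.carrier, gradient (uh + ub) x = agrad a + t • gradient T.bubble x := by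
  obtain ⟨a, ha⟩ := hh.2.2 T hT
  obtain ⟨t, ht⟩ := exists_eqOn_of_mem_Vb hb hT
  have h2 : EqOn (uh + ub) (fun x => a x + t * T.bubble x) T.carrier := fun x hx => by
    simp [ha hx, ht hx]
  refine ⟨a, t, ha, h2, fun x hx => ?_, fun x hx => ?_⟩
  · rw [gradient_congr ha hx, (hasGradientAt_affine a x).gradient]
  · rw [gradient_congr h2 hx]
    have h3 := (hasGradientAt_affine a x).hasFDerivAt
    have h4 := (Cell.differentiableAt_bubble hx).hasFDerivAt.const_mul t
    refine ext_inner_right ℝ fun w => ?_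
    rw [inner_gradient_eq, (h3.fun_add h4).fderiv, inner_add_left, real_inner_smul_left,
      inner_gradient_eq]
    simp

/-- A function of `V_h^D ⊕ V_b` with vanishing gradient vanishes, as do its two components. -/
lemma eq_zero_of_gradient_ae_eq_zero {ΓD : Set (E d)} (hd : 0 < d) (hΩ : IsLipschitzDomain Ω)
    (hΓ : ΓD ⊆ frontier Ω) (hΓm : MeasurableSet ΓD) (hpos : 0 < surf d ΓD)
    {uh ub : E d → ℝ} (hh : uh ∈ VhD 𝒯 ΓD) (hb : ub ∈ Vb 𝒯)
    (h : gradient (uh + ub) =ᵐ[volume.restrict Ω] 0) : uh = 0 ∧ ub = 0 := by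
  obtain ⟨c, hc⟩ :=
    ((isPw_of_mem_Vh hh.1).add (isPw_of_mem_Vb hb)).exists_eq_of_gradient_ae_eq_zero hΩ h
  have : NeZero ((surf d).restrict ΓD) := ⟨by
    rw [Ne, Measure.restrict_eq_zero]; exact hpos.ne'⟩
  -- Positive measure of `ΓD` provides an actual point where `uh` vanishes; bubbles vanish there
  -- too, which fixes the constant.
  obtain ⟨x, hx1, hx2⟩ := (hh.2.and (ae_restrict_mem hΓm)).exists
  have hxΩ : x ∉ Ω := by
    have := (hΓ hx2).2
    rwa [hΩ.isOpen.interior_eq] at this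
  have hc0 : c = 0 := by
    rw [← hc x (frontier_subset_closure (hΓ hx2)), Pi.add_apply, hx1, eq_zero_of_mem_Vb hΩ hb hxΩ]
    simp
  have hu : uh = 0 := by
    funext y
    by_cases hy : y ∈ closure Ω
    · obtain ⟨T, hT, hyT⟩ := 𝒯.exists_cell hy
      obtain ⟨a, t, ha, hat, -, -⟩ := exists_eq_on_cell hh.1 hb hT
      rw [ha hyT]
      -- Bubbles vanish at vertices, so the nodal values of `uh` are those of the sum, namely zero.
      refine Cell.eqOn_zero_of_vertices (fun i => ?_) hyT
      have h1 := hat (T.vertex_mem i)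
      rw [hc _ (𝒯.carrier_subset hT (T.vertex_mem i)), hc0] at h1
      simp only [T.bubble_vertex hd, mul_zero, add_zero] at h1
      exact h1.symm
    · exact hh.1.2.1 y hy
  refine ⟨hu, funext fun y => ?_⟩
  by_cases hy : y ∈ Ω
  · simpa [hu, hc0] using hc y (subset_closure hy)
  · exact eq_zero_of_mem_Vb hΩ hb hy

variable (𝒯)

instance finiteDimensional_Vb : FiniteDimensional ℝ (Vb 𝒯) := by
  refine FiniteDimensional.span_of_finite ℝ ?_
  refine (𝒯.cells.finite_toSet.image Cell.bubble).subset ?_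
  rintro ψ ⟨T, hT, rfl⟩
  exact ⟨T, hT, rfl⟩

/-- The values at the vertices of the cells determine a function of this space. -/
instance finiteDimensional_Vh : FiniteDimensional ℝ (Vh 𝒯) := by
  let ev : Vh 𝒯 →ₗ[ℝ] (𝒯.cells × Fin (d + 1) → ℝ) :=
    { toFun := fun v p => v.1 (p.1.1 p.2)
      map_add' := fun _ _ => rfl
      map_smul' := fun _ _ => rfl }
  refine FiniteDimensional.of_injective ev ?_
  rw [injective_iff_map_eq_zero]
  intro v hv
  ext y
  by_cases hy : y ∈ closure Ω
  · obtain ⟨T, hT, hyT⟩ := 𝒯.exists_cell hy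
    obtain ⟨a, ha⟩ := v.2.2.2 T hT
    rw [ha hyT]
    refine Cell.eqOn_zero_of_vertices (fun i => ?_) hyT
    rw [← ha (T.vertex_mem i)]
    exact congrFun hv (⟨T, hT⟩, i)
  · exact v.2.2.1 y hy

instance finiteDimensional_VhD (ΓD : Set (E d)) : FiniteDimensional ℝ (VhD 𝒯 ΓD) :=
  Submodule.finiteDimensional_of_le (S₂ := Vh 𝒯) fun _ hv => hv.1

end Spaces

/-! ### The best constants -/

/-- A finite infimum is itself an admissible constant. For `y = 0` this needs the set to be
nonempty, which finiteness guarantees since `sInf ∅ = ⊤`. -/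
lemma le_sInf_mul {S : Set ℝ≥0∞} {x y : ℝ≥0∞} (hS : sInf S ≠ ⊤) (hy : y ≠ ⊤)
    (h : ∀ c ∈ S, x ≤ c * y) : x ≤ sInf S * y := by
  by_cases hy0 : y = 0
  · obtain ⟨c, hc⟩ : S.Nonempty := by
      by_contra hne
      rw [not_nonempty_iff_eq_empty] at hne
      simp [hne] at hS
    simpa [hy0] using h c hc
  · rw [← ENNReal.div_le_iff hy0 hy]
    exact le_sInf fun c hc => (ENNReal.div_le_iff hy0 hy).2 (h c hc)

lemma esqrt_ne_top (x : ℝ) : esqrt x ≠ ⊤ := ENNReal.ofReal_ne_top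

lemma esqrt_ne_zero {x : ℝ} (hx : 0 < x) : esqrt x ≠ 0 := by
  rw [esqrt, Ne, ENNReal.ofReal_eq_zero, not_le]
  exact Real.sqrt_pos.2 hx

lemma toReal_esqrt (x : ℝ) : (esqrt x).toReal = √x := ENNReal.toReal_ofReal (Real.sqrt_nonneg x)

/-! ### The resolved part of a function on a cell -/

section Cells

variable {Ω : Set (E d)} {𝒯 : Triangulation Ω} {T : Cell d} {uh ub : E d → ℝ}

lemma IsPw.memLp_cell {v : E d → ℝ} (hΩ : IsLipschitzDomain Ω) (hv : IsPw 𝒯 v) (hT : T ∈ 𝒯.cells)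
    (p : ℝ≥0∞) : MemLp v p (volume.restrict T.carrier) :=
  (hv.memLp hΩ p).mono_measure (𝒯.restrict_le hΩ hT)

lemma IsPw.memLp_gradient_cell {v : E d → ℝ} (hΩ : IsLipschitzDomain Ω) (hv : IsPw 𝒯 v)
    (hT : T ∈ 𝒯.cells) (p : ℝ≥0∞) : MemLp (gradient v) p (volume.restrict T.carrier) :=
  (hv.memLp_gradient hΩ p).mono_measure (𝒯.restrict_le hΩ hT)

/-- The gradient of `uh` is constant on the cell and bubble gradients have mean zero, so it is
orthogonal to the gradient of `ub`; hence the constant `1`. -/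
lemma toReal_L2_gradient_le (hΩ : IsLipschitzDomain Ω) (hh : uh ∈ Vh 𝒯) (hb : ub ∈ Vb 𝒯)
    (hT : T ∈ 𝒯.cells) :
    (L2 T.carrier (gradient uh)).toReal ≤ (L2 T.carrier (gradient (uh + ub))).toReal := by
  obtain ⟨a, t, -, -, hga, hgu⟩ := exists_eq_on_cell hh hb hT
  have h1 := (isPw_of_mem_Vh hh).memLp_gradient_cell hΩ hT 2
  have h2 := ((isPw_of_mem_Vh hh).add (isPw_of_mem_Vb hb)).memLp_gradient_cell hΩ hT 2
  have hψ : T.bubble ∈ Vb 𝒯 := Submodule.subset_span ⟨T, hT, rfl⟩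
  have h3 := (isPw_of_mem_Vb hψ).memLp_gradient_cell hΩ hT 2
  have h4 : ∫ x in T.carrier, ⟪gradient uh x, gradient (uh + ub) x⟫_ℝ =
      ∫ x in T.carrier, ⟪gradient uh x, gradient uh x⟫_ℝ := by
    have h5 : ∫ x in T.carrier, ⟪gradient uh x, gradient (uh + ub) x⟫_ℝ =
        ∫ x in T.carrier, (⟪gradient uh x, gradient uh x⟫_ℝ
          + t * ⟪agrad a, gradient T.bubble x⟫_ℝ) := by
      refine integral_congr_ae ?_
      filter_upwards [T.ae_mem_interior] with x hx
      rw [hgu x hx, hga x hx, inner_add_right, real_inner_smul_right]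
    have h6 : Integrable (fun x => ⟪agrad a, gradient T.bubble x⟫_ℝ)
        (volume.restrict T.carrier) := by
      refine (integrable_inner_of_memLp h1 h3).congr ?_
      filter_upwards [T.ae_mem_interior] with x hx
      rw [hga x hx]
    rw [h5, integral_add (integrable_inner_of_memLp h1 h1) (h6.const_mul t), integral_const_mul,
      T.integral_inner_gradient_bubble, mul_zero, add_zero]
  have h5 := (le_abs_self _).trans (abs_integral_inner_le h1 h2)
  rw [h4, ← sq_toReal_eLpNorm h1] at h5
  change (eLpNorm _ _ _).toReal ≤ (eLpNorm _ _ _).toReal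
  set p := (eLpNorm (gradient uh) 2 (volume.restrict T.carrier)).toReal
  have hp : 0 ≤ p := ENNReal.toReal_nonneg
  rcases hp.eq_or_lt with h | h
  · rw [← h]; exact ENNReal.toReal_nonneg
  · nlinarith

lemma toReal_L2_le (hΩ : IsLipschitzDomain Ω) (hc : c1 d ≠ ⊤) (hh : uh ∈ Vh 𝒯) (hb : ub ∈ Vb 𝒯)
    (hT : T ∈ 𝒯.cells) :
    (L2 T.carrier uh).toReal ≤ (c1 d).toReal * (L2 T.carrier (uh + ub)).toReal := by
  have h2 := ((isPw_of_mem_Vh hh).add (isPw_of_mem_Vb hb)).memLp_cell hΩ hT 2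
  rw [← ENNReal.toReal_mul]
  refine ENNReal.toReal_mono (ENNReal.mul_ne_top hc h2.eLpNorm_ne_top) ?_
  refine le_sInf_mul hc h2.eLpNorm_ne_top fun c hc => ?_
  obtain ⟨a, t, ha, hat, -, -⟩ := exists_eq_on_cell hh hb hT
  have e1 : L2 T.carrier uh = L2 T.carrier (fun x => a x) :=
    eLpNorm_congr_ae (by
      filter_upwards [ae_restrict_mem T.measurableSet] with x hx using ha hx)
  have e2 : L2 T.carrier (uh + ub) = L2 T.carrier (fun x => a x + t * T.bubble x) :=
    eLpNorm_congr_ae (by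
      filter_upwards [ae_restrict_mem T.measurableSet] with x hx using hat hx)
  rw [e1, e2]
  exact hc T a t

end Cells

/-! ### The artificial diffusion -/

/-- Numerator and denominator each move by at most `δ`. The change of denominator is weighted by the
second quotient, which is at most `1`, so each change costs at most `δ / τ`. -/
lemma abs_div_sub_div_le {r₁ r₂ A₁ A₂ τ δ : ℝ} (hτ : 0 < τ) (h₁ : 0 ≤ A₁) (h₂ : 0 ≤ A₂)
    (hr₂ : 0 ≤ r₂) (hr : |r₁ - r₂| ≤ δ) (hA : |A₁ - A₂| ≤ δ) (hle : r₂ ≤ A₂ + τ) :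
    |r₁ / (A₁ + τ) - r₂ / (A₂ + τ)| ≤ 2 * δ / τ := by
  have hδ : 0 ≤ δ := (abs_nonneg _).trans hr
  have p₁ : 0 < A₁ + τ := by linarith
  have p₂ : 0 < A₂ + τ := by linarith
  have e : r₁ / (A₁ + τ) - r₂ / (A₂ + τ) =
      ((r₁ - r₂) - r₂ / (A₂ + τ) * (A₁ - A₂)) / (A₁ + τ) := by
    field_simp
    ring
  have hq0 : 0 ≤ r₂ / (A₂ + τ) := by positivity
  have hq : r₂ / (A₂ + τ) ≤ 1 := (div_le_one p₂).2 hle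
  rw [e, abs_div, abs_of_pos p₁]
  refine div_le_div₀ (by positivity) ?_ hτ (by linarith)
  calc |(r₁ - r₂) - r₂ / (A₂ + τ) * (A₁ - A₂)|
      ≤ |r₁ - r₂| + |r₂ / (A₂ + τ) * (A₁ - A₂)| := abs_sub _ _
    _ ≤ δ + 1 * δ := by
        rw [abs_mul, abs_of_nonneg hq0]
        gcongr
    _ = 2 * δ := by ring

namespace Problem

/-- The energy `ε |u|²_{1,S} + γ ‖u‖²_{0,S}`. -/
noncomputable def energy (P : Problem d) (S : Set (E d)) (u : E d → ℝ) : ℝ :=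
  P.ε * (L2 S (gradient u)).toReal ^ 2 + P.γ * (L2 S u).toReal ^ 2

namespace Admissible

variable {P : Problem d} {𝒯 : Triangulation P.Ω} {T : Cell d} {w w₁ w₂ : E d → ℝ}

lemma memLp_β (hP : P.Admissible) (𝒯 : Triangulation P.Ω) :
    MemLp P.β ⊤ (volume.restrict P.Ω) := by
  obtain ⟨B, hB⟩ := 𝒯.isCompact_closure.exists_bound_of_continuousOn hP.β_cont
  refine memLp_top_of_bound ((hP.β_cont.mono subset_closure).aestronglyMeasurable
    hP.domain.isOpen.measurableSet) B ?_
  filter_upwards [ae_restrict_mem hP.domain.isOpen.measurableSet] with x hx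
    using hB x (subset_closure hx)

lemma τ_ne_zero (P : Problem d) (hf : MemLp P.f 2 (volume.restrict T.carrier)) : P.τ T ≠ 0 := by
  unfold τ
  split_ifs with h
  · exact one_ne_zero
  · exact fun h0 => h ((eLpNorm_eq_zero_iff hf.1 two_ne_zero).1 h0)

lemma τ_ne_top (P : Problem d) (hf : MemLp P.f 2 (volume.restrict T.carrier)) : P.τ T ≠ ⊤ := by
  unfold τ
  split_ifs with h
  · exact ENNReal.one_ne_top
  · exact hf.eLpNorm_ne_top

lemma L2_f_le_τ (P : Problem d) (T : Cell d) : L2 T.carrier P.f ≤ P.τ T := by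
  unfold τ
  split_ifs with h
  · rw [L2, eLpNorm_congr_ae h]
    simp
  · exact le_rfl

lemma f_memLp_cell (hP : P.Admissible) (hT : T ∈ 𝒯.cells) :
    MemLp P.f 2 (volume.restrict T.carrier) :=
  hP.f_mem.mono_measure (𝒯.restrict_le hP.domain hT)

/-- The part of the residual that depends on `w`. -/
lemma memLp_residual (hP : P.Admissible) (hw : IsPw 𝒯 w) (hT : T ∈ 𝒯.cells) :
    MemLp (fun x => ⟪P.β x, gradient w x⟫_ℝ + P.σ x * w x) 2 (volume.restrict T.carrier) ∧
      (L2 T.carrier (fun x => ⟪P.β x, gradient w x⟫_ℝ + P.σ x * w x)).toReal ≤ P.A T w := by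
  have hle := 𝒯.restrict_le hP.domain hT
  have hβ := (hP.memLp_β 𝒯).mono_measure hle
  have hσ := hP.σ_mem.mono_measure hle
  have hw0 := hw.memLp_cell hP.domain hT 2
  have hw1 := hw.memLp_gradient_cell hP.domain hT 2
  have m1 : AEStronglyMeasurable (fun x => ⟪P.β x, gradient w x⟫_ℝ)
      (volume.restrict T.carrier) := hβ.1.inner hw1.1
  have m2 : AEStronglyMeasurable (fun x => P.σ x * w x) (volume.restrict T.carrier) :=
    hσ.1.mul hw0.1
  have b1 : L2 T.carrier (fun x => ⟪P.β x, gradient w x⟫_ℝ) ≤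
      Linf T.carrier P.β * L2 T.carrier (gradient w) := by
    have := eLpNorm_le_eLpNorm_top_mul_eLpNorm 2 P.β hw1.1 (fun a b => ⟪a, b⟫_ℝ) 1
      (Eventually.of_forall fun x => by rw [one_mul]; exact nnnorm_inner_le_nnnorm _ _)
    rwa [ENNReal.coe_one, one_mul] at this
  have b2 : L2 T.carrier (fun x => P.σ x * w x) ≤ Linf T.carrier P.σ * L2 T.carrier w := by
    have := eLpNorm_le_eLpNorm_top_mul_eLpNorm 2 P.σ hw0.1 (fun a b => a * b) 1
      (Eventually.of_forall fun x => by rw [one_mul, nnnorm_mul])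
    rwa [ENNReal.coe_one, one_mul] at this
  have f1 : Linf T.carrier P.β * L2 T.carrier (gradient w) ≠ ⊤ :=
    ENNReal.mul_ne_top hβ.eLpNorm_ne_top hw1.eLpNorm_ne_top
  have f2 : Linf T.carrier P.σ * L2 T.carrier w ≠ ⊤ :=
    ENNReal.mul_ne_top hσ.eLpNorm_ne_top hw0.eLpNorm_ne_top
  have b3 := (eLpNorm_add_le m1 m2 (p := 2) (by norm_num)).trans (add_le_add b1 b2)
  have f3 := ENNReal.add_ne_top.2 ⟨f1, f2⟩
  refine ⟨⟨m1.add m2, b3.trans_lt f3.lt_top⟩, ?_⟩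
  have := ENNReal.toReal_mono f3 b3
  rwa [ENNReal.toReal_add f1 f2, ENNReal.toReal_mul, ENNReal.toReal_mul] at this

lemma gradient_sub_ae (hP : P.Admissible) (h₁ : IsPw 𝒯 w₁) (h₂ : IsPw 𝒯 w₂)
    (hT : T ∈ 𝒯.cells) : gradient (w₁ - w₂) =ᵐ[volume.restrict T.carrier]
      gradient w₁ - gradient w₂ := by
  have hs : w₁ - w₂ = w₁ + (-1 : ℝ) • w₂ := by simp [sub_eq_add_neg]
  rw [hs]
  filter_upwards [ae_mono (𝒯.restrict_le hP.domain hT)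
    (h₁.gradient_add hP.domain (h₂.smul (-1))),
    ae_mono (𝒯.restrict_le hP.domain hT) (h₂.gradient_smul hP.domain (-1))] with x e1 e2
  rw [e1, Pi.add_apply, e2]
  simp [sub_eq_add_neg]

lemma A_nonneg (P : Problem d) (T : Cell d) (w : E d → ℝ) : 0 ≤ P.A T w := by
  unfold A
  positivity

lemma abs_A_sub_le (hP : P.Admissible) (h₁ : IsPw 𝒯 w₁) (h₂ : IsPw 𝒯 w₂) (hT : T ∈ 𝒯.cells) :
    |P.A T w₁ - P.A T w₂| ≤ P.A T (w₁ - w₂) := by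
  have i1 := abs_toReal_eLpNorm_sub_le (h₁.memLp_gradient_cell hP.domain hT 2)
    (h₂.memLp_gradient_cell hP.domain hT 2)
  have i2 := abs_toReal_eLpNorm_sub_le (h₁.memLp_cell hP.domain hT 2)
    (h₂.memLp_cell hP.domain hT 2)
  rw [← eLpNorm_congr_ae (hP.gradient_sub_ae h₁ h₂ hT)] at i1
  have e : P.A T w₁ - P.A T w₂ = (Linf T.carrier P.β).toReal *
      ((L2 T.carrier (gradient w₁)).toReal - (L2 T.carrier (gradient w₂)).toReal) +
      (Linf T.carrier P.σ).toReal *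
      ((L2 T.carrier w₁).toReal - (L2 T.carrier w₂).toReal) := by
    unfold A
    ring
  rw [e]
  refine (abs_add_le _ _).trans ?_
  rw [abs_mul, abs_mul, abs_of_nonneg ENNReal.toReal_nonneg, abs_of_nonneg ENNReal.toReal_nonneg]
  exact add_le_add (mul_le_mul_of_nonneg_left i1 ENNReal.toReal_nonneg)
    (mul_le_mul_of_nonneg_left i2 ENNReal.toReal_nonneg)

/-- The Péclet switch does not involve `w`, so both values use the same branch. In the difference of
residuals `f` cancels, leaving `A_T` of the difference, and `‖f‖ ≤ τ` bounds a residual by its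
denominator. -/
lemma abs_ξ_sub_le (hP : P.Admissible) (h₁ : IsPw 𝒯 w₁) (h₂ : IsPw 𝒯 w₂) (hT : T ∈ 𝒯.cells) :
    |P.ξ T w₁ - P.ξ T w₂| ≤ T.diam * (2 * P.A T (w₁ - w₂) / (P.τ T).toReal) := by
  have hd0 : 0 ≤ T.diam := Metric.diam_nonneg
  have hA0 := A_nonneg P T (w₁ - w₂)
  have hf := hP.f_memLp_cell hT
  have hτ : 0 < (P.τ T).toReal := ENNReal.toReal_pos (τ_ne_zero P hf) (τ_ne_top P hf)
  unfold ξ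
  split_ifs
  swap
  · rw [sub_zero, abs_zero]; positivity
  obtain ⟨m1, -⟩ := hP.memLp_residual h₁ hT
  obtain ⟨m2, l2⟩ := hP.memLp_residual h₂ hT
  have hs : IsPw 𝒯 (w₁ - w₂) := by
    have := h₁.add (h₂.smul (-1))
    rwa [neg_one_smul, ← sub_eq_add_neg] at this
  obtain ⟨m3, l3⟩ := hP.memLp_residual hs hT
  have hr : |(L2 T.carrier (P.R w₁)).toReal - (L2 T.carrier (P.R w₂)).toReal| ≤
      P.A T (w₁ - w₂) := by
    refine (abs_toReal_eLpNorm_sub_le (m1.sub hf) (m2.sub hf)).trans ?_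
    refine le_trans (le_of_eq ?_) l3
    congr 1
    refine eLpNorm_congr_ae ?_
    filter_upwards [hP.gradient_sub_ae h₁ h₂ hT] with x hx
    simp only [Pi.sub_apply, hx, inner_sub_right]
    ring
  have hle : (L2 T.carrier (P.R w₂)).toReal ≤ P.A T w₂ + (P.τ T).toReal := by
    have h3 : L2 T.carrier (P.R w₂) ≤ _ := eLpNorm_sub_le m2.1 hf.1 (p := 2) (by norm_num)
    have h4 := ENNReal.toReal_mono
      (ENNReal.add_ne_top.2 ⟨m2.eLpNorm_ne_top, hf.eLpNorm_ne_top⟩) h3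
    rw [ENNReal.toReal_add m2.eLpNorm_ne_top hf.eLpNorm_ne_top] at h4
    exact h4.trans (add_le_add l2 (ENNReal.toReal_mono (τ_ne_top P hf) (L2_f_le_τ P T)))
  rw [mul_div_assoc, mul_div_assoc, ← mul_sub, abs_mul, abs_of_nonneg hd0]
  exact mul_le_mul_of_nonneg_left (abs_div_sub_div_le hτ (A_nonneg P T w₁) (A_nonneg P T w₂)
    ENNReal.toReal_nonneg hr (hP.abs_A_sub_le h₁ h₂ hT) hle) hd0

lemma energy_nonneg (hP : P.Admissible) (S : Set (E d)) (u : E d → ℝ) : 0 ≤ P.energy S u := by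
  have := hP.ε_pos.le
  have := hP.γ_nonneg
  unfold energy
  positivity

/-- When `γ = 0`, the assumption `‖σ‖ ≤ cσ γ` forces `σ = 0`, so `M₃` controls `σ` even though it
then omits it. -/
lemma M3_mul (hP : P.Admissible) (hT : T ∈ 𝒯.cells) (h : P.M3 T ≠ ⊤) :
    (Linf T.carrier P.β).toReal ≤ (P.M3 T).toReal * √P.ε ∧
      (Linf T.carrier P.σ).toReal ≤ (P.M3 T).toReal * √P.γ := by
  have key : ∀ {x : ℝ≥0∞} {r : ℝ}, 0 < r → x / esqrt r ≤ P.M3 T →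
      x.toReal ≤ (P.M3 T).toReal * √r := by
    intro x r hr hx
    rw [ENNReal.div_le_iff (esqrt_ne_zero hr) (esqrt_ne_top r)] at hx
    have := ENNReal.toReal_mono (ENNReal.mul_ne_top h (esqrt_ne_top r)) hx
    rwa [ENNReal.toReal_mul, toReal_esqrt] at this
  by_cases hγ : 0 < P.γ
  · have e : P.M3 T = max (Linf T.carrier P.β / esqrt P.ε) (Linf T.carrier P.σ / esqrt P.γ) :=
      if_pos hγ
    exact ⟨key hP.ε_pos (e ▸ le_max_left _ _), key hγ (e ▸ le_max_right _ _)⟩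
  · have e : P.M3 T = Linf T.carrier P.β / esqrt P.ε := if_neg hγ
    refine ⟨key hP.ε_pos e.ge, ?_⟩
    have hγ0 : P.γ = 0 := le_antisymm (not_lt.1 hγ) hP.γ_nonneg
    have h0 : Linf T.carrier P.σ ≤ 0 := by
      refine (eLpNorm_mono_measure _ (𝒯.restrict_le hP.domain hT)).trans ?_
      have := hP.σ_le
      rwa [hγ0, mul_zero, ENNReal.ofReal_zero] at this
    rw [le_antisymm h0 bot_le]
    simp [hγ0]

lemma two_mul_A_div_le (hP : P.Admissible) (hM : P.M4 𝒯 ≠ ⊤) {uh ub : E d → ℝ} (hh : uh ∈ Vh 𝒯)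
    (hb : ub ∈ Vb 𝒯) (hT : T ∈ 𝒯.cells) :
    2 * P.A T uh / (P.τ T).toReal ≤ (P.M4 𝒯).toReal * √(P.energy T.carrier (uh + ub)) := by
  have hf := hP.f_memLp_cell hT
  have hτ0 := τ_ne_zero P hf
  have hτt := τ_ne_top P hf
  have hτ : 0 < (P.τ T).toReal := ENNReal.toReal_pos hτ0 hτt
  have hle : 2 * esqrt 2 * max 1 (c1 d) * P.M3 T / P.τ T ≤ P.M4 𝒯 :=
    Finset.le_sup (f := fun T => 2 * esqrt 2 * max 1 (c1 d) * P.M3 T / P.τ T) hT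
  have hmul : 2 * esqrt 2 * max 1 (c1 d) * P.M3 T ≠ ⊤ := fun h => by
    rw [h, ENNReal.top_div_of_ne_top hτt, top_le_iff] at hle
    exact hM hle
  have h2 : 2 * esqrt 2 * max 1 (c1 d) ≠ 0 :=
    mul_ne_zero (mul_ne_zero two_ne_zero (esqrt_ne_zero two_pos))
      (zero_lt_one.trans_le (le_max_left _ _)).ne'
  have hM3 : P.M3 T ≠ ⊤ := fun h => hmul (by rw [h, ENNReal.mul_top h2])
  obtain ⟨hβ, hσ⟩ := hP.M3_mul hT hM3
  set m := (P.M3 T).toReal with hm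
  have hm0 : 0 ≤ m := ENNReal.toReal_nonneg
  set p := (L2 T.carrier (gradient (uh + ub))).toReal with hp
  set q := (L2 T.carrier (uh + ub)).toReal with hq
  have hp0 : 0 ≤ p := ENNReal.toReal_nonneg
  have hq0 : 0 ≤ q := ENNReal.toReal_nonneg
  have hen : P.energy T.carrier (uh + ub) = P.ε * p ^ 2 + P.γ * q ^ 2 := rfl
  have hgrad := toReal_L2_gradient_le hP.domain hh hb hT
  -- If `M₃` vanishes, finiteness of `M₄` says nothing about `c₁` because `∞ · 0 = 0`; but then
  -- `A_T` vanishes. Otherwise `c₁` must be finite.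
  by_cases hm3 : P.M3 T = 0
  · have hm' : m = 0 := by rw [hm, hm3, ENNReal.toReal_zero]
    rw [hm', zero_mul] at hβ hσ
    have hβ' : (Linf T.carrier P.β).toReal = 0 := le_antisymm hβ ENNReal.toReal_nonneg
    have hσ' : (Linf T.carrier P.σ).toReal = 0 := le_antisymm hσ ENNReal.toReal_nonneg
    have : P.A T uh = 0 := by simp [A, hβ', hσ']
    rw [this, mul_zero, zero_div]
    positivity
  · have hmax : max 1 (c1 d) ≠ ⊤ := fun h => hmul (by
      rw [h, ENNReal.mul_top (mul_ne_zero two_ne_zero (esqrt_ne_zero two_pos)),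
        ENNReal.top_mul hm3])
    have hc1 : c1 d ≠ ⊤ := ne_top_of_le_ne_top hmax (le_max_right _ _)
    have hmass := toReal_L2_le hP.domain hc1 hh hb hT
    set k := (max 1 (c1 d)).toReal with hk
    have hk1 : 1 ≤ k := by
      have := ENNReal.toReal_mono hmax (le_max_left 1 (c1 d))
      rwa [ENNReal.toReal_one] at this
    have hkc : (c1 d).toReal ≤ k := ENNReal.toReal_mono hmax (le_max_right 1 (c1 d))
    have hA : P.A T uh ≤ m * k * (√P.ε * p + √P.γ * q) := by
      have i1 : (Linf T.carrier P.β).toReal * (L2 T.carrier (gradient uh)).toReal ≤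
          m * √P.ε * (k * p) :=
        mul_le_mul hβ (hgrad.trans (le_mul_of_one_le_left hp0 hk1)) ENNReal.toReal_nonneg
          (by positivity)
      have i2 : (Linf T.carrier P.σ).toReal * (L2 T.carrier uh).toReal ≤ m * √P.γ * (k * q) :=
        mul_le_mul hσ (hmass.trans (mul_le_mul_of_nonneg_right hkc hq0)) ENNReal.toReal_nonneg
          (by positivity)
      unfold A
      linarith
    -- The factor `√2` in `M₄` comes from `x + y ≤ √2 √(x² + y²)`.
    have hsum : √P.ε * p + √P.γ * q ≤ √2 * √(P.energy T.carrier (uh + ub)) := by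
      rw [← Real.sqrt_mul (by norm_num), hen]
      refine Real.le_sqrt_of_sq_le ?_
      have e1 := Real.sq_sqrt hP.ε_pos.le
      have e2 := Real.sq_sqrt hP.γ_nonneg
      nlinarith [sq_nonneg (√P.ε * p - √P.γ * q)]
    have hM4 : 2 * √2 * k * m / (P.τ T).toReal ≤ (P.M4 𝒯).toReal := by
      have := ENNReal.toReal_mono hM hle
      rw [ENNReal.toReal_div, ENNReal.toReal_mul, ENNReal.toReal_mul, ENNReal.toReal_mul,
        toReal_esqrt] at this
      simpa using this
    calc 2 * P.A T uh / (P.τ T).toReal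
        ≤ 2 * (m * k * (√2 * √(P.energy T.carrier (uh + ub)))) / (P.τ T).toReal := by
          gcongr
          exact hA.trans (by gcongr)
      _ = 2 * √2 * k * m / (P.τ T).toReal * √(P.energy T.carrier (uh + ub)) := by ring
      _ ≤ _ := by gcongr

end Admissible

end Problem

/-! ### The right-hand side -/

lemma IsPw.memH1D {Ω ΓD : Set (E d)} {𝒯 : Triangulation Ω} {v : E d → ℝ} (hd : 0 < d)
    (hΩ : IsLipschitzDomain Ω) (hv : IsPw 𝒯 v) (hv0 : v =ᵐ[(surf d).restrict ΓD] 0) :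
    MemH1D Ω ΓD v (gradient v) :=
  ⟨hv.memH1 hΩ, v, hv.isTrace hd hΩ, hv0⟩

lemma IsPw.eqOn_zero_of_L2_eq_zero {Ω : Set (E d)} {𝒯 : Triangulation Ω} {v : E d → ℝ}
    (hΩ : IsLipschitzDomain Ω) (hv : IsPw 𝒯 v) (h : L2 Ω v = 0) : EqOn v 0 (closure Ω) := by
  have h1 : v =ᵐ[volume.restrict Ω] 0 :=
    (eLpNorm_eq_zero_iff (hv.aestronglyMeasurable hΩ) two_ne_zero).1 h
  have h2 : EqOn v 0 Ω := Measure.eqOn_open_of_ae_eq h1 hΩ.isOpen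
    (hv.cont.mono subset_closure) continuousOn_const
  exact h2.of_subset_closure hv.cont continuousOn_const subset_closure subset_rfl

lemma L2_le_H1norm {Ω : Set (E d)} (u : E d → ℝ) (G : E d → E d) : L2 Ω u ≤ H1norm Ω u G := by
  unfold H1norm
  calc L2 Ω u = (L2 Ω u ^ 2) ^ (1 / 2 : ℝ) := by
        rw [← ENNReal.rpow_natCast, ← ENNReal.rpow_mul]
        norm_num
    _ ≤ _ := ENNReal.rpow_le_rpow le_self_add (by norm_num)

lemma H1norm_ne_top {Ω : Set (E d)} {u : E d → ℝ} {G : E d → E d} (h : MemH1 Ω u G) :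
    H1norm Ω u G ≠ ⊤ := by
  refine ENNReal.rpow_ne_top_of_nonneg (by norm_num) (ENNReal.add_ne_top.2 ⟨?_, ?_⟩)
  · exact ENNReal.pow_ne_top h.1.eLpNorm_ne_top
  · exact ENNReal.pow_ne_top h.2.1.eLpNorm_ne_top

lemma Hhalf_le {Ω ΓN : Set (E d)} {u t : E d → ℝ} {G : E d → E d} (h : MemH1 Ω u G)
    (ht : IsTrace Ω u G t) : Hhalf Ω ΓN t ≤ H1norm Ω u G :=
  iInf_le_of_le u <| iInf_le_of_le G <| iInf_le_of_le t <| iInf_le_of_le h <| iInf_le_of_le ht <|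
    iInf_le_of_le EventuallyEq.rfl le_rfl

namespace Problem.Admissible

variable {P : Problem d} {𝒯 : Triangulation P.Ω} {v : E d → ℝ}

lemma esqrt_mul_le {r s x y : ℝ} (hr : 0 ≤ r) (hs : 0 ≤ s) {z : ℝ≥0∞} (hz : z ≠ ⊤)
    (hx : z.toReal = x) : esqrt r * z ≤ ENNReal.ofReal √(r * x ^ 2 + s * y ^ 2) := by
  have hx0 : 0 ≤ x := hx ▸ ENNReal.toReal_nonneg
  rw [← ENNReal.ofReal_toReal hz, hx, esqrt, ← ENNReal.ofReal_mul (Real.sqrt_nonneg _)]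
  refine ENNReal.ofReal_le_ofReal (Real.le_sqrt_of_sq_le ?_)
  rw [mul_pow, Real.sq_sqrt hr]
  have : 0 ≤ s * y ^ 2 := by positivity
  linarith

lemma esqrt_mul_L2_gradient_le (hP : P.Admissible) (hv : IsPw 𝒯 v) :
    esqrt P.ε * L2 P.Ω (gradient v) ≤ ENNReal.ofReal √(P.energy P.Ω v) :=
  esqrt_mul_le hP.ε_pos.le hP.γ_nonneg (hv.memLp_gradient hP.domain 2).eLpNorm_ne_top rfl

lemma esqrt_mul_L2_le (hP : P.Admissible) (hv : IsPw 𝒯 v) :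
    esqrt P.γ * L2 P.Ω v ≤ ENNReal.ofReal √(P.energy P.Ω v) := by
  unfold energy
  rw [add_comm]
  exact esqrt_mul_le hP.γ_nonneg hP.ε_pos.le (hv.memLp hP.domain 2).eLpNorm_ne_top rfl

/-- The `L²` norm is controlled either by the reaction part of the energy or, through `c₀`, by its
diffusion part; the maximum selects the better of the two. -/
lemma source_le (hd : 0 < d) (hP : P.Admissible) (hv : IsPw 𝒯 v)
    (hv0 : v =ᵐ[(surf d).restrict P.ΓD] 0)
    (hD : L2 P.Ω P.f / max (esqrt P.γ) (esqrt P.ε / c0 P.Ω P.ΓD) ≠ ⊤) :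
    ENNReal.ofReal (∫ x in P.Ω, P.f x * v x) ≤
      L2 P.Ω P.f / max (esqrt P.γ) (esqrt P.ε / c0 P.Ω P.ΓD)
        * ENNReal.ofReal √(P.energy P.Ω v) := by
  have hvL := hv.memLp hP.domain 2
  have h1 : ENNReal.ofReal (∫ x in P.Ω, P.f x * v x) ≤ L2 P.Ω P.f * L2 P.Ω v := by
    refine (ENNReal.ofReal_le_iff_le_toReal
      (ENNReal.mul_ne_top hP.f_mem.eLpNorm_ne_top hvL.eLpNorm_ne_top)).2 ?_
    have := (le_abs_self _).trans (abs_integral_inner_le hvL hP.f_mem)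
    rw [ENNReal.toReal_mul, mul_comm]
    simpa [mul_comm] using this
  have h2 : max (esqrt P.γ) (esqrt P.ε / c0 P.Ω P.ΓD) * L2 P.Ω v ≤
      ENNReal.ofReal √(P.energy P.Ω v) := by
    rcases max_choice (esqrt P.γ) (esqrt P.ε / c0 P.Ω P.ΓD) with h | h <;> rw [h]
    · exact hP.esqrt_mul_L2_le hv
    · by_cases hc : c0 P.Ω P.ΓD = ⊤
      · simp [hc]
      have h3 : L2 P.Ω v ≤ c0 P.Ω P.ΓD * L2 P.Ω (gradient v) :=
        le_sInf_mul hc (hv.memLp_gradient hP.domain 2).eLpNorm_ne_top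
          fun c hc => hc v (gradient v) (hv.memH1D hd hP.domain hv0)
      calc esqrt P.ε / c0 P.Ω P.ΓD * L2 P.Ω v
          ≤ esqrt P.ε / c0 P.Ω P.ΓD * (c0 P.Ω P.ΓD * L2 P.Ω (gradient v)) := by gcongr
        _ = esqrt P.ε / c0 P.Ω P.ΓD * c0 P.Ω P.ΓD * L2 P.Ω (gradient v) := by rw [mul_assoc]
        _ ≤ esqrt P.ε * L2 P.Ω (gradient v) := by
            gcongr
            rw [div_eq_mul_inv, mul_assoc]
            exact mul_le_of_le_one_right' (ENNReal.inv_mul_le_one _)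
        _ ≤ _ := hP.esqrt_mul_L2_gradient_le hv
  set X := max (esqrt P.γ) (esqrt P.ε / c0 P.Ω P.ΓD)
  refine h1.trans ?_
  by_cases hX : X = ⊤
  · have : L2 P.Ω v = 0 := by
      by_contra h
      rw [hX, ENNReal.top_mul h] at h2
      exact absurd h2 (not_le.2 ENNReal.ofReal_lt_top)
    simp [this]
  -- With no control of the `L²` norm, finiteness of the quotient leaves only `f = 0`.
  by_cases hX0 : X = 0
  · have : L2 P.Ω P.f = 0 := by
      by_contra h
      exact hD (by rw [hX0, ENNReal.div_zero h])
    simp [this]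
  calc L2 P.Ω P.f * L2 P.Ω v = L2 P.Ω P.f / X * X * L2 P.Ω v := by
        rw [ENNReal.div_mul_cancel hX0 hX]
    _ = L2 P.Ω P.f / X * (X * L2 P.Ω v) := mul_assoc _ _ _
    _ ≤ _ := by gcongr

/-- A piecewise smooth `v` is its own trace, so duality bounds the integral by `‖g‖ ‖v‖₁`, and `c₃`
passes to the seminorm. The remaining work excludes products `0 · ∞` and divisions by zero. -/
lemma neumann_le (hd : 0 < d) (hP : P.Admissible) (hv : IsPw 𝒯 v)
    (hv0 : v =ᵐ[(surf d).restrict P.ΓD] 0)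
    (hD : c3 P.Ω P.ΓD / esqrt P.ε * HnegHalf P.Ω P.ΓN P.g ≠ ⊤) :
    ENNReal.ofReal (∫ x in P.ΓN, P.g x * v x ∂(surf d)) ≤
      c3 P.Ω P.ΓD / esqrt P.ε * HnegHalf P.Ω P.ΓN P.g * ENNReal.ofReal √(P.energy P.Ω v) := by
  refine (Real.ofReal_le_enorm _).trans ?_
  set I := ‖∫ x in P.ΓN, P.g x * v x ∂(surf d)‖ₑ with hI
  by_cases hI0 : I = 0
  · simp [hI0]
  set K := HnegHalf P.Ω P.ΓN P.g
  set H := Hhalf P.Ω P.ΓN v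
  have hK : I / H ≤ K :=
    le_iSup (fun s : E d → ℝ => ‖∫ x in P.ΓN, P.g x * s x ∂(surf d)‖ₑ / Hhalf P.Ω P.ΓN s) v
  have hH : H ≤ H1norm P.Ω v (gradient v) :=
    Hhalf_le (hv.memH1 hP.domain) (hv.isTrace hd hP.domain)
  have hHt : H ≠ ⊤ := ne_top_of_le_ne_top (H1norm_ne_top (hv.memH1 hP.domain)) hH
  have hK0 : K ≠ 0 := fun h => by
    rw [h, nonpos_iff_eq_zero, ENNReal.div_eq_zero_iff] at hK
    exact hK.elim hI0 hHt
  have hεt := esqrt_ne_top P.ε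
  have hε0 := esqrt_ne_zero hP.ε_pos
  have hc3 : c3 P.Ω P.ΓD ≠ ⊤ := fun h => hD (by
    rw [h, ENNReal.top_div_of_ne_top hεt, ENNReal.top_mul hK0])
  have hH1 : H1norm P.Ω v (gradient v) ≤ c3 P.Ω P.ΓD * L2 P.Ω (gradient v) :=
    le_sInf_mul hc3 (hv.memLp_gradient hP.domain 2).eLpNorm_ne_top
      fun c hc => hc v (gradient v) (hv.memH1D hd hP.domain hv0)
  -- If `c₃` were zero, `v` would vanish on `closure Ω`, hence on `ΓN`, and the integral would be
  -- zero.
  have hc30 : c3 P.Ω P.ΓD ≠ 0 := fun h => by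
    rw [h, zero_mul] at hH1
    have h1 := hv.eqOn_zero_of_L2_eq_zero hP.domain
      (le_antisymm ((L2_le_H1norm v (gradient v)).trans hH1) bot_le)
    refine hI0 ?_
    rw [hI, setIntegral_eq_zero_of_forall_eq_zero, enorm_zero]
    intro x hx
    rw [h1 (frontier_subset_closure (hP.ΓN_subset hx))]
    simp
  have hKt : K ≠ ⊤ := fun h => hD (by
    rw [h, ENNReal.mul_top (ENNReal.div_pos hc30 hεt).ne'])
  have hH0 : H ≠ 0 := fun h => by
    rw [h, ENNReal.div_zero hI0, top_le_iff] at hK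
    exact hKt hK
  rw [ENNReal.div_le_iff hH0 hHt] at hK
  calc I ≤ K * (c3 P.Ω P.ΓD * L2 P.Ω (gradient v)) := hK.trans (by gcongr; exact hH.trans hH1)
    _ = K * (c3 P.Ω P.ΓD / esqrt P.ε * esqrt P.ε * L2 P.Ω (gradient v)) := by
        rw [ENNReal.div_mul_cancel hε0 hεt]
    _ = c3 P.Ω P.ΓD / esqrt P.ε * K * (esqrt P.ε * L2 P.Ω (gradient v)) := by ring
    _ ≤ _ := by
        gcongr
        exact hP.esqrt_mul_L2_gradient_le hv

lemma load_le (hd : 0 < d) (hP : P.Admissible) (hv : IsPw 𝒯 v)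
    (hv0 : v =ᵐ[(surf d).restrict P.ΓD] 0) (hD : P.D ≠ ⊤) :
    (∫ x in P.Ω, P.f x * v x) + ∫ x in P.ΓN, P.g x * v x ∂(surf d) ≤
      P.D.toReal * √(P.energy P.Ω v) := by
  obtain ⟨hD1, hD2⟩ := ENNReal.add_ne_top.1 hD
  have h := ENNReal.ofReal_add_le.trans
    (add_le_add (hP.source_le hd hv hv0 hD1) (hP.neumann_le hd hv hv0 hD2))
  rw [← add_mul] at h
  have h2 := (ENNReal.ofReal_le_iff_le_toReal
    (ENNReal.mul_ne_top hD ENNReal.ofReal_ne_top)).1 h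
  rwa [ENNReal.toReal_mul, ENNReal.toReal_ofReal (Real.sqrt_nonneg _)] at h2

end Problem.Admissible

/-! ### The scheme as a nonlinear variational problem -/

lemma toReal_L2_mono {F : Type*} [NormedAddCommGroup F] {S S' : Set (E d)} {u : E d → F}
    (hle : (volume : Measure (E d)).restrict S ≤ volume.restrict S')
    (hu : MemLp u 2 (volume.restrict S')) : (L2 S u).toReal ≤ (L2 S' u).toReal :=
  ENNReal.toReal_mono hu.eLpNorm_ne_top (eLpNorm_mono_measure u hle)

namespace Problem.Admissible

variable {P : Problem d} {𝒯 : Triangulation P.Ω}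

lemma ξ_nonneg (P : Problem d) (T : Cell d) (w : E d → ℝ) : 0 ≤ P.ξ T w := by
  have h1 : 0 ≤ T.diam := Metric.diam_nonneg
  have h2 := A_nonneg P T w
  unfold ξ
  split_ifs <;> positivity

/-- The function `u_h + u_b` with given components `u_h` and `u_b`. -/
noncomputable def total (P : Problem d) (𝒯 : Triangulation P.Ω) :
    (VhD 𝒯 P.ΓD × Vb 𝒯) →ₗ[ℝ] pwSpace 𝒯 where
  toFun p := ⟨p.1.1 + p.2.1, (isPw_of_mem_Vh p.1.2.1).add (isPw_of_mem_Vb p.2.2)⟩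
  map_add' p q := Subtype.ext (add_add_add_comm p.1.1 q.1.1 p.2.1 q.2.1)
  map_smul' c p := Subtype.ext (smul_add c p.1.1 p.2.1).symm

lemma total_ae_eq_zero (hP : P.Admissible) (p : VhD 𝒯 P.ΓD × Vb 𝒯) :
    (total P 𝒯 p).1 =ᵐ[(surf d).restrict P.ΓD] 0 := by
  filter_upwards [p.1.2.2, ae_restrict_mem hP.measurable_ΓD] with x hx hxD
  have h := (hP.ΓD_subset hxD).2
  rw [hP.domain.isOpen.interior_eq] at h
  change p.1.1 x + p.2.1 x = 0
  rw [hx, eq_zero_of_mem_Vb hP.domain p.2.2 h]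
  simp

/-- The inner product `ε (∇u, ∇v) + γ (u, v)`. -/
noncomputable def energyForm (hP : P.Admissible) (𝒯 : Triangulation P.Ω) :
    pwSpace 𝒯 →ₗ[ℝ] pwSpace 𝒯 →ₗ[ℝ] ℝ :=
  P.ε • gradForm 𝒯 hP.domain (volume.restrict P.Ω) le_rfl +
    P.γ • massForm 𝒯 hP.domain (ρ := fun _ => 1) (memLp_top_const 1)

open Classical in
/-- The form on the left-hand side of the scheme, for a given artificial diffusion. -/
noncomputable def schemeForm (hP : P.Admissible) (𝒯 : Triangulation P.Ω) (w : E d → ℝ) :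
    pwSpace 𝒯 →ₗ[ℝ] pwSpace 𝒯 →ₗ[ℝ] ℝ :=
  P.ε • gradForm 𝒯 hP.domain (volume.restrict P.Ω) le_rfl
    + convectionForm 𝒯 hP.domain (hP.memLp_β 𝒯) + massForm 𝒯 hP.domain hP.σ_mem
    + ∑ T : 𝒯.cells, P.ξ T w • gradForm 𝒯 hP.domain (volume.restrict T.1.carrier)
      (𝒯.restrict_le hP.domain T.2)

/-- The functional on the right-hand side of the scheme. -/
noncomputable def loadForm (hd : 0 < d) (hP : P.Admissible) (𝒯 : Triangulation P.Ω) :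
    pwSpace 𝒯 →ₗ[ℝ] ℝ :=
  have h1 : ∀ v : pwSpace 𝒯, Integrable (fun x => P.f x * v.1 x) (volume.restrict P.Ω) :=
    fun v => hP.f_mem.integrable_mul (IsPw.memLp hP.domain v.2 2)
  have h2 : ∀ v : pwSpace 𝒯, Integrable (fun x => P.g x * v.1 x) ((surf d).restrict P.ΓN) :=
    fun v => hP.g_mem.integrable_mul ((IsPw.memLp_frontier hd hP.domain v.2).mono_measure
      (Measure.restrict_mono_set _ hP.ΓN_subset))
  { toFun := fun v =>
      (∫ x in P.Ω, P.f x * v.1 x) + ∫ x in P.ΓN, P.g x * v.1 x ∂(surf d)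
    map_add' := fun u v => by
      simp only [Submodule.coe_add, Pi.add_apply, mul_add]
      rw [integral_add (h1 u) (h1 v), integral_add (h2 u) (h2 v)]
      ring
    map_smul' := fun c v => by
      simp only [Submodule.coe_smul, Pi.smul_apply, smul_eq_mul, mul_left_comm _ c,
        integral_const_mul, RingHom.id_apply]
      ring }

lemma schemeForm_apply (hP : P.Admissible) (w : E d → ℝ) (u v : pwSpace 𝒯) :
    hP.schemeForm 𝒯 w u v = P.B u.1 v.1 + ∑ T ∈ 𝒯.cells, P.DT T w u.1 v.1 := by
  have h : ∀ T, P.DT T w u.1 v.1 =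
      P.ξ T w * ∫ x in T.carrier, ⟪gradient u.1 x, gradient v.1 x⟫_ℝ :=
    fun T => integral_const_mul _ _
  simp only [schemeForm, LinearMap.add_apply, LinearMap.sum_apply, LinearMap.smul_apply,
    smul_eq_mul, gradForm_apply, massForm_apply, convectionForm_apply, B, h]
  rw [← Finset.sum_coe_sort 𝒯.cells]

lemma energyForm_self (hP : P.Admissible) (v : pwSpace 𝒯) :
    hP.energyForm 𝒯 v v = P.energy P.Ω v.1 := by
  have h1 := sq_toReal_eLpNorm (IsPw.memLp_gradient hP.domain v.2 2)
  have h2 := sq_toReal_eLpNorm (IsPw.memLp hP.domain v.2 2)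
  simp only [energyForm, LinearMap.add_apply, LinearMap.smul_apply, smul_eq_mul,
    gradForm_apply, massForm_apply, energy, L2, h1, h2]
  simp [pow_two]

lemma energyForm_comm (hP : P.Admissible) (u v : pwSpace 𝒯) :
    hP.energyForm 𝒯 u v = hP.energyForm 𝒯 v u := by
  simp only [energyForm, LinearMap.add_apply, LinearMap.smul_apply, smul_eq_mul,
    gradForm_apply, massForm_apply, one_mul, real_inner_comm, mul_comm]

/-- As `γ` may be zero, definiteness rests on the gradient term and the Dirichlet condition. It is
stated for the pair of components, so it also contains the directness of the sum. -/
lemma energyForm_total_pos (hd : 0 < d) (hP : P.Admissible) {p : VhD 𝒯 P.ΓD × Vb 𝒯}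
    (hp : p ≠ 0) : 0 < hP.energyForm 𝒯 (total P 𝒯 p) (total P 𝒯 p) := by
  rw [energyForm_self]
  refine (hP.energy_nonneg _ _).lt_of_ne' fun h => hp ?_
  have hv := (total P 𝒯 p).2
  have h1 : (L2 P.Ω (gradient (total P 𝒯 p).1)).toReal = 0 := by
    have e1 := hP.ε_pos
    have e2 : 0 ≤ P.γ * (L2 P.Ω (total P 𝒯 p).1).toReal ^ 2 :=
      mul_nonneg hP.γ_nonneg (sq_nonneg _)
    by_contra hne
    have e3 : 0 < P.ε * (L2 P.Ω (gradient (total P 𝒯 p).1)).toReal ^ 2 := by positivity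
    unfold energy at h
    linarith
  have hm := IsPw.memLp_gradient hP.domain hv 2
  have h2 : gradient (total P 𝒯 p).1 =ᵐ[volume.restrict P.Ω] 0 :=
    (eLpNorm_eq_zero_iff hm.1 two_ne_zero).1
      (((ENNReal.toReal_eq_zero_iff _).1 h1).resolve_right hm.eLpNorm_ne_top)
  obtain ⟨e1, e2⟩ := eq_zero_of_gradient_ae_eq_zero hd hP.domain hP.ΓD_subset
    hP.measurable_ΓD hP.ΓD_pos p.1.2 p.2.2 h2
  exact Prod.ext (Subtype.ext e1) (Subtype.ext e2)

lemma energyForm_le_schemeForm (hd : 0 < d) (hP : P.Admissible) (w : E d → ℝ)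
    {v : pwSpace 𝒯} (hv0 : v.1 =ᵐ[(surf d).restrict P.ΓD] 0) :
    hP.energyForm 𝒯 v v ≤ hP.schemeForm 𝒯 w v v := by
  have h1 := hP.convection_reaction_ge hd 𝒯 v.2 hv0
  have h2 : 0 ≤ ∑ T : 𝒯.cells, P.ξ T w *
      ∫ x in T.1.carrier, ⟪gradient v.1 x, gradient v.1 x⟫_ℝ :=
    Finset.sum_nonneg fun T _ => mul_nonneg (ξ_nonneg P T w)
      (integral_nonneg fun x => real_inner_self_nonneg)
  simp only [energyForm, schemeForm, LinearMap.add_apply, LinearMap.sum_apply,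
    LinearMap.smul_apply, smul_eq_mul, gradForm_apply, massForm_apply, convectionForm_apply,
    one_mul]
  linarith

lemma sum_L2_gradient_mul_le (hP : P.Admissible) {u v : E d → ℝ} (hu : IsPw 𝒯 u)
    (hv : IsPw 𝒯 v) :
    ∑ T ∈ 𝒯.cells, (L2 T.carrier (gradient u)).toReal * (L2 T.carrier (gradient v)).toReal ≤
      (L2 P.Ω (gradient u)).toReal * (L2 P.Ω (gradient v)).toReal := by
  have h : ∀ {w : E d → ℝ}, IsPw 𝒯 w →
      √(∑ T ∈ 𝒯.cells, (L2 T.carrier (gradient w)).toReal ^ 2) =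
        (L2 P.Ω (gradient w)).toReal := by
    intro w hw
    have hm := hw.memLp_gradient hP.domain 2
    rw [Real.sqrt_eq_iff_eq_sq (Finset.sum_nonneg fun _ _ => sq_nonneg _) ENNReal.toReal_nonneg,
      L2, sq_toReal_eLpNorm hm,
      𝒯.setIntegral_eq_sum hP.domain (integrable_inner_of_memLp hm hm)]
    exact Finset.sum_congr rfl fun T hT =>
      sq_toReal_eLpNorm (hw.memLp_gradient_cell hP.domain hT 2)
  have := Real.sum_mul_le_sqrt_mul_sqrt 𝒯.cells
    (fun T => (L2 T.carrier (gradient u)).toReal) (fun T => (L2 T.carrier (gradient v)).toReal)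
  rwa [h hu, h hv] at this

/-- Only the artificial diffusion depends on `w`. Its Lipschitz bound is uniform over the cells,
Cauchy-Schwarz sums the cell contributions, and passing from the two gradient norms to energies
costs `1 / ε`. -/
lemma abs_schemeForm_sub_le (hP : P.Admissible) (hM : P.M4 𝒯 ≠ ⊤) (hh : 𝒯.meshSize ≠ ⊤)
    (p p' : VhD 𝒯 P.ΓD × Vb 𝒯) (u v : pwSpace 𝒯) :
    |hP.schemeForm 𝒯 p.1.1 u v - hP.schemeForm 𝒯 p'.1.1 u v| ≤
      𝒯.meshSize.toReal * (P.M4 𝒯).toReal / P.ε * √(P.energy P.Ω (total P 𝒯 (p - p')).1) *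
        √(P.energy P.Ω u.1) * √(P.energy P.Ω v.1) := by
  have hε := hP.ε_pos
  set N := √(P.energy P.Ω (total P 𝒯 (p - p')).1) with hN
  set C := 𝒯.meshSize.toReal * ((P.M4 𝒯).toReal * N) with hC
  have hC0 : 0 ≤ C := by positivity
  have hξ : ∀ T ∈ 𝒯.cells, |P.ξ T p.1.1 - P.ξ T p'.1.1| ≤ C := by
    intro T hT
    have i1 := hP.abs_ξ_sub_le (isPw_of_mem_Vh p.1.2.1) (isPw_of_mem_Vh p'.1.2.1) hT
    have i2 := hP.two_mul_A_div_le hM (p - p').1.2.1 (p - p').2.2 hT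
    have i3 : T.diam ≤ 𝒯.meshSize.toReal :=
      (ENNReal.ofReal_le_iff_le_toReal hh).1
        (Finset.le_sup (f := fun T : Cell d => ENNReal.ofReal T.diam) hT)
    have hm := (total P 𝒯 (p - p')).2
    have i4 : P.energy T.carrier (total P 𝒯 (p - p')).1 ≤
        P.energy P.Ω (total P 𝒯 (p - p')).1 := by
      have j1 := toReal_L2_mono (𝒯.restrict_le hP.domain hT) (IsPw.memLp_gradient hP.domain hm 2)
      have j2 := toReal_L2_mono (𝒯.restrict_le hP.domain hT) (IsPw.memLp hP.domain hm 2)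
      have := hP.γ_nonneg
      unfold energy
      gcongr
    refine i1.trans (mul_le_mul i3 (i2.trans ?_) ?_ ENNReal.toReal_nonneg)
    · exact mul_le_mul_of_nonneg_left (Real.sqrt_le_sqrt i4) ENNReal.toReal_nonneg
    · have := A_nonneg P T (p.1.1 - p'.1.1)
      positivity
  have hG : ∀ T ∈ 𝒯.cells, |∫ x in T.carrier, ⟪gradient u.1 x, gradient v.1 x⟫_ℝ| ≤
      (L2 T.carrier (gradient u.1)).toReal * (L2 T.carrier (gradient v.1)).toReal :=
    fun T hT => abs_integral_inner_le (IsPw.memLp_gradient_cell hP.domain u.2 hT 2)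
      (IsPw.memLp_gradient_cell hP.domain v.2 hT 2)
  have hdiff : hP.schemeForm 𝒯 p.1.1 u v - hP.schemeForm 𝒯 p'.1.1 u v =
      ∑ T ∈ 𝒯.cells, (P.ξ T p.1.1 - P.ξ T p'.1.1) *
        ∫ x in T.carrier, ⟪gradient u.1 x, gradient v.1 x⟫_ℝ := by
    rw [schemeForm_apply, schemeForm_apply, add_sub_add_left_eq_sub, ← Finset.sum_sub_distrib]
    refine Finset.sum_congr rfl fun T _ => ?_
    simp only [DT, integral_const_mul, sub_mul]
  have hen : ∀ w : pwSpace 𝒯, √P.ε * (L2 P.Ω (gradient w.1)).toReal ≤ √(P.energy P.Ω w.1) := by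
    intro w
    refine Real.le_sqrt_of_sq_le ?_
    rw [mul_pow, Real.sq_sqrt hε.le]
    have := hP.γ_nonneg
    exact le_add_of_nonneg_right (by positivity)
  calc |hP.schemeForm 𝒯 p.1.1 u v - hP.schemeForm 𝒯 p'.1.1 u v|
      ≤ ∑ T ∈ 𝒯.cells, |(P.ξ T p.1.1 - P.ξ T p'.1.1) *
        ∫ x in T.carrier, ⟪gradient u.1 x, gradient v.1 x⟫_ℝ| := by
        rw [hdiff]
        exact Finset.abs_sum_le_sum_abs _ _
    _ ≤ ∑ T ∈ 𝒯.cells, C * ((L2 T.carrier (gradient u.1)).toReal *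
          (L2 T.carrier (gradient v.1)).toReal) := by
        refine Finset.sum_le_sum fun T hT => ?_
        rw [abs_mul]
        exact mul_le_mul (hξ T hT) (hG T hT) (abs_nonneg _) hC0
    _ ≤ C * ((L2 P.Ω (gradient u.1)).toReal * (L2 P.Ω (gradient v.1)).toReal) := by
        rw [← Finset.mul_sum]
        exact mul_le_mul_of_nonneg_left (hP.sum_L2_gradient_mul_le u.2 v.2) hC0
    _ = C / P.ε * ((√P.ε * (L2 P.Ω (gradient u.1)).toReal) *
          (√P.ε * (L2 P.Ω (gradient v.1)).toReal)) := by
        rw [mul_mul_mul_comm √P.ε, Real.mul_self_sqrt hε.le]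
        field_simp
    _ ≤ C / P.ε * (√(P.energy P.Ω u.1) * √(P.energy P.Ω v.1)) := by
        refine mul_le_mul_of_nonneg_left ?_ (by positivity)
        exact mul_le_mul (hen u) (hen v) (by positivity) (Real.sqrt_nonneg _)
    _ = _ := by rw [hC]; ring

/-- The artificial diffusion sees only the resolved component, so the fixed point problem is posed
on pairs `(uh, ub)`, where that component is a coordinate. -/
lemma isSolution_iff (hd : 0 < d) (hP : P.Admissible) (u : E d → ℝ) :
    P.IsSolution 𝒯 u ↔ ∃ p : VhD 𝒯 P.ΓD × Vb 𝒯, u = (total P 𝒯 p).1 ∧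
      ∀ q, hP.schemeForm 𝒯 p.1.1 (total P 𝒯 p) (total P 𝒯 q) =
        hP.loadForm hd 𝒯 (total P 𝒯 q) := by
  constructor
  · rintro ⟨uh, hh, ub, hb, rfl, h⟩
    refine ⟨(⟨uh, hh⟩, ⟨ub, hb⟩), rfl, fun q => ?_⟩
    rw [schemeForm_apply]
    exact h _ (Submodule.add_mem_sup q.1.2 q.2.2)
  · rintro ⟨p, rfl, h⟩
    refine ⟨p.1.1, p.1.2, p.2.1, p.2.2, rfl, fun v hv => ?_⟩
    obtain ⟨vh, hvh, vb, hvb, rfl⟩ := Submodule.mem_sup.1 hv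
    have := h (⟨vh, hvh⟩, ⟨vb, hvb⟩)
    rwa [schemeForm_apply] at this

lemma existsUnique_isSolution (hd : 0 < d) (hP : P.Admissible)
    (hsmall : 𝒯.meshSize < ENNReal.ofReal P.ε * (P.D)⁻¹ * (P.M4 𝒯)⁻¹) :
    ∃! u : E d → ℝ, P.IsSolution 𝒯 u := by
  have hε := hP.ε_pos
  have hne := (bot_le.trans_lt hsmall).ne'
  -- An infinite `D` or `M₄` would make the right-hand side of the smallness condition zero.
  have hM : P.M4 𝒯 ≠ ⊤ := fun h => by simp [h] at hne
  have hD : P.D ≠ ⊤ := fun h => by simp [h] at hne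
  have hh : 𝒯.meshSize ≠ ⊤ := hsmall.ne_top
  have hκ : 𝒯.meshSize.toReal * (P.M4 𝒯).toReal / P.ε * P.D.toReal < 1 := by
    -- When `D` or `M₄` is zero, its inverse is infinite and the condition cannot be read in the
    -- reals; the contraction constant is then zero.
    by_cases hD0 : P.D = 0
    · simp [hD0]
    by_cases hM0 : P.M4 𝒯 = 0
    · simp [hM0]
    have hDp := ENNReal.toReal_pos hD0 hD
    have hMp := ENNReal.toReal_pos hM0 hM
    have h1 := (ENNReal.toReal_lt_toReal hh (ENNReal.mul_ne_top (ENNReal.mul_ne_top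
      ENNReal.ofReal_ne_top (ENNReal.inv_ne_top.2 hD0)) (ENNReal.inv_ne_top.2 hM0))).2 hsmall
    rw [ENNReal.toReal_mul, ENNReal.toReal_mul, ENNReal.toReal_inv, ENNReal.toReal_inv,
      ENNReal.toReal_ofReal hε.le] at h1
    calc 𝒯.meshSize.toReal * (P.M4 𝒯).toReal / P.ε * P.D.toReal
        < P.ε * P.D.toReal⁻¹ * (P.M4 𝒯).toReal⁻¹ * (P.M4 𝒯).toReal / P.ε * P.D.toReal := by
          gcongr
      _ = 1 := by field_simp
  set s := (hP.energyForm 𝒯).compl₁₂ (total P 𝒯) (total P 𝒯) with hs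
  have hss : ∀ p, s p p = P.energy P.Ω (total P 𝒯 p).1 := fun p => hP.energyForm_self _
  obtain ⟨p, hp, huniq⟩ := existsUnique_of_contraction s
    (fun u v => hP.energyForm_comm _ _) (fun v hv => hP.energyForm_total_pos hd hv)
    (fun w => (hP.schemeForm 𝒯 w.1.1).compl₁₂ (total P 𝒯) (total P 𝒯))
    ((hP.loadForm hd 𝒯).comp (total P 𝒯)) (D := P.D.toReal) ENNReal.toReal_nonneg
    (by positivity) (fun w v => hP.energyForm_le_schemeForm hd w.1.1 (hP.total_ae_eq_zero v))
    (fun v => by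
      rw [hss]
      exact hP.load_le hd (total P 𝒯 v).2 (hP.total_ae_eq_zero v) hD)
    (fun w w' u v => by
      rw [hss, hss, hss]
      exact hP.abs_schemeForm_sub_le hM hh w w' _ _) hκ
  refine ⟨(total P 𝒯 p).1, (hP.isSolution_iff hd _).2 ⟨p, rfl, hp⟩, fun u hu => ?_⟩
  obtain ⟨q, rfl, hq⟩ := (hP.isSolution_iff hd _).1 hu
  rw [huniq q hq]

end Problem.Admissible

end DD

theorem theorem4p2 (d : ℕ) (hd : d = 2 ∨ d = 3) (P : DD.Problem d) (hP : P.Admissible)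
    (𝒯 : DD.Triangulation P.Ω)
    (hsmall : 𝒯.meshSize < ENNReal.ofReal P.ε * (P.D)⁻¹ * (P.M4 𝒯)⁻¹) :
    ∃! u : DD.E d → ℝ, P.IsSolution 𝒯 u :=
  hP.existsUnique_isSolution (by rcases hd with rfl | rfl <;> norm_num) hsmall
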